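/- **Theorem.** $\textsf{Latin Square Isotopy} \in \beta_2\mathsf{L} \cap \beta_2\mathsf{FOLL}$, where the notions are as follows. A *quasigroup* is a set $G$ with a binary operation such that for all $a, b \in G$ there are unique $x, y \in G$ with $ax = b$ and $ya = b$. The problem *Latin Square Isotopy* takes as input two finite nonempty quasigroups $L_1, L_2$, given by their multiplication tables (an element of a quasigroup of order $n$ is written with $\lceil \log_2 n \rceil$ bits), and asks whether there are bijections $\alpha, \beta, \gamma : L_1 \to L_2$ with $\alpha(x)\beta(y) = \gamma(xy)$ for all $x, y \in L_1$. As a language it is the set of binary strings that encode such pairs $(L_1, L_2)$ for which $\alpha, \beta, \gamma$ exist. $\mathsf{L}$ is the class of languages decided by deterministic Turing machines with a read-only input tape that use $O(\log n)$ cells of their work tapes on inputs of length $n$. $\mathsf{FOLL}$ is the class of languages decided by families $(C_n)_{n \in \mathbb{N}}$ of Boolean circuits with $\mathsf{NOT}$ gates and $\mathsf{AND}$, $\mathsf{OR}$ gates of unbounded fan-in, of size $n^{O(1)}$ and depth $O(\log\log n)$, that are logspace uniform: a deterministic logarithmic space machine computes $1^n \mapsto \langle C_n \rangle$. For a class $\mathcal{C}$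 of languages, $\beta_2\mathcal{C}$ is the class of languages $A$ for which there are $B \in \mathcal{C}$ and a bound $\ell(n) = O(\log^2 n)$ such that, for every $x$, $x \in A$ if and only if there is a string $y$ of length at most $\ell(|x|)$ with $(x, y) \in B$. -/

import Mathlib

namespace LatinIsotopy

/-! ### Logarithmic space Turing machines -/

/-- What the input head sees: an end marker or a bit. An input `x` of length `n` is written as
`⊢ x ⊣`: the left marker is in cell `0`, bit `j` of `x` in cell `j + 1`, the right marker in
cell `n + 1`. -/
inductive InSym
  | leftEnd
  | rightEnd
  | bit (b : Bool)

/-- The symbol in cell `p` of the input tape holding `x`. -/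
def inSym (x : List Bool) : ℕ → InSym
  | 0 => .leftEnd
  | p + 1 => if h : p < x.length then .bit x[p] else .rightEnd

/-- Head movement on a tape with cells `0, 1, 2, …`; `none` means that the head stays, and a head
on cell `0` cannot move left. -/
def moveHead : Option Turing.Dir → ℕ → ℕ
  | none, p => p
  | some .left, p => p - 1
  | some .right, p => p + 1

/-- What a machine does in one step: new state, movement of the input head, symbols written on
the `k` work tapes, movements of the work heads, and possibly a bit written on the output tape. -/
structure Action (Q Γ : Type) (k : ℕ) where
  next : Q
  inMove : Option Turing.Dir
  write : Fin k → Γ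
  move : Fin k → Option Turing.Dir
  emit : Option Bool

/-- A deterministic Turing machine with a read-only two-way input tape, `k` read-write work tapes
(infinite to the right) and a write-only one-way output tape. The machine halts where `δ` is
`none`. -/
structure Machine where
  Q : Type
  Γ : Type
  finQ : Fintype Q
  finΓ : Fintype Γ
  k : ℕ
  start : Q
  accept : Set Q
  blank : Γ
  δ : Q → InSym → (Fin k → Γ) → Option (Action Q Γ k)

namespace Machine

variable (M : Machine)

/-- A configuration: state, position of the input head, contents of the work tapes, positions of
the work heads, and the string written so far on the output tape. -/
structure Cfg where
  state : M.Q
  inPos : ℕ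
  tape : Fin M.k → ℕ → M.Γ
  head : Fin M.k → ℕ
  out : List Bool

/-- The initial configuration: work tapes blank, the input head on the left marker. -/
def init : M.Cfg where
  state := M.start
  inPos := 0
  tape := fun _ _ => M.blank
  head := fun _ => 0
  out := []

/-- The configuration after an action, on an input of length `n`. The input head cannot move
beyond the end markers. -/
def act (n : ℕ) (c : M.Cfg) (a : Action M.Q M.Γ M.k) : M.Cfg where
  state := a.next
  inPos := min (moveHead a.inMove c.inPos) (n + 1)
  tape := fun i => Function.update (c.tape i) (c.head i) (a.write i)
  head := fun i => moveHead (a.move i) (c.head i)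
  out := c.out ++ a.emit.toList

/-- One step of the computation on input `x`; `none` if the machine halts. -/
def step (x : List Bool) (c : M.Cfg) : Option M.Cfg :=
  (M.δ c.state (inSym x c.inPos) (fun i => c.tape i (c.head i))).map (M.act x.length c)

/-- On input `x` the machine only ever visits the first `s` cells of each work tape. -/
def SpaceAtMost (x : List Bool) (s : ℕ) : Prop :=
  ∀ c : M.Cfg, StateTransition.Reaches (M.step x) M.init c → ∀ i, c.head i < s

/-- On input `x` the machine halts in configuration `c`. -/
def HaltsAt (x : List Bool) (c : M.Cfg) : Prop :=
  c ∈ StateTransition.eval (M.step x) M.init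

end Machine

/-- The class `L`: languages decided by a deterministic machine that halts on every input and
uses `O(log n)` cells of its work tapes on inputs of length `n`. -/
def LogSpace : Set (Language Bool) :=
  {A | ∃ (M : Machine) (c : ℕ), ∀ x : List Bool,
    M.SpaceAtMost x (c * Nat.log 2 x.length + c) ∧
    ∃ f : M.Cfg, M.HaltsAt x f ∧ (x ∈ A ↔ f.state ∈ M.accept)}

/-- A deterministic logarithmic space machine computes the map `1ⁿ ↦ f n`. -/
def LogSpaceOnUnary (f : ℕ → List Bool) : Prop :=
  ∃ (M : Machine) (c : ℕ), ∀ n : ℕ,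
    M.SpaceAtMost (List.replicate n true) (c * Nat.log 2 n + c) ∧
    ∃ g : M.Cfg, M.HaltsAt (List.replicate n true) g ∧ g.out = f n

/-! ### Boolean circuits with gates of unbounded fan-in -/

/-- A gate: an input bit, or the negation, conjunction or disjunction of the values of gates,
which are named by their index in the circuit. -/
inductive Gate
  | input (i : ℕ)
  | not (j : ℕ)
  | and (js : List ℕ)
  | or (js : List ℕ)

/-- A circuit is the list of its gates in topological order; the last gate is the output. -/
abbrev Circuit := List Gate

namespace Gate

/-- A gate that reads `n` input bits and earlier gates `0, …, m - 1` only. -/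
def WellFormed (n m : ℕ) : Gate → Prop
  | input i => i < n
  | not j => j < m
  | and js => ∀ j ∈ js, j < m
  | or js => ∀ j ∈ js, j < m

/-- The value of a gate, given the input `x` and the values `vs` of the earlier gates. -/
def value (x vs : List Bool) : Gate → Bool
  | input i => x.getD i false
  | not j => !vs.getD j false
  | and js => js.all fun j => vs.getD j false
  | or js => js.any fun j => vs.getD j false

/-- The depth of a gate, given the depths `ds` of the earlier gates: the largest number of
non-input gates on a path ending in this gate. -/
def depth (ds : List ℕ) : Gate → ℕ
  | input _ => 0
  | not j => ds.getD j 0 + 1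
  | and js => (js.map fun j => ds.getD j 0).foldr max 0 + 1
  | or js => (js.map fun j => ds.getD j 0).foldr max 0 + 1

end Gate

/-- The number `m` as the string `1ᵐ0`. -/
def unary (m : ℕ) : List Bool := List.replicate m true ++ [false]

/-- A list of numbers: each one is preceded by `1`, and the list is closed by `0`. -/
def encodeList (js : List ℕ) : List Bool :=
  (js.flatMap fun j => true :: unary j) ++ [false]

/-- A prefix code for gates: two bits for the kind, then the arguments. -/
def Gate.encode : Gate → List Bool
  | .input i => [false, false] ++ unary i
  | .not j => [false, true] ++ unary j
  | .and js => [true, false] ++ encodeList js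
  | .or js => [true, true] ++ encodeList js

namespace Circuit

/-- A circuit with `n` input bits: it is not empty and each gate reads only input bits and
earlier gates. -/
def WellFormed (n : ℕ) (C : Circuit) : Prop :=
  C ≠ [] ∧ ∀ (m : ℕ) (h : m < C.length), C[m].WellFormed n m

/-- The values of all gates on input `x`. -/
def values (x : List Bool) (C : Circuit) : List Bool :=
  C.foldl (fun vs g => vs ++ [g.value x vs]) []

/-- The output of the circuit on input `x`. -/
def output (x : List Bool) (C : Circuit) : Bool :=
  (values x C).getLastD false

/-- The depths of all gates. -/
def depths (C : Circuit) : List ℕ :=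
  C.foldl (fun ds g => ds ++ [g.depth ds]) []

/-- The depth of the circuit: the largest depth of a gate. -/
def depth (C : Circuit) : ℕ := (depths C).foldr max 0

/-- The circuit as a binary string. Gate indices are written in unary; for circuits of polynomial
size this is, up to a logarithmic space translation, the same as writing them in binary. -/
def encode (C : Circuit) : List Bool := C.flatMap Gate.encode

end Circuit

/-- The class `FO(d(n))`: languages decided by logspace uniform families of circuits of unbounded
fan-in, of depth `O(d(n))` and of polynomial size. -/
def FO (d : ℕ → ℕ) : Set (Language Bool) :=
  {A | ∃ (C : ℕ → Circuit) (c : ℕ),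
    LogSpaceOnUnary (fun n => (C n).encode) ∧
    (∀ n, (C n).WellFormed n ∧ (C n).length ≤ c * n ^ c + c ∧ (C n).depth ≤ c * d n + c) ∧
    ∀ x : List Bool, x ∈ A ↔ (C x.length).output x = true}

/-- The class `FOLL = FO(log log n)`. -/
def FOLL : Set (Language Bool) := FO fun n => Nat.log 2 (Nat.log 2 n)

/-! ### Limited nondeterminism -/

/-- The pair `(x, y)` as a string: each bit of `x` is preceded by `1`, then come `0` and `y`. -/
def pair (x y : List Bool) : List Bool :=
  (x.flatMap fun b => [true, b]) ++ false :: y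

/-- The class `β_i 𝒞`: languages `A` for which there is `B ∈ 𝒞` such that `x ∈ A` if and only if
`(x, y) ∈ B` for some `y` of length `O(logⁱ |x|)`. -/
def Beta (i : ℕ) (𝒞 : Set (Language Bool)) : Set (Language Bool) :=
  {A | ∃ B ∈ 𝒞, ∃ c : ℕ, ∀ x : List Bool,
    x ∈ A ↔ ∃ y : List Bool, y.length ≤ c * Nat.log 2 x.length ^ i + c ∧ pair x y ∈ B}

/-! ### Latin squares -/

/-- `op` is the multiplication of a quasigroup. -/
def IsQuasigroup {G : Type*} (op : G → G → G) : Prop :=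
  ∀ a b : G, (∃! x, op a x = b) ∧ (∃! y, op y a = b)

/-- There is an isotopy `(α, β, γ)` between the two operations. -/
def Isotopic {G H : Type*} (op₁ : G → G → G) (op₂ : H → H → H) : Prop :=
  ∃ α β γ : G ≃ H, ∀ x y : G, op₂ (α x) (β y) = γ (op₁ x y)

/-- The multiplication table of an operation on `{0, …, n - 1}`, row by row, each entry written
in binary with `⌈log₂ n⌉` bits, the lowest bit first. -/
def encodeTable {n : ℕ} (op : Fin n → Fin n → Fin n) : List Bool :=
  (List.finRange n).flatMap fun i => (List.finRange n).flatMap fun j =>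
    (List.range (Nat.clog 2 n)).map fun t => (op i j : ℕ).testBit t

/-- The Latin Square Isotopy problem: the pairs of multiplication tables of isotopic (nonempty,
finite) quasigroups. -/
def LatinSquareIsotopy : Language Bool :=
  {w | ∃ (n m : ℕ) (op₁ : Fin n → Fin n → Fin n) (op₂ : Fin m → Fin m → Fin m),
    0 < n ∧ 0 < m ∧ IsQuasigroup op₁ ∧ IsQuasigroup op₂ ∧ Isotopic op₁ op₂ ∧
    w = pair (encodeTable op₁) (encodeTable op₂)}

end LatinIsotopy

/-!
Fix elements `a`, `b` and `u` of a quasigroup of order `n`. For suitable `h 0, …, h (k - 1)` with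
`k = 2 ⌈log₂ n⌉`, every element is the end `T e` of a walk from `u`, which applies in order the
shifts `v ↦ (v / b) h i` for those `i` at which the bit of `e < 2 ^ k` is set: for a random `h i`,
the expected proportion of elements that are still not reached is at most the square of the
previous one. So a certificate of `O(log² n)` bits, the elements `a`, `b`, `u` and `h i` in each of
two quasigroups, parametrizes both of them by the numbers `e`. If it consists of elements that
correspond under an isotopy, the equations `T e₃ = (T e₁ / b) (a \ T e₂)` that hold in the first
quasigroup hold in the second one as well; conversely, if they do, the parametrizations induce an
isotopy.

The conditions on a certificate are first order, except for the evaluation of walks of `k` shifts.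
A logarithmic space machine follows a walk step by step. A circuit guesses the element in the
middle of the walk and evaluates both halves in parallel, which takes `O(log k) = O(log log n)`
rounds of constant depth.
-/

namespace LatinIsotopy

/-! ### Components of machines with one work tape -/

/-- What a machine with one work tape does in one step; `X` is the type of places where the
computation can go on. -/
structure Move (X Γ : Type) where
  next : X
  inMove : Option Turing.Dir
  write : Γ
  move : Option Turing.Dir
  emit : Option Bool

/-- The same move with the place to go on renamed. -/
def Move.map {X Y Γ : Type} (f : X → Y) (a : Move X Γ) : Move Y Γ :=
  ⟨f a.next, a.inMove, a.write, a.move, a.emit⟩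

/-- The part of the configuration of a machine with one work tape that its components share, that
is, everything but the state. -/
structure Memory (Γ : Type) where
  inPos : ℕ
  tape : ℕ → Γ
  head : ℕ
  out : List Bool

/-- The memory after a move, on an input of length `n`. -/
def Memory.after {X Γ : Type} (n : ℕ) (c : Memory Γ) (a : Move X Γ) : Memory Γ where
  inPos := min (moveHead a.inMove c.inPos) (n + 1)
  tape := Function.update c.tape c.head a.write
  head := moveHead a.move c.head
  out := c.out ++ a.emit.toList

theorem Memory.after_write_self {X Γ : Type} (n : ℕ) (c : Memory Γ) (p : X)
    (d m : Option Turing.Dir) (b : Option Bool) :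
    c.after n ⟨p, d, c.tape c.head, m, b⟩ =
      ⟨min (moveHead d c.inPos) (n + 1), c.tape, moveHead m c.head, c.out ++ b.toList⟩ := by
  rw [after, Function.update_eq_self]

/-- A part of a machine with one work tape, which is entered at `start` and left by one of the
exits in `E`. -/
structure Component (Γ E : Type) where
  Q : Type
  finQ : Fintype Q
  start : Q
  δ : Q → InSym → Γ → Move (Q ⊕ E) Γ

namespace Component

variable {Γ E F : Type} {x : List Bool} {S : ℕ}

/-- The move in state `q` and memory `c`. -/
def moveAt (C : Component Γ E) (x : List Bool) (q : C.Q) (c : Memory Γ) : Move (C.Q ⊕ E) Γ :=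
  C.δ q (inSym x c.inPos) (c.tape c.head)

/-- On input `x`, the computation from a state or exit with memory `c` leaves by exit `e` with
memory `d`, and the work head only visits the first `S` cells. -/
inductive RunFrom (C : Component Γ E) (x : List Bool) (S : ℕ) :
    C.Q ⊕ E → Memory Γ → E → Memory Γ → Prop
  | done {e c} (hS : c.head < S) : RunFrom C x S (.inr e) c e c
  | step {q c e d} (hS : c.head < S)
      (h : RunFrom C x S (C.moveAt x q c).next (c.after x.length (C.moveAt x q c)) e d) :
      RunFrom C x S (.inl q) c e d

/-- The computation of a component from its start. -/
def Run (C : Component Γ E) (x : List Bool) (S : ℕ) : Memory Γ → E → Memory Γ → Prop :=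
  C.RunFrom x S (.inl C.start)

theorem RunFrom.step_of {C : Component Γ E} {q : C.Q} {p : C.Q ⊕ E} {c c₁ c' : Memory Γ} {e : E}
    (a : Move (C.Q ⊕ E) Γ) (ha : C.moveAt x q c = a) (hp : a.next = p)
    (hc : c.after x.length a = c₁) (hS : c.head < S) (h : C.RunFrom x S p c₁ e c') :
    C.RunFrom x S (.inl q) c e c' := by
  subst ha hp hc
  exact .step hS h

-- `D` contains a copy of `C` in which exit `e` is replaced by `k e`.
theorem RunFrom.simulate {C : Component Γ E} {D : Component Γ F} {j : C.Q → D.Q} {k : E → D.Q ⊕ F}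
    (hδ : ∀ q i g, D.δ (j q) i g = (C.δ q i g).map (Sum.elim (.inl ∘ j) k)) {p : C.Q ⊕ E}
    {c c₁ c₂ : Memory Γ} {e : E} {f : F} (h : C.RunFrom x S p c e c₁)
    (h' : D.RunFrom x S (k e) c₁ f c₂) :
    D.RunFrom x S (Sum.elim (.inl ∘ j) k p) c f c₂ := by
  induction h with
  | done => exact h'
  | @step q c _ _ hS _ ih =>
    exact .step_of ((C.moveAt x q c).map _) (hδ q _ _) rfl rfl hS (ih h')

theorem RunFrom.head_lt {C : Component Γ E} {p : C.Q ⊕ E} {c c' : Memory Γ} {e : E}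
    (h : C.RunFrom x S p c e c') : c'.head < S := by
  induction h with
  | done hS => exact hS
  | step _ _ ih => exact ih

/-- The component with its exits renamed. -/
def map (f : E → F) (C : Component Γ E) : Component Γ F where
  Q := C.Q
  finQ := C.finQ
  start := C.start
  δ q i g := (C.δ q i g).map (Sum.map id f)

theorem Run.map {C : Component Γ E} {c c' : Memory Γ} {e : E} (f : E → F) (h : C.Run x S c e c') :
    (C.map f).Run x S c (f e) c' :=
  RunFrom.simulate (C := C) (D := C.map f) (j := id) (k := .inr ∘ f) (fun _ _ _ => rfl) h
    (.done h.head_lt)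

/-- Sequential composition: on exit `e` of `C` go on with `D e`. -/
def bind [Fintype E] (C : Component Γ E) (D : E → Component Γ F) : Component Γ F where
  Q := C.Q ⊕ (Σ e, (D e).Q)
  finQ :=
    letI := C.finQ
    letI := fun e => (D e).finQ
    inferInstance
  start := .inl C.start
  δ
    | .inl q, i, g => (C.δ q i g).map (Sum.elim (.inl ∘ .inl) fun e => .inl (.inr ⟨e, (D e).start⟩))
    | .inr ⟨e, q⟩, i, g => ((D e).δ q i g).map (Sum.elim (.inl ∘ fun q => .inr ⟨e, q⟩) .inr)

theorem Run.bind [Fintype E] {C : Component Γ E} {D : E → Component Γ F} {c c₁ c₂ : Memory Γ}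
    {e : E} {f : F} (h : C.Run x S c e c₁) (h' : (D e).Run x S c₁ f c₂) :
    (C.bind D).Run x S c f c₂ :=
  RunFrom.simulate (D := C.bind D) (fun _ _ _ => rfl) h
    (RunFrom.simulate (D := C.bind D) (j := fun q => .inr ⟨e, q⟩) (k := .inr) (fun _ _ _ => rfl) h'
      (.done h'.head_lt))

/-- Repeat `D` until the test `C` leaves by `true`. -/
def loopUntil (C : Component Γ Bool) (D : Component Γ Unit) : Component Γ Unit where
  Q := C.Q ⊕ D.Q
  finQ :=
    letI := C.finQ
    letI := D.finQ
    inferInstance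
  start := .inl C.start
  δ
    | .inl q, i, g => (C.δ q i g).map
        (Sum.elim (.inl ∘ .inl) fun b => if b then .inr () else .inl (.inr D.start))
    | .inr q, i, g => (D.δ q i g).map (Sum.elim (.inl ∘ .inr) fun _ => .inl (.inl C.start))

theorem Run.loopUntil_done {C : Component Γ Bool} {D : Component Γ Unit} {c c' : Memory Γ}
    (h : C.Run x S c true c') : (C.loopUntil D).Run x S c () c' :=
  RunFrom.simulate (D := C.loopUntil D) (fun _ _ _ => rfl) h (.done h.head_lt)

theorem Run.loopUntil_step {C : Component Γ Bool} {D : Component Γ Unit} {c c₁ c₂ c₃ : Memory Γ}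
    (htest : C.Run x S c false c₁) (hbody : D.Run x S c₁ () c₂)
    (hloop : (C.loopUntil D).Run x S c₂ () c₃) : (C.loopUntil D).Run x S c () c₃ :=
  RunFrom.simulate (D := C.loopUntil D) (fun _ _ _ => rfl) htest
    (RunFrom.simulate (D := C.loopUntil D) (k := fun _ => .inl (.inl C.start))
      (fun _ _ _ => rfl) hbody hloop)

/-- A single step that leaves the work tape alone and the component by an exit depending on the
input symbol. -/
def atom (f : InSym → E) (d : Option Turing.Dir) (b : Option Bool) : Component Γ E where
  Q := Unit
  finQ := inferInstance
  start := ()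
  δ _ i g := ⟨.inr (f i), d, g, none, b⟩

theorem run_atom (f : InSym → E) (d : Option Turing.Dir) (b : Option Bool) {c : Memory Γ}
    (hS : c.head < S) : (atom f d b).Run x S c (f (inSym x c.inPos))
      ⟨min (moveHead d c.inPos) (x.length + 1), c.tape, c.head, c.out ++ b.toList⟩ :=
  .step_of ⟨.inr (f (inSym x c.inPos)), d, c.tape c.head, none, b⟩ rfl rfl
    (c.after_write_self _ _ _ _ _) hS (.done hS)

theorem inSym_succ_ne_leftEnd (x : List Bool) (p : ℕ) : inSym x (p + 1) ≠ .leftEnd := by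
  rw [inSym]
  split <;> exact InSym.noConfusion

/-- Move the input head to the left end marker. -/
def rewind : Component Γ Unit where
  Q := Unit
  finQ := inferInstance
  start := ()
  δ
    | _, .leftEnd, g => ⟨.inr (), none, g, none, none⟩
    | _, _, g => ⟨.inl (), some .left, g, none, none⟩

theorem moveAt_rewind_succ {p h : ℕ} {t : ℕ → Γ} {o : List Bool} :
    rewind.moveAt x () ⟨p + 1, t, h, o⟩ = ⟨.inl (), some .left, t h, none, none⟩ := by
  have hne := inSym_succ_ne_leftEnd x p
  simp only [moveAt]
  revert hne
  cases inSym x (p + 1) <;> simp [rewind]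

theorem run_rewind {c : Memory Γ} (hS : c.head < S) (hp : c.inPos ≤ x.length + 1) :
    rewind.Run x S c () ⟨0, c.tape, c.head, c.out⟩ := by
  obtain ⟨p, t, h, o⟩ := c
  induction p with
  | zero =>
    exact .step_of ⟨.inr (), none, t h, none, none⟩ rfl rfl (by simp [Memory.after, moveHead]) hS
      (.done hS)
  | succ p ih =>
    have hp' : p ≤ x.length + 1 := (Nat.le_succ p).trans hp
    exact .step_of _ moveAt_rewind_succ rfl (by simp [Memory.after, moveHead, hp']) hS (ih hS hp')

variable [Fintype Γ] {blank : Γ}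

/-- The machine that runs the component and accepts on exit `true`. -/
def toMachine (C : Component Γ Bool) (blank : Γ) : Machine where
  Q := C.Q ⊕ Bool
  Γ := Γ
  finQ := letI := C.finQ; inferInstance
  finΓ := inferInstance
  k := 1
  start := .inl C.start
  accept := {.inr true}
  blank := blank
  δ
    | .inl q, i, g =>
      let a := C.δ q i (g 0)
      some ⟨a.next, a.inMove, fun _ => a.write, fun _ => a.move, a.emit⟩
    | .inr _, _, _ => none

/-- The configuration of `toMachine` given by its state and the memory. -/
def toCfg (C : Component Γ Bool) (blank : Γ) (p : C.Q ⊕ Bool) (c : Memory Γ) :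
    (C.toMachine blank).Cfg :=
  ⟨p, c.inPos, fun _ => c.tape, fun _ => c.head, c.out⟩

theorem step_toCfg_inl (C : Component Γ Bool) (q : C.Q) (c : Memory Γ) :
    (C.toMachine blank).step x (C.toCfg blank (.inl q) c) =
      some (C.toCfg blank (C.moveAt x q c).next (c.after x.length (C.moveAt x q c))) := rfl

theorem step_toCfg_inr (C : Component Γ Bool) (e : Bool) (c : Memory Γ) :
    (C.toMachine blank).step x (C.toCfg blank (.inr e) c) = none := rfl

theorem RunFrom.reaches {C : Component Γ Bool} {p : C.Q ⊕ Bool} {c c' : Memory Γ} {e : Bool}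
    (h : C.RunFrom x S p c e c') :
    StateTransition.Reaches ((C.toMachine blank).step x) (C.toCfg blank p c)
      (C.toCfg blank (.inr e) c') := by
  induction h with
  | done => exact .refl
  | step _ _ ih => exact .head (step_toCfg_inl C _ _) ih

theorem RunFrom.head_lt_of_reaches {C : Component Γ Bool} {p : C.Q ⊕ Bool} {c c' : Memory Γ}
    {e : Bool} (h : C.RunFrom x S p c e c') {d : (C.toMachine blank).Cfg}
    (hd : StateTransition.Reaches ((C.toMachine blank).step x) (C.toCfg blank p c) d) (i) :
    d.head i < S := by
  induction h with
  | done hS =>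
    obtain rfl | ⟨_, h', _⟩ := hd.cases_head
    · exact hS
    · cases h'
  | step hS _ ih =>
    obtain rfl | ⟨_, h', h''⟩ := hd.cases_head
    · exact hS
    · cases h'
      exact ih h''

theorem Run.spaceAtMost_and_haltsAt {C : Component Γ Bool} {c : Memory Γ} {e : Bool}
    (h : C.Run x S ⟨0, fun _ => blank, 0, []⟩ e c) :
    (C.toMachine blank).SpaceAtMost x S ∧
      (C.toMachine blank).HaltsAt x (C.toCfg blank (.inr e) c) :=
  ⟨fun _ hd => h.head_lt_of_reaches hd,
    StateTransition.mem_eval.2 ⟨h.reaches, step_toCfg_inr C e c⟩⟩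

end Component

/-! ### Sweeps over a work tape with several tracks -/

/-- Work tape symbols: blank (`none`), the left marker (`some none`), or a cell with one bit on each
of `K` tracks. -/
abbrev Sym (K : ℕ) := Option (Option (Fin K → Bool))

/-- The tape with the left marker, the cells `D 0, …, D (ℓ - 1)`, and blanks. -/
def tapeOf {K : ℕ} (ℓ : ℕ) (D : ℕ → Fin K → Bool) : ℕ → Sym K
  | 0 => some none
  | i + 1 => if i < ℓ then some (some (D i)) else none

/-- A finite automaton with states `true` and `false` that rewrites the cells it reads. -/
abbrev Transducer (K : ℕ) := Bool → (Fin K → Bool) → Bool × (Fin K → Bool)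

section

variable {K ℓ i : ℕ} {D D' : ℕ → Fin K → Bool}

theorem tapeOf_succ_of_lt (h : i < ℓ) : tapeOf ℓ D (i + 1) = some (some (D i)) := if_pos h

theorem tapeOf_succ_self : tapeOf ℓ D (ℓ + 1) = none := if_neg (lt_irrefl ℓ)

theorem tapeOf_succ_ne_marker : tapeOf ℓ D (i + 1) ≠ some none := by
  rw [tapeOf]
  split <;> simp

theorem tapeOf_congr (h : ∀ i < ℓ, D i = D' i) : tapeOf ℓ D = tapeOf ℓ D' := by
  funext i
  cases i with
  | zero => rfl
  | succ i =>
    simp only [tapeOf]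
    split
    · rw [h i ‹_›]
    · rfl

theorem update_tapeOf (h : i ≤ ℓ) (d : Fin K → Bool) :
    Function.update (tapeOf ℓ D) (i + 1) (some (some d)) =
      tapeOf (max ℓ (i + 1)) (Function.update D i d) := by
  funext j
  rcases j with _ | j
  · rfl
  · rcases eq_or_ne j i with rfl | hj
    · simp [tapeOf]
    · have hlt : j < max ℓ (i + 1) ↔ j < ℓ := by omega
      rw [Function.update_of_ne (by omega)]
      simp only [tapeOf, Function.update_of_ne hj, hlt]

end

namespace Transducer

variable {K : ℕ} (f : Transducer K) (σ₀ : Bool) (D : ℕ → Fin K → Bool)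

/-- The state of the transducer before it reads cell `i`. -/
def state : ℕ → Bool
  | 0 => σ₀
  | i + 1 => (f (state i) (D i)).1

/-- What the transducer writes into cell `i`. -/
def write (i : ℕ) : Fin K → Bool := (f (f.state σ₀ D i) (D i)).2

/-- The cells after the transducer has rewritten the first `i` of them. -/
def partialWrite (i j : ℕ) : Fin K → Bool := if j < i then f.write σ₀ D j else D j

theorem partialWrite_zero : f.partialWrite σ₀ D 0 = D := rfl

theorem update_partialWrite (i : ℕ) :
    Function.update (f.partialWrite σ₀ D i) i (f.write σ₀ D i) = f.partialWrite σ₀ D (i + 1) := by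
  funext j
  rcases eq_or_ne j i with rfl | hj
  · simp [partialWrite]
  · have hlt : j < i + 1 ↔ j < i := by omega
    simp only [partialWrite, Function.update_of_ne hj, hlt]

theorem tapeOf_partialWrite (ℓ : ℕ) :
    tapeOf ℓ (f.partialWrite σ₀ D ℓ) = tapeOf ℓ (f.write σ₀ D) :=
  tapeOf_congr fun _ hj => if_pos hj

end Transducer

namespace Component

/-- Sweep over the cells with the transducer `f`, append a cell if `ext` is set and the final state
is `true`, return to the left marker, and leave by the final state. The states `inl σ` move
rightwards, the states `inr σ` leftwards. -/
def sweep {K : ℕ} (f : Transducer K) (σ₀ ext : Bool) : Component (Sym K) Bool where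
  Q := Bool ⊕ Bool
  finQ := inferInstance
  start := .inl σ₀
  δ
    | .inl σ, _, some none => ⟨.inl (.inl σ), none, some none, some .right, none⟩
    | .inl σ, _, some (some d) =>
      ⟨.inl (.inl (f σ d).1), none, some (some (f σ d).2), some .right, none⟩
    | .inl σ, _, none =>
      ⟨.inl (.inr σ), none, if ext && σ then some (some (f σ fun _ => false).2) else none,
        some .left, none⟩
    | .inr σ, _, some none => ⟨.inr σ, none, some none, none, none⟩
    | .inr σ, _, g => ⟨.inl (.inr σ), none, g, some .left, none⟩

variable {K : ℕ} {f : Transducer K} {σ₀ ext : Bool} {x : List Bool} {S ℓ p : ℕ}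
  {D : ℕ → Fin K → Bool} {o : List Bool}

theorem runFrom_sweep_left (σ : Bool) {h : ℕ} (hS : h < S) (hp : p ≤ x.length + 1) :
    (sweep f σ₀ ext).RunFrom x S (.inl (.inr σ)) ⟨p, tapeOf ℓ D, h, o⟩ σ ⟨p, tapeOf ℓ D, 0, o⟩ := by
  induction h with
  | zero =>
    refine .step_of ⟨.inr σ, none, tapeOf ℓ D 0, none, none⟩ rfl rfl ?_ hS (.done hS)
    rw [Memory.after_write_self (c := ⟨p, tapeOf ℓ D, 0, o⟩)]
    simp [moveHead, hp]
  | succ h ih =>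
    refine .step_of ⟨.inl (.inr σ), none, tapeOf ℓ D (h + 1), some .left, none⟩ ?_ rfl ?_ hS
      (ih (by omega))
    · have hne := tapeOf_succ_ne_marker (i := h) (ℓ := ℓ) (D := D)
      simp only [moveAt]
      match hg : tapeOf ℓ D (h + 1) with
      | none => rfl
      | some none => exact absurd hg hne
      | some (some d) => rfl
    · rw [Memory.after_write_self (c := ⟨p, tapeOf ℓ D, h + 1, o⟩)]
      simp [moveHead, hp]

theorem runFrom_sweep_turn (hD : D ℓ = fun _ => false) (hS : ℓ + 1 < S) (hp : p ≤ x.length + 1) :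
    (sweep f σ₀ ext).RunFrom x S (.inl (.inl (f.state σ₀ D ℓ)))
      ⟨p, tapeOf ℓ (f.write σ₀ D), ℓ + 1, o⟩ (f.state σ₀ D ℓ)
      ⟨p, tapeOf (if ext && f.state σ₀ D ℓ then ℓ + 1 else ℓ) (f.write σ₀ D), 0, o⟩ := by
  have hw : (f (f.state σ₀ D ℓ) fun _ => false).2 = f.write σ₀ D ℓ := by
    rw [Transducer.write, hD]
  refine .step_of ⟨.inl (.inr (f.state σ₀ D ℓ)), none,
    if ext && f.state σ₀ D ℓ then some (some (f.write σ₀ D ℓ)) else none, some .left, none⟩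
    ?_ rfl ?_ hS (runFrom_sweep_left _ (h := ℓ) (by omega) hp)
  · simp only [moveAt, tapeOf_succ_self, sweep, hw]
  · have htape : Function.update (tapeOf ℓ (f.write σ₀ D)) (ℓ + 1)
        (if ext && f.state σ₀ D ℓ then some (some (f.write σ₀ D ℓ)) else none) =
        tapeOf (if ext && f.state σ₀ D ℓ then ℓ + 1 else ℓ) (f.write σ₀ D) := by
      split
      · rw [update_tapeOf le_rfl, Function.update_eq_self, max_eq_right ℓ.le_succ]
      · rw [Function.update_eq_self_iff, tapeOf_succ_self]
    simp only [Memory.after, htape]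
    simp [moveHead, hp]

theorem runFrom_sweep_right (hD : D ℓ = fun _ => false) (hS : ℓ + 1 < S) (hp : p ≤ x.length + 1)
    {i : ℕ} (hi : i ≤ ℓ) :
    (sweep f σ₀ ext).RunFrom x S (.inl (.inl (f.state σ₀ D i)))
      ⟨p, tapeOf ℓ (f.partialWrite σ₀ D i), i + 1, o⟩ (f.state σ₀ D ℓ)
      ⟨p, tapeOf (if ext && f.state σ₀ D ℓ then ℓ + 1 else ℓ) (f.write σ₀ D), 0, o⟩ := by
  induction hi using Nat.decreasingInduction with
  | self =>
    rw [f.tapeOf_partialWrite]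
    exact runFrom_sweep_turn hD hS hp
  | of_succ i hi ih =>
    refine .step_of ⟨.inl (.inl (f.state σ₀ D (i + 1))), none, some (some (f.write σ₀ D i)),
      some .right, none⟩ ?_ rfl ?_ (show i + 1 < S by omega) ih
    · have hDi : f.partialWrite σ₀ D i i = D i := if_neg (lt_irrefl i)
      simp only [moveAt, tapeOf_succ_of_lt hi, sweep, hDi]
      rfl
    · simp only [Memory.after, update_tapeOf hi.le, f.update_partialWrite]
      simp [moveHead, hp, hi]

theorem run_sweep (hD : D ℓ = fun _ => false) (hS : ℓ + 1 < S) (hp : p ≤ x.length + 1) :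
    (sweep f σ₀ ext).Run x S ⟨p, tapeOf ℓ D, 0, o⟩ (f.state σ₀ D ℓ)
      ⟨p, tapeOf (if ext && f.state σ₀ D ℓ then ℓ + 1 else ℓ) (f.write σ₀ D), 0, o⟩ := by
  refine .step_of ⟨.inl (.inl σ₀), none, tapeOf ℓ D 0, some .right, none⟩ rfl rfl ?_
    (show 0 < S by omega) (runFrom_sweep_right hD hS hp ℓ.zero_le)
  rw [Memory.after_write_self (c := ⟨p, tapeOf ℓ D, 0, o⟩)]
  simp [moveHead, hp, Transducer.partialWrite_zero]

end Component

/-! ### Register programs -/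

/-- What a register program works on: registers, the position of the input head, the output. -/
structure Store where
  reg : ℕ → ℕ
  pos : ℕ
  out : List Bool

namespace Store

/-- The store at the start of a program. -/
def init : Store := ⟨fun _ => 0, 0, []⟩

/-- The store with register `r` set to `v`. -/
def set (s : Store) (r v : ℕ) : Store := { s with reg := Function.update s.reg r v }

end Store

/-- Whether the input symbol is the bit `1`. -/
def InSym.isOne : InSym → Bool
  | bit b => b
  | _ => false

/-- Whether the input symbol is the right end marker. -/
def InSym.isRightEnd : InSym → Bool
  | rightEnd => true
  | _ => false

/-- Tests of a register program: equality of registers, input symbol `1`, right end of the input. -/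
inductive Test
  | eq (r t : ℕ)
  | isOne
  | isEnd

namespace Test

/-- The result of a test. -/
def eval (x : List Bool) (s : Store) : Test → Bool
  | eq r t => decide (s.reg r = s.reg t)
  | isOne => (inSym x s.pos).isOne
  | isEnd => (inSym x s.pos).isRightEnd

/-- A bound for the registers of a test. -/
def width : Test → ℕ
  | eq r t => max r t + 1
  | _ => 0

end Test

/-- Register programs; `loop T P` repeats `P` until `T` holds. -/
inductive Prog
  | inc (r : ℕ)
  | clear (r : ℕ)
  | copy (r t : ℕ)
  | emit (b : Bool)
  | home
  | right
  | seq (P Q : Prog)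
  | ite (T : Test) (P Q : Prog)
  | loop (T : Test) (P : Prog)

/-- A bound for the registers of a program. -/
def Prog.width : Prog → ℕ
  | inc r => r + 1
  | clear r => r + 1
  | copy r t => max r t + 1
  | seq P Q => max P.width Q.width
  | ite T P Q => max T.width (max P.width Q.width)
  | loop T P => max T.width P.width
  | _ => 0

/-- `Exec x B P s s'`: on input `x`, program `P` takes store `s` to `s'`, and no register is
increased beyond `B` on the way. -/
inductive Exec (x : List Bool) (B : ℕ) : Prog → Store → Store → Prop
  | inc {r s} (h : s.reg r + 1 ≤ B) : Exec x B (.inc r) s (s.set r (s.reg r + 1))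
  | clear {r s} : Exec x B (.clear r) s (s.set r 0)
  | copy {r t s} : Exec x B (.copy r t) s (s.set r (s.reg t))
  | emit {b s} : Exec x B (.emit b) s { s with out := s.out ++ [b] }
  | home {s} : Exec x B .home s { s with pos := 0 }
  | right {s} : Exec x B .right s { s with pos := min (s.pos + 1) (x.length + 1) }
  | seq {P Q s₁ s₂ s₃} (h : Exec x B P s₁ s₂) (h' : Exec x B Q s₂ s₃) : Exec x B (.seq P Q) s₁ s₃
  | iteTrue {T P Q s s'} (hT : T.eval x s = true) (h : Exec x B P s s') :
      Exec x B (.ite T P Q) s s'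
  | iteFalse {T P Q s s'} (hT : T.eval x s = false) (h : Exec x B Q s s') :
      Exec x B (.ite T P Q) s s'
  | loopDone {T P s} (hT : T.eval x s = true) : Exec x B (.loop T P) s s
  | loopStep {T P s₁ s₂ s₃} (hT : T.eval x s₁ = false) (h : Exec x B P s₁ s₂)
      (h' : Exec x B (.loop T P) s₂ s₃) : Exec x B (.loop T P) s₁ s₃

theorem Exec.mono {x : List Bool} {B B' : ℕ} {P : Prog} {s s' : Store} (h : Exec x B P s s')
    (hB : B ≤ B') : Exec x B' P s s' := by
  induction h with
  | inc h => exact .inc (h.trans hB)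
  | clear => exact .clear
  | copy => exact .copy
  | emit => exact .emit
  | home => exact .home
  | right => exact .right
  | seq _ _ h₁ h₂ => exact .seq h₁ h₂
  | iteTrue hT _ ih => exact .iteTrue hT ih
  | iteFalse hT _ ih => exact .iteFalse hT ih
  | loopDone hT => exact .loopDone hT
  | loopStep hT _ _ h₁ h₂ => exact .loopStep hT h₁ h₂

theorem eq_iff_forall_testBit_eq {a b ℓ : ℕ} (ha : a < 2 ^ ℓ) (hb : b < 2 ^ ℓ) :
    a = b ↔ ∀ j < ℓ, a.testBit j = b.testBit j := by
  refine ⟨fun h _ _ => by rw [h], fun h => Nat.eq_of_testBit_eq fun j => ?_⟩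
  rcases lt_or_ge j ℓ with hj | hj
  · exact h j hj
  · have hpow := Nat.pow_le_pow_right two_pos hj
    rw [Nat.testBit_lt_two_pow (ha.trans_le hpow), Nat.testBit_lt_two_pow (hb.trans_le hpow)]

theorem testBit_add_carry (v i : ℕ) (c : ℕ → Bool) (hc : ∀ i, c (i + 1) = (c i && v.testBit i)) :
    (v + (c 0).toNat).testBit i = xor (c i) (v.testBit i) := by
  induction i generalizing v c with
  | zero =>
    rcases Nat.mod_two_eq_zero_or_one v with h | h <;> cases c 0 <;>
      simp [Nat.testBit_zero, Nat.add_mod, h]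
  | succ i ih =>
    have hdiv : (v + (c 0).toNat) / 2 = v / 2 + (c 1).toNat := by
      rw [hc 0, Nat.testBit_zero]
      rcases Nat.mod_two_eq_zero_or_one v with h | h <;> cases c 0 <;> simp [h] <;> omega
    rw [Nat.testBit_succ, Nat.testBit_succ, hdiv]
    exact ih (v / 2) (fun i => c (i + 1)) fun i => by rw [hc, Nat.testBit_succ]

theorem carry_iff_of_lt_two_pow {v ℓ : ℕ} (hv : v < 2 ^ ℓ) {c : ℕ → Bool} (h0 : c 0 = true)
    (hc : ∀ i, c (i + 1) = (c i && v.testBit i)) : c ℓ = true ↔ v + 1 = 2 ^ ℓ := by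
  have hbit := testBit_add_carry v ℓ c hc
  rw [Nat.testBit_lt_two_pow hv, Bool.xor_false, h0, Bool.toNat_true] at hbit
  rw [← hbit]
  refine ⟨fun h => le_antisymm hv (Nat.ge_two_pow_of_testBit h), fun h => ?_⟩
  rw [h, Nat.testBit_two_pow_self]

/-! ### Compilation of programs to components -/

/-- Bit `i` of the registers below `K`. -/
def digits (K : ℕ) (reg : ℕ → ℕ) (i : ℕ) : Fin K → Bool := fun r => (reg r).testBit i

/-- Track `r` of a cell, and `false` if there is no such track. -/
def getTrack {K : ℕ} (d : Fin K → Bool) (r : ℕ) : Bool := if h : r < K then d ⟨r, h⟩ else false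

/-- A cell with track `r` replaced. -/
def setTrack {K : ℕ} (d : Fin K → Bool) (r : ℕ) (b : Bool) : Fin K → Bool :=
  fun i => if i.val = r then b else d i

section

variable {K ℓ : ℕ} {reg : ℕ → ℕ}

theorem getTrack_digits (reg : ℕ → ℕ) (i : ℕ) {r : ℕ} (h : r < K) :
    getTrack (digits K reg i) r = (reg r).testBit i := by
  simp [getTrack, digits, h]

theorem setTrack_digits (reg : ℕ → ℕ) (i r v : ℕ) :
    setTrack (digits K reg i) r (v.testBit i) = digits K (Function.update reg r v) i := by
  funext j
  simp only [setTrack, digits, Function.update_apply]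
  split <;> rfl

theorem digits_eq_false (h : ∀ r < K, reg r < 2 ^ ℓ) : digits K reg ℓ = fun _ => false :=
  funext fun r => Nat.testBit_lt_two_pow (h r r.2)

end

section Compilation

open Component

/-- The component performing a test. -/
def Test.comp (K : ℕ) : Test → Component (Sym K) Bool
  | eq r t => sweep (fun σ d => (σ && (getTrack d r == getTrack d t), d)) true false
  | isOne => atom InSym.isOne none none
  | isEnd => atom InSym.isRightEnd none none

/-- The component that increases register `r` by one; the state of the sweep is the carry. -/
def incComp (K r : ℕ) : Component (Sym K) Unit :=
  (sweep (fun σ d => (σ && getTrack d r, setTrack d r (xor σ (getTrack d r)))) true true).map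
    fun _ => ()

/-- The component that sets register `r` to a value whose digits are computed by `g` from the digits
of the registers at the same position. -/
def assignComp (K r : ℕ) (g : (Fin K → Bool) → Bool) : Component (Sym K) Unit :=
  (sweep (fun _ d => (false, setTrack d r (g d))) false false).map fun _ => ()

/-- The component performing a program. -/
def Prog.comp (K : ℕ) : Prog → Component (Sym K) Unit
  | inc r => incComp K r
  | clear r => assignComp K r fun _ => false
  | copy r t => assignComp K r fun d => getTrack d t
  | emit b => atom (fun _ => ()) none (some b)
  | home => rewind
  | right => atom (fun _ => ()) (some .right) none
  | seq P Q => (P.comp K).bind fun _ => Q.comp K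
  | ite T P Q => (T.comp K).bind fun b => if b then P.comp K else Q.comp K
  | loop T P => (T.comp K).loopUntil (P.comp K)

namespace Store

/-- The memory that holds the registers below `K` of a store in cells of `K` tracks. -/
def memory (K ℓ : ℕ) (s : Store) : Memory (Sym K) :=
  ⟨s.pos, tapeOf ℓ (digits K s.reg), 0, s.out⟩

/-- The registers below `K` of the store are held by the memory in at most `L` cells, on an input of
length `n`. -/
def StoredIn (n K L : ℕ) (s : Store) (m : Memory (Sym K)) : Prop :=
  s.pos ≤ n + 1 ∧ ∃ ℓ ≤ L, (∀ r < K, s.reg r < 2 ^ ℓ) ∧ m = s.memory K ℓ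

theorem set_lt {K b r v : ℕ} {s : Store} (hs : ∀ r < K, s.reg r < b) (hv : v < b) :
    ∀ t < K, (s.set r v).reg t < b :=
  (Function.forall_update_iff s.reg fun t u => t < K → u < b).2 ⟨fun _ => hv, fun t _ => hs t⟩

end Store

variable {x : List Bool} {K L : ℕ} {s : Store} {m : Memory (Sym K)}

theorem Test.run_comp (T : Test) (hK : T.width ≤ K) (hm : s.StoredIn x.length K L m) :
    (T.comp K).Run x (L + 2) m (T.eval x s) m := by
  obtain ⟨hp, ℓ, hℓ, hs, rfl⟩ := hm
  cases T with
  | eq r t =>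
    simp only [width] at hK
    have hstate (i : ℕ) :
        Transducer.state (fun σ d => (σ && (getTrack d r == getTrack d t), d)) true
          (digits K s.reg) i = decide (∀ j < i, (s.reg r).testBit j = (s.reg t).testBit j) := by
      induction i with
      | zero => simp [Transducer.state]
      | succ i ih =>
        rw [Transducer.state, ih, getTrack_digits _ _ (by omega), getTrack_digits _ _ (by omega)]
        simp only [Nat.forall_lt_succ_right, Bool.decide_and, Bool.beq_eq_decide_eq]
    have hrun := run_sweep (f := fun σ d => (σ && (getTrack d r == getTrack d t), d)) (σ₀ := true)
      (ext := false) (o := s.out) (digits_eq_false hs) (show ℓ + 1 < L + 2 by omega) hp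
    rw [hstate] at hrun
    rw [eval, decide_eq_decide.2 (eq_iff_forall_testBit_eq (hs r (by omega)) (hs t (by omega)))]
    exact hrun
  | isOne | isEnd =>
    have hrun := fun f : InSym → Bool => run_atom (c := s.memory K ℓ) (S := L + 2) (x := x) f
      none none (L + 1).succ_pos
    simp only [Store.memory, moveHead, min_eq_left hp, Option.toList, List.append_nil] at hrun
    exact hrun _

theorem run_assignComp {r v : ℕ} {g : (Fin K → Bool) → Bool} (hm : s.StoredIn x.length K L m)
    (hg : ∀ i, g (digits K s.reg i) = v.testBit i)
    (hv : ∀ ℓ, (∀ r < K, s.reg r < 2 ^ ℓ) → v < 2 ^ ℓ) :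
    ∃ m', (s.set r v).StoredIn x.length K L m' ∧ (assignComp K r g).Run x (L + 2) m () m' := by
  obtain ⟨hp, ℓ, hℓ, hs, rfl⟩ := hm
  refine ⟨(s.set r v).memory K ℓ, ⟨hp, ℓ, hℓ, Store.set_lt hs (hv ℓ hs), rfl⟩, ?_⟩
  have hwrite : Transducer.write (fun _ d => (false, setTrack d r (g d))) false (digits K s.reg) =
      digits K (s.set r v).reg := by
    funext i
    rw [Transducer.write, hg, setTrack_digits]
    rfl
  have hrun := run_sweep (f := fun _ d => (false, setTrack d r (g d))) (σ₀ := false) (ext := false)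
    (o := s.out) (digits_eq_false hs) (show ℓ + 1 < L + 2 by omega) hp
  rw [hwrite] at hrun
  exact hrun.map _

theorem run_incComp {r : ℕ} (hr : r < K) (hL : s.reg r + 1 < 2 ^ L)
    (hm : s.StoredIn x.length K L m) : ∃ m', (s.set r (s.reg r + 1)).StoredIn x.length K L m' ∧
      (incComp K r).Run x (L + 2) m () m' := by
  obtain ⟨hp, ℓ, hℓ, hs, rfl⟩ := hm
  set f : Transducer K := fun σ d => (σ && getTrack d r, setTrack d r (xor σ (getTrack d r)))
  set c := f.state true (digits K s.reg)
  have hc (i : ℕ) : c (i + 1) = (c i && (s.reg r).testBit i) := by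
    rw [← getTrack_digits _ _ hr]
    rfl
  have hcarry : c ℓ = true ↔ s.reg r + 1 = 2 ^ ℓ := carry_iff_of_lt_two_pow (hs r hr) rfl hc
  have hwrite : f.write true (digits K s.reg) = digits K (s.set r (s.reg r + 1)).reg := by
    funext i
    change setTrack _ r (xor (c i) (getTrack _ r)) = _
    rw [getTrack_digits _ _ hr, ← testBit_add_carry (s.reg r) i c hc, setTrack_digits]
    rfl
  have hrun := run_sweep (f := f) (σ₀ := true) (ext := true) (o := s.out) (digits_eq_false hs)
    (show ℓ + 1 < L + 2 by omega) hp
  rw [hwrite, Bool.true_and] at hrun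
  refine ⟨(s.set r (s.reg r + 1)).memory K (if c ℓ then ℓ + 1 else ℓ),
    ⟨hp, _, ?_, ?_, rfl⟩, hrun.map _⟩ <;> split_ifs with h
  · exact (Nat.pow_lt_pow_iff_right one_lt_two).1 (hcarry.1 h ▸ hL)
  · exact hℓ
  · have hpow : 2 ^ ℓ < 2 ^ (ℓ + 1) := Nat.pow_lt_pow_right one_lt_two ℓ.lt_succ_self
    exact Store.set_lt (fun t ht => (hs t ht).trans hpow) (hcarry.1 h ▸ hpow)
  · exact Store.set_lt hs (lt_of_le_of_ne (hs r hr) (mt hcarry.2 h))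

theorem Exec.run_comp {B : ℕ} {P : Prog} {s' : Store} (h : Exec x B P s s') (hK : P.width ≤ K)
    (hm : s.StoredIn x.length K B.size m) :
    ∃ m', s'.StoredIn x.length K B.size m' ∧ (P.comp K).Run x (B.size + 2) m () m' := by
  induction h generalizing m with
  | inc h => exact run_incComp hK (Nat.size_le.1 (Nat.size_le_size h)) hm
  | clear =>
    exact run_assignComp hm (fun i => (Nat.zero_testBit i).symm) fun _ _ => Nat.two_pow_pos _
  | copy =>
    simp only [Prog.width] at hK
    exact run_assignComp hm (fun i => getTrack_digits _ i (by omega)) fun _ hs => hs _ (by omega)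
  | emit =>
    obtain ⟨hp, ℓ, hℓ, hs, rfl⟩ := hm
    refine ⟨_, ⟨?_, ℓ, hℓ, hs, ?_⟩, run_atom _ _ _ (Nat.succ_pos _)⟩ <;>
      simp [Store.memory, moveHead, hp]
  | home =>
    obtain ⟨hp, ℓ, hℓ, hs, rfl⟩ := hm
    exact ⟨_, ⟨Nat.zero_le _, ℓ, hℓ, hs, rfl⟩, run_rewind (Nat.succ_pos _) hp⟩
  | right =>
    obtain ⟨-, ℓ, hℓ, hs, rfl⟩ := hm
    refine ⟨_, ⟨?_, ℓ, hℓ, hs, ?_⟩, run_atom _ _ _ (Nat.succ_pos _)⟩ <;>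
      simp [Store.memory, moveHead]
  | seq _ _ ih₁ ih₂ =>
    obtain ⟨hK₁, hK₂⟩ := max_le_iff.1 hK
    obtain ⟨m₁, hm₁, run₁⟩ := ih₁ hK₁ hm
    obtain ⟨m₂, hm₂, run₂⟩ := ih₂ hK₂ hm₁
    exact ⟨m₂, hm₂, run₁.bind run₂⟩
  | @iteTrue T P Q _ _ hT _ ih =>
    simp only [Prog.width, max_le_iff] at hK
    obtain ⟨m₁, hm₁, run₁⟩ := ih hK.2.1 hm
    exact ⟨m₁, hm₁, (hT ▸ T.run_comp hK.1 hm).bind run₁⟩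
  | @iteFalse T P Q _ _ hT _ ih =>
    simp only [Prog.width, max_le_iff] at hK
    obtain ⟨m₁, hm₁, run₁⟩ := ih hK.2.2 hm
    exact ⟨m₁, hm₁, (hT ▸ T.run_comp hK.1 hm).bind run₁⟩
  | @loopDone T P _ hT =>
    exact ⟨m, hm, (hT ▸ T.run_comp (max_le_iff.1 hK).1 hm).loopUntil_done⟩
  | @loopStep T P _ _ _ hT _ _ ih₁ ih₂ =>
    obtain ⟨hKT, hKP⟩ := max_le_iff.1 hK
    obtain ⟨m₁, hm₁, run₁⟩ := ih₁ hKP hm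
    obtain ⟨m₂, hm₂, run₂⟩ := ih₂ hK hm₁
    exact ⟨m₂, hm₂, (hT ▸ T.run_comp hKT hm).loopUntil_step run₁ run₂⟩

/-- The component that writes the left marker on a blank work tape. -/
def markLeft (K : ℕ) : Component (Sym K) Unit where
  Q := Unit
  finQ := inferInstance
  start := ()
  δ _ _ _ := ⟨.inr (), none, some none, none, none⟩

theorem run_markLeft (S : ℕ) :
    (markLeft K).Run x (S + 1) ⟨0, fun _ => none, 0, []⟩ () (Store.init.memory K 0) := by
  refine .step_of ⟨.inr (), none, some none, none, none⟩ rfl rfl ?_ S.succ_pos (.done S.succ_pos)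
  have htape : Function.update (fun _ : ℕ => (none : Sym K)) 0 (some none) =
      tapeOf 0 (digits K fun _ => 0) := by
    funext i
    cases i <;> rfl
  simp [Memory.after, Store.memory, Store.init, moveHead, htape]

/-- The machine that runs a program and then accepts if registers `r` and `t` agree. -/
def Prog.machine (P : Prog) (r t : ℕ) : Machine :=
  let K := max P.width (Test.eq r t).width
  ((markLeft K).bind fun _ => (P.comp K).bind fun _ => (Test.eq r t).comp K).toMachine none

theorem Exec.machine {B : ℕ} {P : Prog} (h : Exec x B P .init s) (r t : ℕ) :
    (P.machine r t).SpaceAtMost x (B.size + 2) ∧ ∃ f, (P.machine r t).HaltsAt x f ∧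
      f.out = s.out ∧ (f.state ∈ (P.machine r t).accept ↔ s.reg r = s.reg t) := by
  have hinit : Store.init.StoredIn x.length (max P.width (Test.eq r t).width) B.size
      (Store.init.memory _ 0) :=
    ⟨Nat.zero_le _, 0, Nat.zero_le _, fun _ _ => one_pos, rfl⟩
  obtain ⟨m, hm, run⟩ := h.run_comp (le_max_left _ _) hinit
  have hrun := (run_markLeft _).bind (D := fun _ => (P.comp _).bind fun _ => (Test.eq r t).comp _)
    (run.bind (D := fun _ => (Test.eq r t).comp _) ((Test.eq r t).run_comp (le_max_right _ _) hm))
  obtain ⟨hspace, hhalts⟩ := hrun.spaceAtMost_and_haltsAt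
  obtain ⟨-, ℓ, -, -, rfl⟩ := hm
  refine ⟨hspace, _, hhalts, rfl, ?_⟩
  exact Sum.inr_injective.eq_iff.trans decide_eq_true_iff

end Compilation

/-! ### Functions computable in logarithmic space -/

/-- Data that consist of an input string and finitely many numbers; the numbers are counted from the
one that was added last. -/
class Ctx (α : Type) where
  inp : α → List Bool
  arity : ℕ
  var : α → ℕ → ℕ

instance : Ctx (List Bool) := ⟨id, 0, fun _ _ => 0⟩

instance {α : Type} [Ctx α] : Ctx (α × ℕ) where
  inp a := Ctx.inp a.1
  arity := Ctx.arity α + 1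
  var a
    | 0 => a.2
    | i + 1 => Ctx.var a.1 i

open Ctx

/-- `B` bounds the length of the input and the numbers. -/
structure Fit {α : Type} [Ctx α] (a : α) (B : ℕ) : Prop where
  two_le : 2 ≤ B
  length_le : (inp a).length ≤ B
  var_le : ∀ i < arity α, var a i ≤ B

/-- The values are bounded by a polynomial in the length of the input and the numbers. -/
def PolyBounded {α : Type} [Ctx α] (f : α → ℕ) : Prop := ∃ c, ∀ a B, Fit a B → f a ≤ B ^ c

/-- The registers `ρ i` hold the numbers of `a`. -/
def Store.Holds {α : Type} [Ctx α] (s : Store) (ρ : ℕ → ℕ) (a : α) : Prop :=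
  ∀ i < arity α, s.reg (ρ i) = var a i

/-- Registers below `m` are the same. -/
def Store.Agree (m : ℕ) (s s' : Store) : Prop := ∀ r < m, s'.reg r = s.reg r

/-- The number `f a`, polynomially bounded, and the string `F a` are computed in logarithmic space:
wherever the numbers of `a` are stored below a register `m`, some program with polynomially
bounded registers puts `f a` into register `m` and writes `F a`, without changing the registers
below `m`. -/
structure LogComputes {α : Type} [Ctx α] (f : α → ℕ) (F : α → List Bool) : Prop where
  bounded : PolyBounded f
  prog : ∀ (ρ : ℕ → ℕ) (m : ℕ), (∀ i < arity α, ρ i < m) → ∃ (P : Prog) (c : ℕ),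
    ∀ (a : α) (s : Store) (B : ℕ), Fit a B → s.Holds ρ a →
      ∃ s', Exec (inp a) (B ^ c) P s s' ∧ s'.reg m = f a ∧ s.Agree m s' ∧ s'.out = s.out ++ F a

/-- Functions computable in logarithmic space, with polynomially bounded values. -/
def LogNat {α : Type} [Ctx α] (f : α → ℕ) : Prop := LogComputes f fun _ => []

/-- String functions computable in logarithmic space. -/
def LogString {α : Type} [Ctx α] (F : α → List Bool) : Prop := LogComputes (fun _ => 0) F

section LogSpaceFunctions

variable {α β : Type} [Ctx α] [Ctx β] {f g : α → ℕ} {F G : α → List Bool}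

namespace Fit

variable {a : α} {B v : ℕ}

theorem pow (h : Fit a B) (c : ℕ) : Fit a (B ^ (c + 1)) := by
  have hB : B ≤ B ^ (c + 1) := Nat.le_self_pow (by omega) B
  exact ⟨h.two_le.trans hB, h.length_le.trans hB, fun i hi => (h.var_le i hi).trans hB⟩

theorem pow_le_pow (h : Fit a B) {c d : ℕ} (hc : c ≤ d) : B ^ c ≤ B ^ d :=
  Nat.pow_le_pow_right (two_pos.trans_le h.two_le) hc

theorem fst {b : α × ℕ} (h : Fit b B) : Fit b.1 B :=
  ⟨h.two_le, h.length_le, fun i hi => h.var_le (i + 1) (Nat.succ_lt_succ hi)⟩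

theorem snd_le {b : α × ℕ} (h : Fit b B) : b.2 ≤ B := h.var_le 0 (Nat.succ_pos _)

theorem cons (h : Fit a B) (hv : v ≤ B) : Fit (a, v) B := by
  refine ⟨h.two_le, h.length_le, fun i hi => ?_⟩
  cases i with
  | zero => exact hv
  | succ i => exact h.var_le i (Nat.lt_of_succ_lt_succ hi)

end Fit

namespace PolyBounded

theorem of_le (hg : PolyBounded g) (h : ∀ a, f a ≤ g a) : PolyBounded f :=
  hg.imp fun _ hc a B H => (h a).trans (hc a B H)

theorem add (hf : PolyBounded f) (hg : PolyBounded g) : PolyBounded fun a => f a + g a := by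
  obtain ⟨c, hc⟩ := hf
  obtain ⟨d, hd⟩ := hg
  refine ⟨max c d + 1, fun a B H => ?_⟩
  calc f a + g a ≤ B ^ max c d + B ^ max c d :=
        Nat.add_le_add ((hc a B H).trans (H.pow_le_pow (le_max_left _ _)))
          ((hd a B H).trans (H.pow_le_pow (le_max_right _ _)))
    _ = B ^ max c d * 2 := (Nat.mul_two _).symm
    _ ≤ B ^ (max c d + 1) := Nat.mul_le_mul_left _ H.two_le

theorem mul (hf : PolyBounded f) (hg : PolyBounded g) : PolyBounded fun a => f a * g a := by
  obtain ⟨c, hc⟩ := hf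
  obtain ⟨d, hd⟩ := hg
  refine ⟨c + d, fun a B H => ?_⟩
  rw [pow_add]
  exact Nat.mul_le_mul (hc a B H) (hd a B H)

end PolyBounded

/-- Locations of the numbers of `(a, v)` from those of `a` and of `v`. -/
def consLoc (r : ℕ) (ρ : ℕ → ℕ) : ℕ → ℕ
  | 0 => r
  | i + 1 => ρ i

theorem consLoc_lt {r m m' : ℕ} {ρ : ℕ → ℕ} (hρ : ∀ i < arity α, ρ i < m) (hr : r < m')
    (hm : m ≤ m') : ∀ i < arity (α × ℕ), consLoc r ρ i < m'
  | 0, _ => hr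
  | i + 1, hi => (hρ i (Nat.lt_of_succ_lt_succ hi)).trans_le hm

namespace Store

variable {ρ : ℕ → ℕ} {a : α} {m r v w : ℕ} {s s' s₁ s₂ s₃ : Store}

@[simp]
theorem set_reg_self : (s.set r v).reg r = v := Function.update_self _ _ _

theorem set_reg_of_ne {t : ℕ} (h : t ≠ r) : (s.set r v).reg t = s.reg t :=
  Function.update_of_ne h _ _

theorem agree_set (h : m ≤ r) : s.Agree m (s.set r v) :=
  fun _ ht => set_reg_of_ne (ht.trans_le h).ne

theorem Agree.trans {m' : ℕ} (h : s₁.Agree m s₂) (h' : s₂.Agree m' s₃) (hm : m ≤ m') :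
    s₁.Agree m s₃ :=
  fun r hr => (h' r (hr.trans_le hm)).trans (h r hr)

theorem Holds.of_agree (h : s.Holds ρ a) (hs : s.Agree m s') (hρ : ∀ i < arity α, ρ i < m) :
    s'.Holds ρ a :=
  fun i hi => (hs _ (hρ i hi)).trans (h i hi)

theorem Holds.cons (h : s.Holds ρ a) (hv : s.reg r = v) : s.Holds (consLoc r ρ) (a, v) := by
  intro i hi
  cases i with
  | zero => exact hv
  | succ i => exact h i (Nat.lt_of_succ_lt_succ hi)

theorem Holds.fst {b : α × ℕ} (h : s.Holds ρ b) : s.Holds (fun i => ρ (i + 1)) b.1 :=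
  fun i hi => h (i + 1) (Nat.succ_lt_succ hi)

theorem Holds.snd {b : α × ℕ} (h : s.Holds ρ b) : s.reg (ρ 0) = b.2 := h 0 (Nat.succ_pos _)

end Store

theorem Exec.mono_pow {x : List Bool} {B c d : ℕ} {P : Prog} {s s' : Store}
    (h : Exec x (B ^ c) P s s') (hB : 2 ≤ B) (hc : c ≤ d) : Exec x (B ^ d) P s s' :=
  h.mono (Nat.pow_le_pow_right (two_pos.trans_le hB) hc)

theorem exec_loop {x : List Bool} {B N : ℕ} {T : Test} {P : Prog} (I : ℕ → Store → Prop)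
    (hT : ∀ t ≤ N, ∀ s, I t s → T.eval x s = decide (t = N))
    (hstep : ∀ t < N, ∀ s, I t s → ∃ s', Exec x B P s s' ∧ I (t + 1) s') {s : Store} (h : I 0 s) :
    ∃ s', Exec x B (.loop T P) s s' ∧ I N s' := by
  suffices from_t : ∀ t ≤ N, ∀ s, I t s → ∃ s', Exec x B (.loop T P) s s' ∧ I N s' from
    from_t 0 N.zero_le s h
  intro t ht
  induction ht using Nat.decreasingInduction with
  | self => exact fun s hs => ⟨s, .loopDone (by simpa using hT N le_rfl s hs), hs⟩
  | @of_succ t ht ih =>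
    intro s hs
    obtain ⟨s₁, e₁, hs₁⟩ := hstep t ht s hs
    obtain ⟨s₂, e₂, hs₂⟩ := ih s₁ hs₁
    exact ⟨s₂, .loopStep (by simpa [ht.ne] using hT t ht.le s hs) e₁ e₂, hs₂⟩

namespace LogComputes

theorem congr {f' : α → ℕ} {F' : α → List Bool} (h : LogComputes f F) (hf : ∀ a, f a = f' a)
    (hF : ∀ a, F a = F' a) : LogComputes f' F' :=
  (funext hf : f = f') ▸ (funext hF : F = F') ▸ h

theorem rename (h : LogComputes f F) (π : β → α) (r : ℕ → ℕ) (hi : ∀ b, inp (π b) = inp b)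
    (hr : ∀ i < arity α, r i < arity β) (hv : ∀ b, ∀ i < arity α, var (π b) i = var b (r i)) :
    LogComputes (fun b => f (π b)) (fun b => F (π b)) := by
  have hfit {b : β} {B : ℕ} (H : Fit b B) : Fit (π b) B :=
    ⟨H.two_le, hi b ▸ H.length_le, fun i h => hv b i h ▸ H.var_le _ (hr i h)⟩
  refine ⟨h.bounded.imp fun c hc b B H => hc _ B (hfit H), fun ρ m hρ => ?_⟩
  obtain ⟨P, c, hP⟩ := h.prog (fun i => ρ (r i)) m fun i h => hρ _ (hr i h)
  refine ⟨P, c, fun b s B H hs => ?_⟩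
  rw [← hi]
  exact hP (π b) s B (hfit H) fun i h => (hs (r i) (hr i h)).trans (hv b i h).symm

theorem weaken (h : LogComputes f F) :
    LogComputes (fun b : α × ℕ => f b.1) (fun b : α × ℕ => F b.1) :=
  h.rename Prod.fst (· + 1) (fun _ => rfl) (fun _ => Nat.succ_lt_succ) fun _ _ _ => rfl

theorem comp {f : α × ℕ → ℕ} {F : α × ℕ → List Bool} (hf : LogComputes f F)
    (hg : LogComputes g G) :
    LogComputes (fun a => f (a, g a)) (fun a => G a ++ F (a, g a)) := by
  obtain ⟨cg, hcg⟩ := hg.bounded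
  have hfit {a : α} {B : ℕ} (H : Fit a B) : Fit (a, g a) (B ^ (cg + 1)) :=
    (H.pow cg).cons ((hcg a B H).trans (H.pow_le_pow (by omega)))
  refine ⟨?_, fun ρ m hρ => ?_⟩
  · obtain ⟨cf, hcf⟩ := hf.bounded
    exact ⟨(cg + 1) * cf, fun a B H => pow_mul B _ _ ▸ hcf _ _ (hfit H)⟩
  · obtain ⟨P, c, hP⟩ := hg.prog ρ m hρ
    obtain ⟨P', c', hP'⟩ := hf.prog (consLoc m ρ) (m + 1) (consLoc_lt hρ (by omega) (by omega))
    refine ⟨.seq P (.seq P' (.copy m (m + 1))), max c ((cg + 1) * c'), fun a s B H hs => ?_⟩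
    obtain ⟨s₁, e₁, hv₁, hA₁, ho₁⟩ := hP a s B H hs
    obtain ⟨s₂, e₂, hv₂, hA₂, ho₂⟩ := hP' (a, g a) s₁ _ (hfit H) ((hs.of_agree hA₁ hρ).cons hv₁)
    rw [← pow_mul] at e₂
    refine ⟨_, .seq (e₁.mono_pow H.two_le (by omega))
      (.seq (e₂.mono_pow H.two_le (by omega)) .copy), ?_, ?_, ?_⟩
    · rw [Store.set_reg_self, hv₂]
    · exact (hA₁.trans hA₂ (by omega)).trans (Store.agree_set le_rfl) le_rfl
    · rw [← List.append_assoc, ← ho₁]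
      exact ho₂

theorem ite_var (hf : LogComputes f F) (hg : LogComputes g G) {i j : ℕ} (hi : i < arity α)
    (hj : j < arity α) :
    LogComputes (fun a => if var a i = var a j then f a else g a)
      (fun a => if var a i = var a j then F a else G a) := by
  refine ⟨(hf.bounded.add hg.bounded).of_le fun a => by split <;> omega, fun ρ m hρ => ?_⟩
  obtain ⟨P, c, hP⟩ := hf.prog ρ m hρ
  obtain ⟨Q, d, hQ⟩ := hg.prog ρ m hρ
  refine ⟨.ite (.eq (ρ i) (ρ j)) P Q, max c d, fun a s B H hs => ?_⟩
  have htest : (Test.eq (ρ i) (ρ j)).eval (inp a) s = decide (var a i = var a j) := by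
    rw [Test.eval, hs i hi, hs j hj]
  split_ifs with h
  · obtain ⟨s', e, hs'⟩ := hP a s B H hs
    exact ⟨s', .iteTrue (htest.trans (decide_eq_true h)) (e.mono_pow H.two_le (le_max_left _ _)),
      hs'⟩
  · obtain ⟨s', e, hs'⟩ := hQ a s B H hs
    exact ⟨s', .iteFalse (htest.trans (decide_eq_false h)) (e.mono_pow H.two_le (le_max_right _ _)),
      hs'⟩

end LogComputes

namespace LogNat

theorem congr (hf : LogNat f) (h : ∀ a, f a = g a) : LogNat g := LogComputes.congr hf h fun _ => rfl

theorem weaken (hf : LogNat f) : LogNat fun b : α × ℕ => f b.1 := LogComputes.weaken hf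

theorem weaken_snd {f : α × ℕ → ℕ} (hf : LogNat f) :
    LogNat fun b : (α × ℕ) × ℕ => f (b.1.1, b.2) :=
  LogComputes.rename hf (fun b : (α × ℕ) × ℕ => (b.1.1, b.2)) (consLoc 0 (· + 2)) (fun _ => rfl)
    (fun i hi => by cases i with
      | zero => exact Nat.succ_pos _
      | succ i => exact Nat.succ_lt_succ hi)
    fun _ i _ => by cases i <;> rfl

theorem comp {f : α × ℕ → ℕ} (hf : LogNat f) (hg : LogNat g) : LogNat fun a => f (a, g a) :=
  LogComputes.comp hf hg

theorem snd : LogNat fun b : α × ℕ => b.2 :=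
  ⟨⟨1, fun _ B H => (pow_one B).symm ▸ H.snd_le⟩, fun ρ m _ => ⟨.copy m (ρ 0), 0, fun _ s _ _ hs =>
    ⟨_, .copy, s.set_reg_self.trans hs.snd, Store.agree_set le_rfl, s.out.append_nil.symm⟩⟩⟩

theorem zero : LogNat fun _ : α => 0 :=
  ⟨⟨0, fun _ _ _ => Nat.zero_le _⟩, fun _ m _ => ⟨.clear m, 0, fun _ s _ _ _ =>
    ⟨_, .clear, s.set_reg_self, Store.agree_set le_rfl, s.out.append_nil.symm⟩⟩⟩

theorem succ (hf : LogNat f) : LogNat fun a => f a + 1 := by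
  suffices hsucc : LogNat fun b : α × ℕ => b.2 + 1 from hsucc.comp hf
  have hle {b : α × ℕ} {B : ℕ} (H : Fit b B) : b.2 + 1 ≤ B ^ 2 := by
    have hb := H.snd_le
    have hB := H.two_le
    nlinarith
  refine ⟨⟨2, fun _ _ H => hle H⟩, fun ρ m _ => ⟨.seq (.copy m (ρ 0)) (.inc m), 2,
    fun b s B H hs => ⟨_, .seq .copy (.inc ?_), ?_, ?_, s.out.append_nil.symm⟩⟩⟩
  · rw [Store.set_reg_self, hs.snd]
    exact hle H
  · rw [Store.set_reg_self, Store.set_reg_self, hs.snd]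
  · exact (Store.agree_set le_rfl).trans (Store.agree_set le_rfl) le_rfl

theorem const (n : ℕ) : LogNat fun _ : α => n := by
  induction n with
  | zero => exact zero
  | succ n ih => exact ih.succ

end LogNat

theorem LogComputes.ite_eq {h k : α → ℕ} {H K : α → List Bool} (hf : LogNat f) (hg : LogNat g)
    (hh : LogComputes h H) (hk : LogComputes k K) :
    LogComputes (fun a => if f a = g a then h a else k a)
      (fun a => if f a = g a then H a else K a) :=
  ((hh.weaken.weaken.ite_var hk.weaken.weaken (i := 1) (j := 0) (Nat.succ_lt_succ (Nat.succ_pos _))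
    (Nat.succ_pos _)).comp hg.weaken).comp hf

theorem exec_iterate_step {x : List Bool} {B m t : ℕ} {P : Prog} {u u' : Store}
    (e : Exec x B P u u') (hA : u.Agree (m + 2) u') (ht : u.reg (m + 1) = t) (hB : t + 1 ≤ B) :
    ∃ u₁, Exec x B (.seq P (.seq (.copy m (m + 2)) (.inc (m + 1)))) u u₁ ∧
      u₁.reg m = u'.reg (m + 2) ∧ u₁.reg (m + 1) = t + 1 ∧ u.Agree m u₁ ∧ u₁.out = u'.out := by
  have hcount : (u'.set m (u'.reg (m + 2))).reg (m + 1) = t := by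
    rw [Store.set_reg_of_ne (by omega), hA _ (by omega), ht]
  refine ⟨_, .seq e (.seq .copy (.inc (hcount.symm ▸ hB))), ?_, ?_, ?_, rfl⟩
  · rw [Store.set_reg_of_ne (by omega), Store.set_reg_self]
  · rw [Store.set_reg_self, hcount]
  · intro r hr
    rw [Store.set_reg_of_ne (by omega), Store.set_reg_of_ne (by omega), hA r (by omega)]

theorem LogComputes.recursion {f : α → ℕ → ℕ} {h : (α × ℕ) × ℕ → ℕ} {H : (α × ℕ) × ℕ → List Bool}
    (hbound : PolyBounded fun b : α × ℕ => f b.1 b.2) (hzero : LogNat fun a => f a 0)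
    (hh : LogComputes h H) (hsucc : ∀ a t, f a (t + 1) = h ((a, t), f a t)) :
    LogComputes (fun b : α × ℕ => f b.1 b.2)
      (fun b => (List.range b.2).flatMap fun t => H ((b.1, t), f b.1 t)) := by
  refine ⟨hbound, fun ρ m hρ => ?_⟩
  obtain ⟨cf, hcf⟩ := hbound
  have hρ' : ∀ i < arity α, ρ (i + 1) < m := fun i hi => hρ (i + 1) (Nat.succ_lt_succ hi)
  have hρ₀ : ρ 0 < m := hρ 0 (Nat.succ_pos _)
  obtain ⟨P₀, c₀, hP₀⟩ := hzero.prog (fun i => ρ (i + 1)) m hρ'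
  obtain ⟨P, c, hP⟩ := hh.prog (consLoc m (consLoc (m + 1) fun i => ρ (i + 1))) (m + 2)
    (consLoc_lt (consLoc_lt hρ' (Nat.lt_succ_self _) (by omega)) (by omega) le_rfl)
  set C := max (max c₀ ((cf + 1) * c)) 1
  refine ⟨.seq P₀ (.seq (.clear (m + 1)) (.loop (.eq (m + 1) (ρ 0))
    (.seq P (.seq (.copy m (m + 2)) (.inc (m + 1)))))), C, fun ⟨a, n⟩ s B hB hs => ?_⟩
  obtain ⟨s₁, e₁, hv₁, hA₁, ho₁⟩ := hP₀ a s B hB.fst hs.fst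
  let I (t : ℕ) (u : Store) : Prop := u.reg m = f a t ∧ u.reg (m + 1) = t ∧ s.Agree m u ∧
    u.out = s.out ++ (List.range t).flatMap fun t => H ((a, t), f a t)
  have hstep : ∀ t < n, ∀ u, I t u →
      ∃ u', Exec (inp a) (B ^ C) (.seq P (.seq (.copy m (m + 2)) (.inc (m + 1)))) u u' ∧
        I (t + 1) u' := by
    rintro t ht u ⟨hv, ht', hA, ho⟩
    have hat : Fit (a, t) B := hB.fst.cons (ht.le.trans hB.snd_le)
    have hfit : Fit ((a, t), f a t) (B ^ (cf + 1)) :=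
      (hat.pow cf).cons ((hcf _ _ hat).trans (hB.pow_le_pow cf.le_succ))
    obtain ⟨u', e, hv', hA', ho'⟩ := hP _ u _ hfit (((hs.fst.of_agree hA hρ').cons ht').cons hv)
    obtain ⟨u₁, e₁, hv₁, ht₁, hA₁, ho₁⟩ := exec_iterate_step
      ((pow_mul B _ _ ▸ e).mono_pow hB.two_le (by omega)) hA' ht'
      ((Nat.succ_le_of_lt ht).trans (hB.snd_le.trans (Nat.le_self_pow (n := C) (by omega) B)))
    refine ⟨u₁, e₁, (hv₁.trans hv').trans (hsucc a t).symm, ht₁, hA.trans hA₁ le_rfl, ?_⟩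
    rw [ho₁, ho', ho, List.range_succ, List.flatMap_append, List.flatMap_singleton,
      List.append_assoc]
  have hstart : I 0 (s₁.set (m + 1) 0) :=
    ⟨(Store.set_reg_of_ne (by omega)).trans hv₁, Store.set_reg_self,
      hA₁.trans (Store.agree_set (by omega)) le_rfl, ho₁⟩
  obtain ⟨u, e, hv, -, hA, ho⟩ := exec_loop (T := .eq (m + 1) (ρ 0)) I (fun t _ u hu => by
    rw [Test.eval, hu.2.1, hu.2.2.1 _ hρ₀, hs.snd]) hstep hstart
  exact ⟨u, .seq (e₁.mono_pow hB.two_le (by omega)) (.seq .clear e), hv, hA, ho⟩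

namespace LogNat

theorem recursion {f : α → ℕ → ℕ} {h : (α × ℕ) × ℕ → ℕ}
    (hbound : PolyBounded fun b : α × ℕ => f b.1 b.2) (hzero : LogNat fun a => f a 0)
    (hh : LogNat h) (hsucc : ∀ a t, f a (t + 1) = h ((a, t), f a t)) (hg : LogNat g) :
    LogNat fun a => f a (g a) :=
  ((LogComputes.recursion hbound hzero hh hsucc).comp hg).congr (fun _ => rfl) fun _ => by simp

theorem pred (hf : LogNat f) : LogNat fun a => f a - 1 :=
  recursion (f := fun _ t => t - 1) (snd.bounded.of_le fun _ => Nat.sub_le _ _) zero snd.weaken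
    (fun _ _ => rfl) hf

theorem sub (hf : LogNat f) (hg : LogNat g) : LogNat fun a => f a - g a :=
  recursion (f := fun a t => f a - t) (hf.weaken.bounded.of_le fun _ => Nat.sub_le _ _) hf snd.pred
    (fun _ _ => rfl) hg

theorem add (hf : LogNat f) (hg : LogNat g) : LogNat fun a => f a + g a :=
  recursion (f := fun a t => f a + t) (hf.weaken.bounded.add snd.bounded) hf snd.succ
    (fun _ _ => rfl) hg

theorem mul (hf : LogNat f) (hg : LogNat g) : LogNat fun a => f a * g a :=
  recursion (f := fun a t => f a * t) (hf.weaken.bounded.mul snd.bounded) zero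
    (snd.add hf.weaken.weaken) (fun _ _ => Nat.mul_succ _ _) hg

theorem pow_const (hf : LogNat f) (n : ℕ) : LogNat fun a => f a ^ n := by
  induction n with
  | zero => exact const 1
  | succ n ih => exact ih.mul hf

end LogNat

theorem inSym_isRightEnd (x : List Bool) (i : ℕ) :
    (inSym x (min (i + 1) (x.length + 1))).isRightEnd = decide (x.length ≤ i) := by
  rcases lt_or_ge i x.length with h | h
  · simp [inSym, InSym.isRightEnd, h.le, h]
  · simp [inSym, InSym.isRightEnd, h]

theorem inSym_isOne (x : List Bool) (i : ℕ) :
    (inSym x (min (i + 1) (x.length + 1))).isOne = x.getD i false := by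
  rcases lt_or_ge i x.length with h | h
  · simp [inSym, InSym.isOne, h.le, h]
  · simp [inSym, InSym.isOne, h]

theorem exec_scan {x : List Bool} {B N : ℕ} (m : ℕ) (s : Store) (hB : N ≤ B) {T : Test}
    (hT : ∀ t ≤ N, ∀ u : Store, u.pos = min (t + 1) (x.length + 1) → u.reg m = t → s.Agree m u →
      T.eval x u = decide (t = N)) :
    ∃ s', Exec x B (.seq (.clear m) (.seq .home (.seq .right (.loop T (.seq .right (.inc m))))))
        s s' ∧ s'.pos = min (N + 1) (x.length + 1) ∧ s'.reg m = N ∧ s.Agree m s' ∧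
      s'.out = s.out := by
  obtain ⟨s', e, hs'⟩ := exec_loop (B := B) (P := .seq .right (.inc m))
    (fun t u => u.pos = min (t + 1) (x.length + 1) ∧ u.reg m = t ∧ s.Agree m u ∧ u.out = s.out)
    (fun t ht u hu => hT t ht u hu.1 hu.2.1 hu.2.2.1)
    (fun t ht u ⟨hp, hr, hA, ho⟩ => ⟨_, .seq .right (.inc (hr.symm ▸ ht.trans_le hB)),
      (congrArg (fun i => min (i + 1) (x.length + 1)) hp).trans (by omega),
      Store.set_reg_self.trans (congrArg Nat.succ hr),
      (show s.Agree m _ from hA).trans (Store.agree_set le_rfl) le_rfl, ho⟩)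
    (s := ⟨Function.update s.reg m 0, min (0 + 1) (x.length + 1), s.out⟩)
    ⟨rfl, Function.update_self _ _ _, fun _ hr => Function.update_of_ne hr.ne _ _, rfl⟩
  exact ⟨s', .seq .clear (.seq .home (.seq .right e)), hs'⟩

namespace LogNat

theorem length : LogNat fun a : α => (inp a).length := by
  refine ⟨⟨1, fun a B H => (pow_one B).symm ▸ H.length_le⟩, fun _ m _ => ⟨.seq (.clear m)
    (.seq .home (.seq .right (.loop .isEnd (.seq .right (.inc m))))), 1, fun a s B H _ => ?_⟩⟩
  obtain ⟨s', e, -, hr, hA, ho⟩ := exec_scan m s (T := .isEnd)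
    ((pow_one B).symm ▸ H.length_le) fun t ht u hp _ _ => by
      rw [Test.eval, hp, inSym_isRightEnd, decide_eq_decide, ht.ge_iff_eq]
  exact ⟨s', e, hr, hA, ho.trans s.out.append_nil.symm⟩

theorem bit (hf : LogNat f) : LogNat fun a => ((inp a).getD (f a) false).toNat := by
  suffices hbit : LogNat fun b : α × ℕ => ((inp b).getD b.2 false).toNat from hbit.comp hf
  refine ⟨⟨0, fun _ _ _ => Bool.toNat_le _⟩, fun ρ m hρ => ⟨.seq (.seq (.clear m) (.seq .home
    (.seq .right (.loop (.eq m (ρ 0)) (.seq .right (.inc m)))))) (.seq (.clear m)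
    (.ite .isOne (.inc m) (.clear m))), 1, fun b s B H hs => ?_⟩⟩
  obtain ⟨u, e, hp, -, hA, ho⟩ := exec_scan (x := inp b) m s (T := .eq m (ρ 0))
    ((pow_one B).symm ▸ H.snd_le) fun t _ u _ hr hA => by
      rw [Test.eval, hr, hA _ (hρ 0 (Nat.succ_pos _)), hs.snd]
  have htest : Test.isOne.eval (inp b) (u.set m 0) = (inp b).getD b.2 false :=
    (congrArg (fun p => (inSym (inp b) p).isOne) hp).trans (inSym_isOne _ _)
  have hA' (v : ℕ) : s.Agree m ((u.set m 0).set m v) :=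
    (hA.trans (Store.agree_set le_rfl) le_rfl).trans (Store.agree_set le_rfl) le_rfl
  have ho' : u.out = s.out ++ [] := ho.trans s.out.append_nil.symm
  cases hb : (inp b).getD b.2 false with
  | true =>
    refine ⟨_, .seq e (.seq .clear (.iteTrue (htest.trans hb) (.inc ?_))), ?_, hA' _, ho'⟩
    · rw [Store.set_reg_self, pow_one]
      exact one_le_two.trans H.two_le
    · rw [Store.set_reg_self, Store.set_reg_self, Bool.toNat_true]
  | false =>
    exact ⟨_, .seq e (.seq .clear (.iteFalse (htest.trans hb) .clear)), Store.set_reg_self, hA' 0,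
      ho'⟩

end LogNat

/-! ### Predicates decidable in logarithmic space -/

open Classical in
/-- The indicator of a proposition. -/
noncomputable def ind (p : Prop) : ℕ := if p then 1 else 0

theorem ind_le_one (p : Prop) : ind p ≤ 1 := by
  unfold ind
  split <;> simp

theorem ind_eq_one {p : Prop} : ind p = 1 ↔ p := by
  unfold ind
  split <;> simp_all

theorem ind_eq_zero {p : Prop} : ind p = 0 ↔ ¬p := by
  unfold ind
  split <;> simp_all

/-- Predicates decidable in logarithmic space. -/
def LogPred (p : α → Prop) : Prop := LogNat fun a => ind (p a)

theorem LogComputes.ite {p : α → Prop} [∀ a, Decidable (p a)] {F G : α → List Bool}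
    (hp : LogPred p) (hf : LogComputes f F) (hg : LogComputes g G) :
    LogComputes (fun a => if p a then f a else g a) (fun a => if p a then F a else G a) :=
  (ite_eq hp (.const 1) hf hg).congr (fun a => by simp only [ind_eq_one]) fun a => by
    simp only [ind_eq_one]

theorem LogNat.ite {p : α → Prop} [∀ a, Decidable (p a)] (hp : LogPred p) (hf : LogNat f)
    (hg : LogNat g) : LogNat fun a => if p a then f a else g a :=
  (LogComputes.ite hp hf hg).congr (fun _ => rfl) fun _ => ite_self _

namespace LogPred

variable {p q : α → Prop}

theorem congr (hp : LogPred p) (h : ∀ a, p a ↔ q a) : LogPred q :=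
  (funext fun a => propext (h a) : p = q) ▸ hp

theorem weaken (hp : LogPred p) : LogPred fun a : α × ℕ => p a.1 := LogNat.weaken hp

theorem weaken_snd {p : α × ℕ → Prop} (hp : LogPred p) :
    LogPred fun a : (α × ℕ) × ℕ => p (a.1.1, a.2) :=
  LogNat.weaken_snd hp

theorem comp {p : α × ℕ → Prop} (hp : LogPred p) (hg : LogNat g) : LogPred fun a => p (a, g a) :=
  LogNat.comp hp hg

theorem const (p : Prop) : LogPred fun _ : α => p := LogNat.const _

theorem eq (hf : LogNat f) (hg : LogNat g) : LogPred fun a => f a = g a :=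
  (LogComputes.ite_eq hf hg (LogNat.const 1) LogNat.zero).congr
    (fun a => by unfold ind; split <;> rfl) fun _ => ite_self _

theorem le (hf : LogNat f) (hg : LogNat g) : LogPred fun a => f a ≤ g a :=
  (eq (hf.sub hg) .zero).congr fun _ => Nat.sub_eq_zero_iff_le

theorem lt (hf : LogNat f) (hg : LogNat g) : LogPred fun a => f a < g a := le hf.succ hg

theorem not (hp : LogPred p) : LogPred fun a => ¬p a :=
  (eq hp .zero).congr fun _ => ind_eq_zero

theorem and (hp : LogPred p) (hq : LogPred q) : LogPred fun a => p a ∧ q a :=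
  (eq (hp.mul hq) (.const 1)).congr fun _ => by rw [mul_eq_one, ind_eq_one, ind_eq_one]

theorem or (hp : LogPred p) (hq : LogPred q) : LogPred fun a => p a ∨ q a :=
  (hp.not.and hq.not).not.congr fun _ => by tauto

theorem ex {p : α × ℕ → Prop} (hp : LogPred p) (hg : LogNat g) :
    LogPred fun a => ∃ t < g a, p (a, t) := by
  classical
  refine LogNat.recursion (f := fun a n => ind (∃ t < n, p (a, t)))
    (h := fun b => if p (b.1.1, b.1.2) then 1 else b.2)
    ((LogNat.const 1).bounded.of_le fun _ => ind_le_one _)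
    (LogNat.zero.congr fun a => (ind_eq_zero.2 (by simp)).symm)
    (.ite hp.weaken (.const 1) .snd) (fun a t => ?_) hg
  simp only [Nat.exists_lt_succ_right]
  split_ifs with h
  · exact ind_eq_one.2 (.inr h)
  · rw [or_iff_left h]

theorem all {p : α × ℕ → Prop} (hp : LogPred p) (hg : LogNat g) :
    LogPred fun a => ∀ t < g a, p (a, t) :=
  (hp.not.ex hg).not.congr fun _ => by simp

theorem bit (hf : LogNat f) : LogPred fun a => (inp a).getD (f a) false = true :=
  (eq hf.bit (.const 1)).congr fun _ => Bool.toNat_eq_one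

end LogPred

namespace LogNat

theorem findGreatest {p : α × ℕ → Prop} [∀ a, Decidable (p a)] (hp : LogPred p) (hg : LogNat g) :
    LogNat fun a => Nat.findGreatest (fun t => p (a, t)) (g a) :=
  recursion (f := fun a n => Nat.findGreatest (fun t => p (a, t)) n)
    (h := fun b => if p (b.1.1, b.1.2 + 1) then b.1.2 + 1 else b.2)
    (snd.bounded.of_le fun b => Nat.findGreatest_le b.2) zero
    (.ite (hp.weaken_snd.weaken_snd.comp snd.weaken.succ) snd.weaken.succ snd)
    (fun _ _ => Nat.findGreatest_succ _) hg

theorem div (hf : LogNat f) (hg : LogNat g) : LogNat fun a => f a / g a := by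
  refine (ite (.eq hg zero) zero (findGreatest (p := fun b : α × ℕ => b.2 * g b.1 ≤ f b.1)
    (.le (snd.mul hg.weaken) hf.weaken) hf)).congr fun a => ?_
  split_ifs with h
  · rw [h, Nat.div_zero]
  · rw [Nat.findGreatest_eq_iff]
    exact ⟨Nat.div_le_self _ _, fun _ => Nat.div_mul_le_self _ _, fun t ht _ =>
      not_le.2 ((Nat.div_lt_iff_lt_mul (Nat.pos_of_ne_zero h)).1 ht)⟩

theorem mod (hf : LogNat f) (hg : LogNat g) : LogNat fun a => f a % g a :=
  (hf.sub (hg.mul (hf.div hg))).congr fun _ => (Nat.mod_eq_sub _ _).symm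

theorem div_two_pow (hf : LogNat f) (hg : LogNat g) : LogNat fun a => f a / 2 ^ g a :=
  recursion (f := fun a t => f a / 2 ^ t) (hf.weaken.bounded.of_le fun _ => Nat.div_le_self _ _)
    (hf.congr fun _ => by simp) (snd.div (const 2))
    (fun _ _ => by rw [pow_succ, Nat.div_div_eq_div_mul]) hg

theorem log (hf : LogNat f) : LogNat fun a => Nat.log 2 (f a) := by
  refine (findGreatest (p := fun b : α × ℕ => 1 ≤ f b.1 / 2 ^ b.2)
    (.le (const 1) (hf.weaken.div_two_pow snd)) hf).congr fun a => ?_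
  simp only [Nat.le_div_iff_mul_le (Nat.two_pow_pos _), one_mul]
  rw [Nat.findGreatest_eq_iff]
  exact ⟨Nat.log_le_self _ _, fun h => Nat.pow_log_le_self 2 fun h0 => h (by simp [h0]),
    fun t ht _ => not_le.2 (Nat.lt_pow_of_log_lt one_lt_two ht)⟩

theorem clog (hf : LogNat f) : LogNat fun a => Nat.clog 2 (f a) := by
  refine (ite (.le hf (const 1)) zero (hf.pred.log.succ)).congr fun a => ?_
  split_ifs with h
  · rw [Nat.clog_of_right_le_one h]
  · refine le_antisymm ((Nat.lt_clog_iff_pow_lt one_lt_two).2 ?_)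
      ((Nat.clog_le_iff_le_pow one_lt_two).2 ?_)
    · have := Nat.pow_log_le_self 2 (x := f a - 1) (by omega)
      omega
    · have := Nat.lt_pow_succ_log_self one_lt_two (f a - 1)
      omega

end LogNat

theorem LogPred.testBit (hf : LogNat f) (hg : LogNat g) :
    LogPred fun a => (f a).testBit (g a) = true :=
  (LogPred.eq ((hf.div_two_pow hg).mod (.const 2)) (.const 1)).congr fun a => by
    rw [Nat.testBit_eq_decide_div_mod_eq, decide_eq_true_iff]

namespace LogString

theorem congr (hF : LogString F) (h : ∀ a, F a = G a) : LogString G :=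
  LogComputes.congr hF (fun _ => rfl) h

theorem nil : LogString fun _ : α => [] := LogNat.zero

theorem bit (b : Bool) : LogString fun _ : α => [b] :=
  ⟨⟨0, fun _ _ _ => Nat.zero_le _⟩, fun _ m _ => ⟨.seq (.clear m) (.emit b), 0, fun _ _ _ _ _ =>
    ⟨_, .seq .clear .emit, Store.set_reg_self, fun _ hr => Store.set_reg_of_ne hr.ne, rfl⟩⟩⟩

theorem append (hF : LogString F) (hG : LogString G) : LogString fun a => F a ++ G a :=
  LogComputes.comp (LogComputes.weaken hG) hF

theorem ite {p : α → Prop} [∀ a, Decidable (p a)] (hp : LogPred p) (hF : LogString F)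
    (hG : LogString G) : LogString fun a => if p a then F a else G a :=
  (LogComputes.ite hp hF hG).congr (fun _ => ite_self _) fun _ => rfl

theorem flatMap {F : α × ℕ → List Bool} (hF : LogString F) (hg : LogNat g) :
    LogString fun a => (List.range (g a)).flatMap fun t => F (a, t) :=
  (LogComputes.recursion (f := fun _ _ => 0) LogNat.zero.bounded .zero (LogComputes.weaken hF)
    fun _ _ => rfl).comp hg

theorem replicate (b : Bool) (hg : LogNat g) : LogString fun a => List.replicate (g a) b :=
  (flatMap (bit b) hg).congr fun a => by
    rw [List.flatMap_def, List.map_const', List.length_range, List.flatten_replicate_singleton]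

theorem unary (hg : LogNat g) : LogString fun a => unary (g a) :=
  (replicate true hg).append (bit false)

end LogString

/-! ### Membership in the logarithmic space classes -/

theorem size_pow_add_two_le (n c : ℕ) :
    ((n + 2) ^ c).size + 2 ≤ (2 * c + 3) * Nat.log 2 n + (2 * c + 3) := by
  have hn : n + 2 ≤ 2 ^ (Nat.log 2 n + 2) := by
    have hlt := Nat.lt_pow_succ_log_self one_lt_two n
    have hpos := Nat.one_le_two_pow (n := Nat.log 2 n)
    rw [pow_succ] at hlt ⊢
    omega
  have hsize : ((n + 2) ^ c).size ≤ (Nat.log 2 n + 2) * c + 1 := by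
    rw [Nat.size_le, pow_succ, pow_mul]
    have hpow := Nat.pow_le_pow_left hn c
    have hpos := Nat.pow_pos (n := c) (Nat.two_pow_pos (Nat.log 2 n + 2))
    omega
  nlinarith

theorem Fit.list (x : List Bool) : Fit x (x.length + 2) :=
  ⟨Nat.le_add_left _ _, Nat.le_add_right _ _, nofun⟩

theorem mem_logSpace {A : Language Bool} (h : LogPred fun x : List Bool => x ∈ A) :
    A ∈ LogSpace := by
  obtain ⟨P, c, hP⟩ := (LogPred.not h).prog id 0 nofun
  refine ⟨(Prog.seq P (.clear 1)).machine 0 1, 2 * c + 3, fun x => ?_⟩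
  obtain ⟨s, e, hs, -⟩ := hP x .init (x.length + 2) (.list x) nofun
  obtain ⟨hspace, f, hf, -, hacc⟩ := (e.seq .clear).machine 0 1
  refine ⟨fun d hd i => (hspace d hd i).trans_le (size_pow_add_two_le _ _), f, hf, ?_⟩
  rw [hacc, Store.set_reg_self, Store.set_reg_of_ne zero_ne_one, hs, ind_eq_zero, not_not]

theorem logSpaceOnUnary {F : List Bool → List Bool} (h : LogString F) :
    LogSpaceOnUnary fun n => F (List.replicate n true) := by
  obtain ⟨P, c, hP⟩ := h.prog id 0 nofun
  refine ⟨P.machine 0 0, 2 * c + 3, fun n => ?_⟩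
  have hfit := Fit.list (List.replicate n true)
  rw [List.length_replicate] at hfit
  obtain ⟨s, e, -, -, hs⟩ := hP (List.replicate n true) .init (n + 2) hfit nofun
  obtain ⟨hspace, f, hf, hout, -⟩ := e.machine 0 0
  exact ⟨fun d hd i => (hspace d hd i).trans_le (size_pow_add_two_le _ _), f, hf, hout.trans hs⟩

end LogSpaceFunctions

/-! ### Formulas -/

/-- Assignments of numbers to variables. -/
abbrev Env := ℕ → ℕ

/-- First order formulas about an input string: numerical predicates and positions depend on the
length of the string and on the variables, and `call f` refers to a relation on assignments, which
is applied to the image of the current assignment under `f`. -/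
inductive Formula
  | num (p : ℕ → Env → Prop)
  | lit (pos : ℕ → Env → ℕ)
  | not (φ : Formula)
  | and (φ ψ : Formula)
  | or (φ ψ : Formula)
  | ex (i : ℕ) (φ : Formula)
  | all (i : ℕ) (φ : Formula)
  | call (f : ℕ → Env → Env)

/-- The bound for the variables on inputs of length `N`. -/
def base (N : ℕ) : ℕ := (N + 2) ^ 2

theorem base_pos (N : ℕ) : 0 < base N := pow_pos (Nat.succ_pos _) 2

/-- The first `D` variables reduced modulo `b`, the others set to zero. -/
def normEnv (b D : ℕ) (v : Env) : Env := fun i => if i < D then v i % b else 0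

/-- The truth value of a formula with `D` variables, with `R` for the relation called. -/
def Formula.Eval (D : ℕ) (w : List Bool) (R : Env → Prop) : Formula → Env → Prop
  | num p, v => p w.length v
  | lit pos, v => w.getD (pos w.length v) false = true
  | not φ, v => ¬ φ.Eval D w R v
  | and φ ψ, v => φ.Eval D w R v ∧ ψ.Eval D w R v
  | or φ ψ, v => φ.Eval D w R v ∨ ψ.Eval D w R v
  | ex i φ, v => ∃ t < base w.length, φ.Eval D w R (Function.update v i t)
  | all i φ, v => ∀ t < base w.length, φ.Eval D w R (Function.update v i t)
  | call f, v => R (normEnv (base w.length) D (f w.length v))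

/-- The relation obtained by iterating a formula, starting with the empty relation. -/
def Formula.stage (D : ℕ) (w : List Bool) (φ : Formula) : ℕ → Env → Prop
  | 0, _ => False
  | ℓ + 1, v => φ.Eval D w (stage D w φ ℓ) v

/-- Numerical terms computable in logarithmic space, whatever the variables stand for. -/
def LogTerm (f : ℕ → Env → ℕ) : Prop :=
  ∀ {α : Type} [Ctx α] {v : α → Env}, (∀ i, LogNat fun a => v a i) →
    LogNat fun a => f (inp a).length (v a)

/-- Numerical relations decidable in logarithmic space, whatever the variables stand for. -/
def LogRel (p : ℕ → Env → Prop) : Prop :=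
  ∀ {α : Type} [Ctx α] {v : α → Env}, (∀ i, LogNat fun a => v a i) →
    LogPred fun a => p (inp a).length (v a)

/-- The numerical parts of the formula are computable in logarithmic space, and quantifiers bind
only the first `D` variables. -/
def Formula.Uniform (D : ℕ) : Formula → Prop
  | num p => LogRel p
  | lit pos => LogTerm pos
  | not φ => φ.Uniform D
  | and φ ψ => φ.Uniform D ∧ ψ.Uniform D
  | or φ ψ => φ.Uniform D ∧ ψ.Uniform D
  | ex i φ => i < D ∧ φ.Uniform D
  | all i φ => i < D ∧ φ.Uniform D
  | call f => ∀ i, LogTerm fun N v => f N v i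

section

variable {α : Type} [Ctx α] {v : α → Env}

theorem LogNat.base : LogNat fun a : α => base (inp a).length :=
  (length.add (const 2)).pow_const 2

theorem LogNat.update (hv : ∀ i, LogNat fun a => v a i) {f : α → ℕ} (hf : LogNat f) (i j : ℕ) :
    LogNat fun a => Function.update (v a) i (f a) j := by
  by_cases h : j = i
  · subst h
    simpa only [Function.update_self] using hf
  · simpa only [Function.update_of_ne h] using hv j

theorem LogNat.normEnv {b : α → ℕ} (hb : LogNat b) (D : ℕ) (hv : ∀ i, LogNat fun a => v a i)
    (i : ℕ) : LogNat fun a => normEnv (b a) D (v a) i := by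
  by_cases h : i < D
  · simpa only [LatinIsotopy.normEnv, if_pos h] using (hv i).mod hb
  · simpa only [LatinIsotopy.normEnv, if_neg h] using zero

theorem Formula.Uniform.logPred {D : ℕ} {R : List Bool → Env → Prop}
    (hR : ∀ {α : Type} [Ctx α] {v : α → Env}, (∀ i, LogNat fun a => v a i) →
      LogPred fun a => R (inp a) (v a)) {φ : Formula} (hφ : φ.Uniform D)
    (hv : ∀ i, LogNat fun a => v a i) : LogPred fun a => φ.Eval D (inp a) (R (inp a)) (v a) := by
  induction φ generalizing α with
  | num p => exact hφ hv
  | lit pos => exact .bit (hφ hv)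
  | not φ ih => exact (ih hφ hv).not
  | and φ ψ ih₁ ih₂ => exact (ih₁ hφ.1 hv).and (ih₂ hφ.2 hv)
  | or φ ψ ih₁ ih₂ => exact (ih₁ hφ.1 hv).or (ih₂ hφ.2 hv)
  | ex i φ ih => exact (ih hφ.2 (.update (fun j => (hv j).weaken) .snd i)).ex .base
  | all i φ ih => exact (ih hφ.2 (.update (fun j => (hv j).weaken) .snd i)).all .base
  | call f => exact hR (.normEnv .base D fun i => hφ i hv)

end

/-! ### Circuits for iterated formulas -/

namespace Formula

/-- The subformulas, each one after its own subformulas. -/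
def flat : Formula → List Formula
  | not φ => φ.flat ++ [not φ]
  | and φ ψ => φ.flat ++ ψ.flat ++ [and φ ψ]
  | or φ ψ => φ.flat ++ ψ.flat ++ [or φ ψ]
  | ex i φ => φ.flat ++ [ex i φ]
  | all i φ => φ.flat ++ [all i φ]
  | φ => [φ]

/-- The number of subformulas. -/
def size (φ : Formula) : ℕ := φ.flat.length

/-- The subformula evaluated by block `q` of gates: each round of the iteration has one block for
each subformula. -/
def subformula (φ : Formula) (q : ℕ) : Formula := φ.flat.getD (q % φ.size) φ

end Formula

/-- The assignment with code `a`: the digits of `a` in base `b`. -/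
def decodeEnv (b D a : ℕ) : Env := normEnv b D fun i => a / b ^ i

/-- The assignment of gate `g`, in a block of `base N ^ D` gates. The codes decrease along a block,
so that the last gate, the output of the circuit, has the assignment `0`. -/
def gateEnv (D N g : ℕ) : Env := decodeEnv (base N) D (base N ^ D - 1 - g % base N ^ D)

/-- Gate `h` belongs to the block before that of gate `g`, and their assignments differ at most in
variable `i`. -/
def QuantChild (D N i g h : ℕ) : Prop :=
  h / base N ^ D + 1 = g / base N ^ D ∧
    gateEnv D N h = Function.update (gateEnv D N g) i (gateEnv D N h i)

/-- Gate `h` belongs to the last of the `K` blocks in the round before that of gate `g`, and its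
assignment arises from that of `g` by `f`. -/
def CallChild (D K N : ℕ) (f : ℕ → Env → Env) (g h : ℕ) : Prop :=
  h / base N ^ D + 1 = g / base N ^ D / K * K ∧
    gateEnv D N h = normEnv (base N) D (f N (gateEnv D N g))

open Classical in
/-- Gate `g` of the circuit for inputs of length `N`, if its block evaluates the given
subformula. -/
noncomputable def Formula.gate (D K N g : ℕ) : Formula → Gate
  | num p => if p N (gateEnv D N g) then .and [] else .or []
  | lit pos => if pos N (gateEnv D N g) < N then .input (pos N (gateEnv D N g)) else .or []
  | not _ => .not (g - base N ^ D)
  | and _ ψ => .and [g - base N ^ D, g - (ψ.size + 1) * base N ^ D]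
  | or _ ψ => .or [g - base N ^ D, g - (ψ.size + 1) * base N ^ D]
  | ex i _ => .or ((List.range g).filter fun h => QuantChild D N i g h)
  | all i _ => .and ((List.range g).filter fun h => QuantChild D N i g h)
  | call f => .or ((List.range g).filter fun h => CallChild D K N f g h)

/-- The circuit that iterates a formula for `T` rounds. -/
noncomputable def Formula.circuit (φ : Formula) (D T N : ℕ) : Circuit :=
  (List.range (T * φ.size * base N ^ D)).map fun g =>
    (φ.subformula (g / base N ^ D)).gate D φ.size N g

section

variable {α : Type} [Ctx α] {f g h : α → ℕ}

theorem LogPred.forall_lt_const {p : ℕ → α → Prop} (hp : ∀ j, LogPred (p j)) (D : ℕ) :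
    LogPred fun a => ∀ j < D, p j a := by
  induction D with
  | zero => exact (const True).congr fun a => by simp
  | succ D ih => exact (ih.and (hp D)).congr fun a => by rw [Nat.forall_lt_succ_right]

theorem LogPred.env_eq {u v : α → Env} (hu : ∀ i, LogNat fun a => u a i)
    (hv : ∀ i, LogNat fun a => v a i) {D : ℕ} (hD : ∀ a, ∀ i, D ≤ i → u a i = v a i) :
    LogPred fun a => u a = v a :=
  (forall_lt_const (fun i => .eq (hu i) (hv i)) D).congr fun a =>
    ⟨fun h => funext fun i => (lt_or_ge i D).elim (h i) (hD a i), fun h i _ => congrFun h i⟩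

theorem normEnv_of_le {b D i : ℕ} (h : D ≤ i) (v : Env) : normEnv b D v i = 0 := if_neg h.not_gt

theorem gateEnv_of_le {D N g i : ℕ} (h : D ≤ i) : gateEnv D N g i = 0 := by
  rw [gateEnv, decodeEnv, normEnv_of_le h]

theorem LogNat.gateEnv (hg : LogNat g) (D i : ℕ) :
    LogNat fun a => gateEnv D (inp a).length (g a) i :=
  have size := LogNat.base.pow_const D
  .normEnv .base D (fun j => (size.pred.sub (hg.mod size)).div (base.pow_const j)) i

theorem LogPred.quantChild (hg : LogNat g) (hh : LogNat h) {D i : ℕ} (hi : i < D) :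
    LogPred fun a => QuantChild D (inp a).length i (g a) (h a) := by
  have size := LogNat.base (α := α).pow_const D
  refine .and (.eq (hh.div size).succ (hg.div size)) (.env_eq (D := D) (hh.gateEnv D)
    (.update (hg.gateEnv D) (hh.gateEnv D i) i) fun a j hj => ?_)
  rw [Function.update_of_ne (hi.trans_le hj).ne']
  exact (gateEnv_of_le hj).trans (gateEnv_of_le hj).symm

theorem LogPred.callChild (hg : LogNat g) (hh : LogNat h) {f : ℕ → Env → Env}
    (hf : ∀ i, LogTerm fun N v => f N v i) (D K : ℕ) :
    LogPred fun a => CallChild D K (inp a).length f (g a) (h a) := by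
  have size := LogNat.base (α := α).pow_const D
  exact .and (.eq (hh.div size).succ (((hg.div size).div (.const K)).mul (.const K)))
    (.env_eq (D := D) (hh.gateEnv D) (.normEnv .base D fun i => hf i (hg.gateEnv D))
      fun _ _ hj => (gateEnv_of_le hj).trans (normEnv_of_le hj _).symm)

namespace LogString

theorem encodeList_pair (hf : LogNat f) (hg : LogNat g) :
    LogString fun a => encodeList [f a, g a] :=
  ((((bit true).append (unary hf)).append ((bit true).append (unary hg))).append
    (bit false)).congr fun a => by simp [encodeList]

theorem encodeList_filter {p : α × ℕ → Prop} [∀ b, Decidable (p b)] (hp : LogPred p)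
    (hg : LogNat g) :
    LogString fun a => encodeList ((List.range (g a)).filter fun t => p (a, t)) := by
  refine ((flatMap (ite hp ((bit true).append (unary .snd)) nil) hg).append (bit false)).congr
    fun a => ?_
  rw [encodeList]
  congr 1
  induction List.range (g a) with
  | nil => rfl
  | cons t l ih =>
    rw [List.flatMap_cons, ih]
    by_cases h : p (a, t) <;> simp [h]

theorem getD {ι : Type*} {l : List ι} {d : ι} {F : ι → α → List Bool}
    (hl : ∀ i ∈ l, LogString (F i)) (hd : LogString (F d)) {σ : α → ℕ} (hσ : LogNat σ) :
    LogString fun a => F (l.getD (σ a) d) a := by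
  induction l generalizing σ with
  | nil => simpa using hd
  | cons i l ih =>
    refine (LogComputes.ite_eq hσ .zero (hl i (by simp)) (ih (fun j hj => hl j (by simp [hj]))
      hσ.pred)).congr (fun a => by simp) fun a => ?_
    cases h : σ a <;> simp

theorem kind (b c : Bool) : LogString fun _ : α => [b, c] := (bit b).append (bit c)

end LogString

namespace Formula

theorem Uniform.of_mem_flat {D : ℕ} {φ ψ : Formula} (hφ : φ.Uniform D) (h : ψ ∈ φ.flat) :
    ψ.Uniform D := by
  induction φ with
  | num | lit | call =>
    obtain rfl := List.mem_singleton.1 h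
    exact hφ
  | not φ ih =>
    obtain h | rfl := by simpa only [flat, List.mem_append, List.mem_singleton] using h
    exacts [ih hφ h, hφ]
  | ex _ φ ih | all _ φ ih =>
    obtain h | rfl := by simpa only [flat, List.mem_append, List.mem_singleton] using h
    exacts [ih hφ.2 h, hφ]
  | and φ ψ ih₁ ih₂ | or φ ψ ih₁ ih₂ =>
    obtain (h | h) | rfl := by simpa only [flat, List.mem_append, List.mem_singleton] using h
    exacts [ih₁ hφ.1 h, ih₂ hφ.2 h, hφ]

theorem Uniform.logString_gate {D : ℕ} {ψ : Formula} (hψ : ψ.Uniform D) (K : ℕ) (hg : LogNat g) :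
    LogString fun a => (ψ.gate D K (inp a).length (g a)).encode := by
  classical
  have size := LogNat.base (α := α).pow_const D
  have hsub (s : ℕ) : LogNat fun a => g a - s * base (inp a).length ^ D :=
    hg.sub ((LogNat.const s).mul size)
  have hfalse : LogString fun _ : α => (Gate.or []).encode :=
    .append (.kind true true) (.bit false)
  cases ψ with
  | num p =>
    refine (LogString.ite (hψ (hg.gateEnv D)) (.append (.kind true false) (.bit false))
      hfalse).congr fun a => ?_
    simp only [gate]
    split <;> rfl
  | lit pos =>
    have hpos := hψ (hg.gateEnv D)
    refine (LogString.ite (.lt hpos .length) (.append (.kind false false) (.unary hpos))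
      hfalse).congr fun a => ?_
    simp only [gate]
    split <;> rfl
  | not => exact .append (.kind false true) (.unary (hg.sub size))
  | and => exact .append (.kind true false) (.encodeList_pair (hg.sub size) (hsub _))
  | or => exact .append (.kind true true) (.encodeList_pair (hg.sub size) (hsub _))
  | ex => exact .append (.kind true true) (.encodeList_filter (.quantChild hg.weaken .snd hψ.1) hg)
  | all =>
    exact .append (.kind true false) (.encodeList_filter (.quantChild hg.weaken .snd hψ.1) hg)
  | call =>
    exact .append (.kind true true) (.encodeList_filter (.callChild hg.weaken .snd hψ D K) hg)

theorem Uniform.logString_circuit {D : ℕ} {φ : Formula} (hφ : φ.Uniform D) {T : α → ℕ}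
    (hT : LogNat T) : LogString fun a => (φ.circuit D (T a) (inp a).length).encode := by
  have size := LogNat.base (α := α).pow_const D
  have hblock : LogNat fun b : α × ℕ => b.2 / base (inp b.1).length ^ D % φ.size :=
    (LogNat.snd.div size.weaken).mod (.const _)
  refine (LogString.flatMap (.getD (F := fun ψ (b : α × ℕ) =>
      (ψ.gate D φ.size (inp b.1).length b.2).encode)
    (fun ψ hψ => (hφ.of_mem_flat hψ).logString_gate _ .snd) (hφ.logString_gate _ .snd) hblock)
    ((hT.mul (.const φ.size)).mul size)).congr fun a => ?_
  simp only [Circuit.encode, circuit, List.flatMap_map, subformula]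

end Formula

end

namespace Formula

theorem flat_eq_concat (φ : Formula) : ∃ l, φ.flat = l ++ [φ] := by
  cases φ with
  | num | lit | call => exact ⟨[], rfl⟩
  | _ => exact ⟨_, rfl⟩

theorem size_pos (φ : Formula) : 0 < φ.size := by
  obtain ⟨l, h⟩ := φ.flat_eq_concat
  simp [size, h]

theorem getElem?_of_isPrefix {χ : Formula} {l L : List Formula} {n : ℕ} (h : l ++ χ.flat <+: L)
    (hn : n + 1 = l.length + χ.size) : L[n]? = some χ := by
  obtain ⟨l', rfl⟩ := h
  obtain ⟨k, hk⟩ := χ.flat_eq_concat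
  simp only [size, hk, List.length_append, List.length_singleton] at hn ⊢
  obtain rfl : n = l.length + k.length := by omega
  simp

theorem exists_prefix_of_last {φ ψ : Formula} {σ : ℕ} (h : φ.flat[σ]? = some ψ)
    (hσ : φ.size ≤ σ + 1) : ∃ l, l ++ ψ.flat <+: φ.flat ∧ l.length + ψ.size = σ + 1 := by
  have hlt : σ < φ.size := (List.getElem?_eq_some_iff.1 h).1
  have hlast := getElem?_of_isPrefix (l := []) φ.flat.prefix_rfl (n := σ) (by simpa using by omega)
  obtain rfl := Option.some.inj (h.symm.trans hlast)
  exact ⟨[], List.prefix_rfl, by simpa using by omega⟩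

theorem exists_prefix_flat {φ ψ : Formula} {σ : ℕ} (h : φ.flat[σ]? = some ψ) :
    ∃ l, l ++ ψ.flat <+: φ.flat ∧ l.length + ψ.size = σ + 1 := by
  induction φ generalizing σ with
  | num | lit | call => exact exists_prefix_of_last h (Nat.succ_le_succ (Nat.zero_le σ))
  | not φ ih | ex _ φ ih | all _ φ ih =>
    obtain hσ | hσ := lt_or_ge σ φ.size
    · rw [flat, List.getElem?_append_left hσ] at h
      obtain ⟨l, hl, hlen⟩ := ih h
      exact ⟨l, hl.trans (List.prefix_append _ _), hlen⟩
    · exact exists_prefix_of_last h (by simpa [size, flat] using hσ)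
  | and φ χ ih₁ ih₂ | or φ χ ih₁ ih₂ =>
    obtain hσ | hσ := lt_or_ge σ φ.size
    · rw [flat, List.append_assoc, List.getElem?_append_left hσ] at h
      obtain ⟨l, hl, hlen⟩ := ih₁ h
      exact ⟨l, hl.trans (by simp [flat]), hlen⟩
    obtain hσ' | hσ' := lt_or_ge (σ - φ.size) χ.size
    · rw [flat, List.append_assoc, List.getElem?_append_right hσ,
        List.getElem?_append_left (by exact hσ')] at h
      obtain ⟨l, hl, hlen⟩ := ih₂ h
      refine ⟨φ.flat ++ l, ?_, ?_⟩
      · rw [flat, List.append_assoc, List.append_assoc, List.prefix_append_right_inj]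
        exact hl.trans (List.prefix_append _ _)
      · simp only [size, List.length_append] at hσ hlen ⊢
        omega
    · refine exists_prefix_of_last h ?_
      simp only [size, flat, List.length_append, List.length_singleton] at hσ hσ' ⊢
      omega

section

variable {φ ψ χ : Formula} {q : ℕ} {l l' : List Formula}

theorem getElem?_flat_subformula (φ : Formula) (q : ℕ) :
    φ.flat[q % φ.size]? = some (φ.subformula q) := by
  have hq : q % φ.size < φ.flat.length := Nat.mod_lt _ φ.size_pos
  rw [subformula, List.getD_eq_getElem?_getD, List.getElem?_eq_getElem hq, Option.getD_some]

theorem Uniform.subformula {D : ℕ} (hφ : φ.Uniform D) (q : ℕ) : (φ.subformula q).Uniform D :=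
  hφ.of_mem_flat (List.mem_of_getElem? (φ.getElem?_flat_subformula q))

theorem subformula_eq (h : φ.flat[q % φ.size]? = some χ) : φ.subformula q = χ :=
  Option.some.inj ((φ.getElem?_flat_subformula q).symm.trans h)

theorem subformula_sub (hq : φ.subformula q = ψ) (hψ : ψ.flat = l ++ χ.flat ++ l') :
    l'.length ≤ q % φ.size ∧ φ.subformula (q - l'.length) = χ := by
  obtain ⟨k, hk, hlen⟩ := exists_prefix_flat (hq ▸ φ.getElem?_flat_subformula q)
  have hχ := χ.size_pos
  have hsize : ψ.size = l.length + χ.size + l'.length := by simp [size, hψ, add_assoc]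
  have hle : l'.length ≤ q % φ.size := by omega
  refine ⟨hle, subformula_eq ?_⟩
  rw [← Nat.mod_sub_of_le hle]
  rw [hψ, ← List.append_assoc, ← List.append_assoc] at hk
  refine getElem?_of_isPrefix ((List.prefix_append _ _).trans hk) ?_
  rw [List.length_append]
  omega

/-- The truth value that block `q` of the circuit computes for the assignment `v`. -/
def BlockHolds (φ : Formula) (D : ℕ) (w : List Bool) (q : ℕ) (v : Env) : Prop :=
  (φ.subformula q).Eval D w (φ.stage D w (q / φ.size)) v

variable {D : ℕ} {w : List Bool} {v : Env}

theorem blockHolds_sub (hq : φ.subformula q = ψ) (hψ : ψ.flat = l ++ χ.flat ++ l') :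
    φ.BlockHolds D w (q - l'.length) v ↔ χ.Eval D w (φ.stage D w (q / φ.size)) v := by
  obtain ⟨hle, hχ⟩ := subformula_sub hq hψ
  have hdiv : (q - l'.length) / φ.size = q / φ.size := by
    rw [← Nat.mod_add_div q φ.size, Nat.sub_add_comm hle, Nat.add_mul_div_left _ _ φ.size_pos,
      Nat.add_mul_div_left _ _ φ.size_pos, Nat.div_eq_of_lt (Nat.mod_lt _ φ.size_pos),
      Nat.div_eq_of_lt ((Nat.sub_le _ _).trans_lt (Nat.mod_lt _ φ.size_pos))]
  rw [BlockHolds, hdiv, hχ]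

theorem blockHolds_last {ℓ : ℕ} (hℓ : 0 < ℓ) :
    φ.BlockHolds D w (ℓ * φ.size - 1) v ↔ φ.stage D w ℓ v := by
  obtain ⟨t, rfl⟩ := Nat.exists_eq_succ_of_ne_zero hℓ.ne'
  have hK := φ.size_pos
  have hpos : 0 < φ.size * (t + 1) := Nat.mul_pos hK t.succ_pos
  have hsub : φ.subformula (φ.size * (t + 1) - (0 + 1)) = φ :=
    subformula_eq (getElem?_of_isPrefix (l := []) List.prefix_rfl (by
      rw [Nat.mul_sub_mod hpos, Nat.zero_mod, List.length_nil]
      omega))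
  rw [mul_comm, BlockHolds, hsub, Nat.mul_sub_div _ _ _ hpos, Nat.zero_div]
  rfl

end

end Formula

section

variable {D N g : ℕ}

theorem exists_decodeEnv {b : ℕ} (hb : 0 < b) (D : ℕ) (v : Env) :
    ∃ a < b ^ D, decodeEnv b D a = normEnv b D v := by
  set a := finFunctionFinEquiv fun i : Fin D => (⟨v i % b, Nat.mod_lt _ hb⟩ : Fin b)
  refine ⟨a, a.isLt, funext fun i => ?_⟩
  rw [decodeEnv, normEnv, normEnv]
  split
  case isTrue hi =>
    exact congrArg Fin.val (congrFun (finFunctionFinEquiv.symm_apply_apply _) (⟨i, hi⟩ : Fin D))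
  case isFalse => rfl

theorem exists_gate (D N q : ℕ) (v : Env) :
    ∃ g, g / base N ^ D = q ∧ gateEnv D N g = normEnv (base N) D v := by
  obtain ⟨a, ha, hv⟩ := exists_decodeEnv (base_pos N) D v
  have hlt : base N ^ D - 1 - a < base N ^ D := by omega
  refine ⟨base N ^ D * q + (base N ^ D - 1 - a), ?_, ?_⟩
  · rw [Nat.mul_add_div (by omega), Nat.div_eq_of_lt hlt, add_zero]
  · rw [gateEnv, Nat.mul_add_mod, Nat.mod_eq_of_lt hlt, ← hv]
    congr 1
    omega

theorem gateEnv_lt (i : ℕ) : gateEnv D N g i < base N := by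
  rw [gateEnv, decodeEnv, normEnv]
  split
  exacts [Nat.mod_lt _ (base_pos N), base_pos N]

theorem normEnv_update_gateEnv {i t : ℕ} (hi : i < D) (ht : t < base N) :
    normEnv (base N) D (Function.update (gateEnv D N g) i t) =
      Function.update (gateEnv D N g) i t := by
  funext j
  rw [normEnv, Function.update_apply]
  split_ifs with hj hji hji
  · exact Nat.mod_eq_of_lt ht
  · exact Nat.mod_eq_of_lt (gateEnv_lt j)
  · omega
  · exact (gateEnv_of_le (not_lt.1 hj)).symm

theorem exists_quantChild {i t : ℕ} (hi : i < D) (ht : t < base N) (hg : 0 < g / base N ^ D) :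
    ∃ h < g, QuantChild D N i g h ∧ gateEnv D N h i = t := by
  obtain ⟨h, hq, hv⟩ := exists_gate D N (g / base N ^ D - 1) (Function.update (gateEnv D N g) i t)
  rw [normEnv_update_gateEnv hi ht] at hv
  have hself : gateEnv D N h i = t := by rw [hv, Function.update_self]
  exact ⟨h, Nat.lt_of_div_lt_div (c := base N ^ D) (by omega), ⟨by omega, by rw [hself, hv]⟩, hself⟩

theorem exists_callChild {K : ℕ} (f : ℕ → Env → Env) (hg : 0 < g / base N ^ D / K * K) :
    ∃ h < g, CallChild D K N f g h := by
  obtain ⟨h, hq, hv⟩ := exists_gate D N (g / base N ^ D / K * K - 1) (f N (gateEnv D N g))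
  have hle := Nat.div_mul_le_self (g / base N ^ D) K
  exact ⟨h, Nat.lt_of_div_lt_div (c := base N ^ D) (by omega), by omega, hv⟩

theorem sub_mul_div_gate {s : ℕ} (hs : s ≤ g / base N ^ D) :
    (g - s * base N ^ D) / base N ^ D = g / base N ^ D - s ∧
      gateEnv D N (g - s * base N ^ D) = gateEnv D N g := by
  have hle : base N ^ D * s ≤ g := by
    rw [mul_comm]
    exact (Nat.le_div_iff_mul_le (pow_pos (base_pos N) D)).1 hs
  rw [mul_comm]
  exact ⟨Nat.sub_mul_div _ _ _, by rw [gateEnv, gateEnv, Nat.sub_mul_mod hle]⟩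

theorem mul_sub_one_gate {Q : ℕ} (hQ : 0 < Q) :
    (Q * base N ^ D - 1) / base N ^ D = Q - 1 ∧ gateEnv D N (Q * base N ^ D - 1) = 0 := by
  have hpos : 0 < base N ^ D * Q := Nat.mul_pos (pow_pos (base_pos N) D) hQ
  rw [mul_comm]
  refine ⟨by simpa using Nat.mul_sub_div 0 _ _ hpos, funext fun i => ?_⟩
  have hmod : (base N ^ D * Q - 1) % base N ^ D = base N ^ D - 1 := by
    simpa using Nat.mul_sub_mod hpos
  rw [gateEnv, hmod, Nat.sub_self, decodeEnv, normEnv]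
  simp

end

namespace Formula

variable {φ ψ χ : Formula} {D : ℕ} {w : List Bool} {g : ℕ} {l l' : List Formula}

open Classical in
/-- The value of gate `g` of the circuit on input `w`. -/
noncomputable def gateValue (φ : Formula) (D : ℕ) (w : List Bool) (g : ℕ) : Bool :=
  decide (φ.BlockHolds D w (g / base w.length ^ D) (gateEnv D w.length g))

theorem gateValue_eq_true : φ.gateValue D w g = true ↔
    φ.BlockHolds D w (g / base w.length ^ D) (gateEnv D w.length g) := by
  simp only [gateValue, decide_eq_true_eq]

theorem gateValue_quantChild {i h : ℕ} (hq : φ.subformula (g / base w.length ^ D) = ψ)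
    (hψ : ψ.flat = χ.flat ++ [ψ]) (hh : QuantChild D w.length i g h) :
    φ.gateValue D w h = true ↔ χ.Eval D w (φ.stage D w (g / base w.length ^ D / φ.size))
      (Function.update (gateEnv D w.length g) i (gateEnv D w.length h i)) := by
  rw [gateValue_eq_true, Nat.eq_sub_of_add_eq hh.1, hh.2, Function.update_self]
  exact blockHolds_sub (l := []) hq hψ

theorem gateValue_callChild {f : ℕ → Env → Env} {h : ℕ}
    (hh : CallChild D φ.size w.length f g h) :
    φ.gateValue D w h = true ↔ φ.stage D w (g / base w.length ^ D / φ.size)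
      (normEnv (base w.length) D (f w.length (gateEnv D w.length g))) := by
  have hpos : 0 < g / base w.length ^ D / φ.size :=
    Nat.pos_of_mul_pos_right (Nat.lt_of_lt_of_eq (Nat.succ_pos _) hh.1)
  rw [gateValue_eq_true, Nat.eq_sub_of_add_eq hh.1, hh.2, blockHolds_last hpos]

theorem div_pos_of_subformula (hq : φ.subformula (g / base w.length ^ D) = ψ)
    (hψ : ψ.flat = χ.flat ++ [ψ]) : 0 < g / base w.length ^ D :=
  ((subformula_sub (l := []) hq hψ).1.trans (Nat.mod_le _ _))

theorem getD_gateValues {j : ℕ} (h : j < g) :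
    ((List.range g).map (φ.gateValue D w)).getD j false = φ.gateValue D w j := by
  simp [h]

theorem getD_sub_gate (hq : φ.subformula (g / base w.length ^ D) = ψ)
    (hψ : ψ.flat = l ++ χ.flat ++ l') (hl' : 0 < l'.length) :
    ((List.range g).map (φ.gateValue D w)).getD (g - l'.length * base w.length ^ D) false = true ↔
      χ.Eval D w (φ.stage D w (g / base w.length ^ D / φ.size)) (gateEnv D w.length g) := by
  have hle := (subformula_sub hq hψ).1.trans (Nat.mod_le _ _)
  obtain ⟨hdiv, henv⟩ := sub_mul_div_gate hle
  rw [getD_gateValues (Nat.lt_of_div_lt_div (c := base w.length ^ D) (by omega)),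
    gateValue_eq_true, hdiv, henv, blockHolds_sub hq hψ]

theorem getD_pred_gate (hq : φ.subformula (g / base w.length ^ D) = ψ)
    (hψ : ψ.flat = l ++ χ.flat ++ [ψ]) :
    ((List.range g).map (φ.gateValue D w)).getD (g - base w.length ^ D) false = true ↔
      χ.Eval D w (φ.stage D w (g / base w.length ^ D / φ.size)) (gateEnv D w.length g) := by
  rw [← getD_sub_gate hq hψ Nat.one_pos, List.length_singleton, one_mul]

theorem getD_left_gate {χ' : Formula} (hq : φ.subformula (g / base w.length ^ D) = ψ)
    (hψ : ψ.flat = χ.flat ++ χ'.flat ++ [ψ]) :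
    ((List.range g).map (φ.gateValue D w)).getD (g - (χ'.size + 1) * base w.length ^ D) false =
        true ↔
      χ.Eval D w (φ.stage D w (g / base w.length ^ D / φ.size)) (gateEnv D w.length g) := by
  have hlen : (χ'.flat ++ [ψ]).length = χ'.size + 1 := List.length_append
  rw [← getD_sub_gate (l := []) (l' := χ'.flat ++ [ψ]) hq (by rw [hψ]; simp) (by omega), hlen]

open Classical in
theorem any_quantChild {i : ℕ} (hi : i < D) (hq : φ.subformula (g / base w.length ^ D) = ψ)
    (hψ : ψ.flat = χ.flat ++ [ψ]) :
    (((List.range g).filter fun h => QuantChild D w.length i g h).any fun j =>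
        ((List.range g).map (φ.gateValue D w)).getD j false) = true ↔
      ∃ t < base w.length, χ.Eval D w (φ.stage D w (g / base w.length ^ D / φ.size))
        (Function.update (gateEnv D w.length g) i t) := by
  simp only [List.any_eq_true, List.mem_filter, List.mem_range, decide_eq_true_eq]
  constructor
  · rintro ⟨h, ⟨hlt, hh⟩, hval⟩
    rw [getD_gateValues hlt, gateValue_quantChild hq hψ hh] at hval
    exact ⟨_, gateEnv_lt i, hval⟩
  · rintro ⟨t, ht, hval⟩
    obtain ⟨h, hlt, hh, rfl⟩ := exists_quantChild hi ht (div_pos_of_subformula hq hψ)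
    exact ⟨h, ⟨hlt, hh⟩, by rwa [getD_gateValues hlt, gateValue_quantChild hq hψ hh]⟩

open Classical in
theorem all_quantChild {i : ℕ} (hi : i < D) (hq : φ.subformula (g / base w.length ^ D) = ψ)
    (hψ : ψ.flat = χ.flat ++ [ψ]) :
    (((List.range g).filter fun h => QuantChild D w.length i g h).all fun j =>
        ((List.range g).map (φ.gateValue D w)).getD j false) = true ↔
      ∀ t < base w.length, χ.Eval D w (φ.stage D w (g / base w.length ^ D / φ.size))
        (Function.update (gateEnv D w.length g) i t) := by
  simp only [List.all_eq_true, List.mem_filter, List.mem_range, decide_eq_true_eq]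
  constructor
  · intro hall t ht
    obtain ⟨h, hlt, hh, rfl⟩ := exists_quantChild hi ht (div_pos_of_subformula hq hψ)
    rw [← gateValue_quantChild hq hψ hh, ← getD_gateValues hlt]
    exact hall h ⟨hlt, hh⟩
  · rintro hall h ⟨hlt, hh⟩
    rw [getD_gateValues hlt, gateValue_quantChild hq hψ hh]
    exact hall _ (gateEnv_lt i)

open Classical in
theorem any_callChild (f : ℕ → Env → Env) :
    (((List.range g).filter fun h => CallChild D φ.size w.length f g h).any fun j =>
        ((List.range g).map (φ.gateValue D w)).getD j false) = true ↔
      φ.stage D w (g / base w.length ^ D / φ.size)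
        (normEnv (base w.length) D (f w.length (gateEnv D w.length g))) := by
  simp only [List.any_eq_true, List.mem_filter, List.mem_range, decide_eq_true_eq]
  constructor
  · rintro ⟨h, ⟨hlt, hh⟩, hval⟩
    rwa [getD_gateValues hlt, gateValue_callChild hh] at hval
  · intro hval
    have hpos : 0 < g / base w.length ^ D / φ.size :=
      Nat.pos_of_ne_zero fun h0 => by rwa [h0] at hval
    obtain ⟨h, hlt, hh⟩ := exists_callChild f (Nat.mul_pos hpos φ.size_pos)
    exact ⟨h, ⟨hlt, hh⟩, by rwa [getD_gateValues hlt, gateValue_callChild hh]⟩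

theorem value_gate (hφ : φ.Uniform D) (hq : φ.subformula (g / base w.length ^ D) = ψ) :
    (ψ.gate D φ.size w.length g).value w ((List.range g).map (φ.gateValue D w)) =
      φ.gateValue D w g := by
  have hψ := hq ▸ hφ.subformula _
  rw [Bool.eq_iff_iff, gateValue_eq_true, BlockHolds, hq]
  cases ψ with
  | num p =>
    simp only [gate, Eval]
    split <;> simp_all [Gate.value]
  | lit pos =>
    simp only [gate, Eval]
    split
    case isTrue => rfl
    case isFalse hpos => rw [List.getD_eq_default _ _ (not_lt.1 hpos)]; rfl
  | not χ =>
    rw [gate, Gate.value, Bool.not_eq_true', ← Bool.not_eq_true, getD_pred_gate (l := []) hq rfl]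
    rfl
  | and χ₁ χ₂ =>
    rw [Eval, ← getD_left_gate hq rfl, ← getD_pred_gate hq rfl]
    simp [gate, Gate.value, and_comm]
  | or χ₁ χ₂ =>
    rw [Eval, ← getD_left_gate hq rfl, ← getD_pred_gate hq rfl]
    simp [gate, Gate.value, or_comm]
  | ex i χ => exact any_quantChild hψ.1 hq rfl
  | all i χ => exact all_quantChild hψ.1 hq rfl
  | call f => exact any_callChild f

end Formula

/-- The gates read by a gate. -/
def Gate.deps : Gate → List ℕ
  | input _ => []
  | not j => [j]
  | and js => js
  | or js => js

theorem Gate.depth_le {ds : List ℕ} {G : Gate} {b : ℕ} (h : ∀ j ∈ G.deps, ds.getD j 0 ≤ b) :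
    G.depth ds ≤ b + 1 := by
  cases G with
  | input i => exact Nat.zero_le _
  | not j => exact Nat.succ_le_succ (h j (List.mem_singleton_self j))
  | and js | or js =>
    exact Nat.succ_le_succ (List.max_le_of_forall_le _ _ (List.forall_mem_map.2 h))

namespace Circuit

theorem values_map_range {x : List Bool} {gate : ℕ → Gate} {val : ℕ → Bool} {T : ℕ}
    (h : ∀ g < T, (gate g).value x ((List.range g).map val) = val g) :
    values x ((List.range T).map gate) = (List.range T).map val := by
  induction T with
  | zero => rfl
  | succ T ih =>
    have ih := ih fun g hg => h g (by omega)
    rw [values] at ih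
    rw [values, List.range_succ, List.map_append, List.foldl_append, ih]
    simp [h T (by omega)]

theorem depths_map_range {gate : ℕ → Gate} {bnd : ℕ → ℕ} {T : ℕ}
    (h : ∀ g < T, ∀ j ∈ (gate g).deps, j < g ∧ bnd j < bnd g) :
    (depths ((List.range T).map gate)).length = T ∧
      ∀ j < T, (depths ((List.range T).map gate)).getD j 0 ≤ bnd j + 1 := by
  induction T with
  | zero => exact ⟨rfl, nofun⟩
  | succ T ih =>
    obtain ⟨hlen, hle⟩ := ih fun g hg => h g (by omega)
    set ds := depths ((List.range T).map gate) with hds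
    have hT : (gate T).depth ds ≤ bnd T + 1 := Gate.depth_le fun j hj => by
      obtain ⟨hjT, hbnd⟩ := h T (by omega) j hj
      exact (hle j hjT).trans hbnd
    have hsucc : depths ((List.range (T + 1)).map gate) = ds ++ [(gate T).depth ds] := by
      rw [depths, List.range_succ, List.map_append, List.foldl_append]
      rfl
    rw [hsucc]
    refine ⟨by simp [hlen], fun j hj => ?_⟩
    rcases Nat.lt_succ_iff_lt_or_eq.1 hj with hj | rfl
    · rw [List.getD_append _ _ _ _ (by omega)]
      exact hle j hj
    · rw [List.getD_append_right _ _ _ _ (by omega), hlen]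
      simpa using hT

theorem depth_map_range_le {gate : ℕ → Gate} {bnd : ℕ → ℕ} {T d : ℕ}
    (h : ∀ g < T, ∀ j ∈ (gate g).deps, j < g ∧ bnd j < bnd g) (hd : ∀ g < T, bnd g < d) :
    depth ((List.range T).map gate) ≤ d := by
  obtain ⟨hlen, hle⟩ := depths_map_range h
  refine List.max_le_of_forall_le _ _ fun a ha => ?_
  obtain ⟨j, hj, rfl⟩ := List.mem_iff_getElem.1 ha
  rw [← List.getD_eq_getElem _ 0]
  exact (hle j (hlen ▸ hj)).trans (hd j (hlen ▸ hj))

end Circuit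

namespace Formula

variable {φ ψ : Formula} {D N T g : ℕ}

theorem deps_gate (hq : φ.subformula (g / base N ^ D) = ψ) :
    ∀ j ∈ (ψ.gate D φ.size N g).deps, j / base N ^ D < g / base N ^ D := by
  have hsub {χ l l'} (hψ : ψ.flat = l ++ flat χ ++ l') (hl' : 0 < l'.length) :
      (g - l'.length * base N ^ D) / base N ^ D < g / base N ^ D := by
    have hle := (subformula_sub hq hψ).1.trans (Nat.mod_le _ _)
    rw [(sub_mul_div_gate hle).1]
    omega
  have hpred {χ l} (hψ : ψ.flat = l ++ flat χ ++ [ψ]) :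
      (g - base N ^ D) / base N ^ D < g / base N ^ D := by
    simpa using hsub hψ Nat.one_pos
  intro j hj
  cases ψ with
  | num | lit =>
    simp only [gate] at hj
    split at hj <;> exact absurd hj List.not_mem_nil
  | not χ =>
    obtain rfl := List.mem_singleton.1 hj
    exact hpred (l := []) rfl
  | and χ₁ χ₂ | or χ₁ χ₂ =>
    obtain rfl | rfl := List.mem_pair.1 hj
    · exact hpred rfl
    · simpa [size] using hsub (l := []) (List.append_assoc _ _ _) (by simp)
  | ex i χ | all i χ =>
    simp only [gate, Gate.deps, List.mem_filter, decide_eq_true_eq] at hj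
    exact hj.2.1.le
  | call f =>
    simp only [gate, Gate.deps, List.mem_filter, decide_eq_true_eq] at hj
    exact hj.2.1.trans_le (Nat.div_mul_le_self _ _)

theorem lt_of_gate_eq_input {K i : ℕ} (h : ψ.gate D K N g = .input i) : i < N := by
  cases ψ with
  | num =>
    simp only [gate] at h
    split at h <;> exact Gate.noConfusion h
  | lit pos =>
    simp only [gate] at h
    split at h
    case isTrue hi => exact Gate.input.inj h ▸ hi
    case isFalse => exact Gate.noConfusion h
  | _ => exact Gate.noConfusion h

theorem wellFormed_gate (hq : φ.subformula (g / base N ^ D) = ψ) :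
    (ψ.gate D φ.size N g).WellFormed N g := by
  have hdeps (j : ℕ) (hj : j ∈ (ψ.gate D φ.size N g).deps) : j < g :=
    Nat.lt_of_div_lt_div (deps_gate hq j hj)
  have hinput (i : ℕ) :=
    lt_of_gate_eq_input (ψ := ψ) (D := D) (N := N) (g := g) (K := φ.size) (i := i)
  cases h : ψ.gate D φ.size N g with rw [h] at hdeps
  | input i => exact hinput i h
  | not j => exact hdeps j (List.mem_singleton_self j)
  | and | or => exact hdeps

theorem length_circuit (φ : Formula) (D T N : ℕ) :
    (φ.circuit D T N).length = T * φ.size * base N ^ D := by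
  rw [circuit, List.length_map, List.length_range]

theorem wellFormed_circuit (φ : Formula) (D N : ℕ) (hT : 0 < T) :
    (φ.circuit D T N).WellFormed N := by
  refine ⟨List.ne_nil_of_length_pos ?_, fun g hg => ?_⟩
  · rw [length_circuit]
    exact Nat.mul_pos (Nat.mul_pos hT φ.size_pos) (pow_pos (base_pos N) D)
  · simp only [circuit, List.getElem_map, List.getElem_range]
    exact wellFormed_gate rfl

theorem depth_circuit_le (φ : Formula) (D T N : ℕ) : (φ.circuit D T N).depth ≤ T * φ.size :=
  Circuit.depth_map_range_le (bnd := fun g => g / base N ^ D)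
    (fun _ _ j hj => have hlt := deps_gate rfl j hj
      ⟨Nat.lt_of_div_lt_div hlt, hlt⟩)
    fun _ hg => Nat.div_lt_of_lt_mul (by rwa [mul_comm])

theorem output_circuit (hφ : φ.Uniform D) (hT : 0 < T) (w : List Bool) :
    (φ.circuit D T w.length).output w = true ↔ φ.stage D w T 0 := by
  have hQ : 0 < T * φ.size := Nat.mul_pos hT φ.size_pos
  have hlen : 0 < T * φ.size * base w.length ^ D := Nat.mul_pos hQ (pow_pos (base_pos _) D)
  obtain ⟨hdiv, henv⟩ := mul_sub_one_gate (D := D) (N := w.length) hQ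
  rw [Circuit.output, circuit, Circuit.values_map_range fun g _ => value_gate hφ rfl,
    ← Nat.sub_add_cancel hlen, List.range_succ, List.map_append, List.map_singleton,
    List.getLastD_concat, gateValue_eq_true, hdiv, henv, blockHolds_last hT]

end Formula

theorem base_pow (N D : ℕ) : base N ^ D = (N + 2) ^ (2 * D) := (pow_mul _ _ _).symm

theorem add_two_pow_le {N d c : ℕ} (h : d ≤ c) : (N + 2) ^ d ≤ 3 ^ d * (N ^ c + 1) := by
  rcases Nat.eq_zero_or_pos N with rfl | hN
  · exact (Nat.pow_le_pow_left (by omega) d).trans (Nat.le_mul_of_pos_right _ (Nat.succ_pos _))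
  · calc (N + 2) ^ d ≤ (3 * N) ^ d := Nat.pow_le_pow_left (by omega) _
      _ = 3 ^ d * N ^ d := mul_pow _ _ _
      _ ≤ 3 ^ d * (N ^ c + 1) := by
        gcongr
        exact (Nat.pow_le_pow_right hN h).trans (Nat.le_succ _)

namespace Formula

theorem length_circuit_le (φ : Formula) {D T N r c : ℕ} (hT : T ≤ r * (N + 2))
    (hc : r * φ.size * 3 ^ (2 * D + 1) + 2 * D + 1 ≤ c) :
    (φ.circuit D T N).length ≤ c * N ^ c + c := by
  rw [length_circuit, base_pow]
  calc T * φ.size * (N + 2) ^ (2 * D) ≤ r * (N + 2) * φ.size * (N + 2) ^ (2 * D) := by gcongr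
    _ = r * φ.size * (N + 2) ^ (2 * D + 1) := by ring
    _ ≤ r * φ.size * (3 ^ (2 * D + 1) * (N ^ c + 1)) := by
      gcongr
      exact add_two_pow_le (by omega)
    _ = r * φ.size * 3 ^ (2 * D + 1) * (N ^ c + 1) := by ring
    _ ≤ c * (N ^ c + 1) := by
      gcongr
      omega
    _ = c * N ^ c + c := by ring

theorem Uniform.mem_FOLL {φ : Formula} {D : ℕ} (hφ : φ.Uniform D) (r : ℕ) {A : Language Bool}
    (hA : ∀ w : List Bool, w ∈ A ↔ φ.stage D w (Nat.log 2 (Nat.log 2 w.length) + r + 1) 0) :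
    A ∈ FOLL := by
  set c := (r + 1) * φ.size * 3 ^ (2 * D + 1) + 2 * D + 1 with hc
  refine ⟨fun N => φ.circuit D (Nat.log 2 (Nat.log 2 N) + r + 1) N, c, ?_, fun N => ⟨?_, ?_, ?_⟩,
    fun w => ?_⟩
  · have := logSpaceOnUnary (hφ.logString_circuit (α := List Bool)
      (((LogNat.length.log.log).add (.const r)).succ))
    simpa [inp] using this
  · exact wellFormed_circuit φ D N (Nat.succ_pos _)
  · have hlog := (Nat.log_le_self 2 (Nat.log 2 N)).trans (Nat.log_le_self 2 N)
    exact length_circuit_le φ (r := r + 1) (by nlinarith) hc.ge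
  · have hsize : (r + 1) * φ.size ≤ c := by
      have := Nat.le_mul_of_pos_right ((r + 1) * φ.size) (pow_pos three_pos (2 * D + 1))
      omega
    calc (φ.circuit D (Nat.log 2 (Nat.log 2 N) + r + 1) N).depth
        ≤ (Nat.log 2 (Nat.log 2 N) + r + 1) * φ.size := depth_circuit_le _ _ _ _
      _ ≤ (r + 1) * φ.size * Nat.log 2 (Nat.log 2 N) + (r + 1) * φ.size := by
        nlinarith [Nat.zero_le (r * φ.size * Nat.log 2 (Nat.log 2 N))]
      _ ≤ c * Nat.log 2 (Nat.log 2 N) + c := by gcongr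
  · rw [hA, output_circuit hφ (Nat.succ_pos _)]

end Formula

/-! ### Cubes in quasigroups -/

/-- The composition of the maps `f i, …, f (i + s - 1)`, the first of them applied first. -/
def walk {G : Type*} (f : ℕ → G → G) (i : ℕ) : ℕ → G → G
  | 0, u => u
  | s + 1, u => f (i + s) (walk f i s u)

theorem walk_add {G : Type*} (f : ℕ → G → G) (i s t : ℕ) (u : G) :
    walk f i (s + t) u = walk f (i + s) t (walk f i s u) := by
  induction t with
  | zero => rfl
  | succ t ih => rw [← Nat.add_assoc, walk, walk, ih, Nat.add_assoc]

theorem walk_congr {G : Type*} {f g : ℕ → G → G} {i s : ℕ} (h : ∀ j < s, f (i + j) = g (i + j))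
    (u : G) : walk f i s u = walk g i s u := by
  induction s with
  | zero => rfl
  | succ s ih => rw [walk, walk, ih fun j hj => h j (by omega), h s (by omega)]

section SquaredComplement

variable {G : Type*} [Fintype G] [DecidableEq G] {S : ℕ → Finset G}

theorem card_compl_le_mul_exp (h₀ : (S 0).Nonempty)
    (hS : ∀ k, Fintype.card G * (S (k + 1))ᶜ.card ≤ (S k)ᶜ.card ^ 2) (k : ℕ) :
    ((S k)ᶜ.card : ℝ) ≤ Fintype.card G * Real.exp (-(2 ^ k / Fintype.card G)) := by
  obtain ⟨u, hu⟩ := h₀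
  set n := Fintype.card G with hn
  have hn0 : 0 < n := Fintype.card_pos_iff.2 ⟨u⟩
  have hnR : (0 : ℝ) < n := by exact_mod_cast hn0
  induction k with
  | zero =>
    have hcard : (S 0)ᶜ.card + 1 ≤ n := by
      have := Finset.card_pos.2 ⟨u, hu⟩
      have := (S 0).card_add_card_compl
      omega
    calc ((S 0)ᶜ.card : ℝ) ≤ n - 1 := by
          rw [le_sub_iff_add_le]
          exact_mod_cast hcard
      _ = n * (-(2 ^ 0 / n) + 1) := by field_simp; ring
      _ ≤ n * Real.exp (-(2 ^ 0 / n)) := by gcongr; exact Real.add_one_le_exp _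
  | succ k ih =>
    refine le_of_mul_le_mul_left ?_ hnR
    calc (n : ℝ) * (S (k + 1))ᶜ.card ≤ ((S k)ᶜ.card : ℝ) ^ 2 := by exact_mod_cast hS k
      _ ≤ (n * Real.exp (-(2 ^ k / n))) ^ 2 := by gcongr
      _ = n * (n * Real.exp (-(2 ^ (k + 1) / n))) := by
        rw [mul_pow, ← Real.exp_nat_mul, sq, mul_assoc]
        congr 4
        push_cast
        ring

theorem eq_univ_of_card_compl_le (h₀ : (S 0).Nonempty)
    (hS : ∀ k, Fintype.card G * (S (k + 1))ᶜ.card ≤ (S k)ᶜ.card ^ 2) :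
    S (2 * Nat.clog 2 (Fintype.card G)) = Finset.univ := by
  have hbound := card_compl_le_mul_exp h₀ hS (2 * Nat.clog 2 (Fintype.card G))
  set n := Fintype.card G
  have hnR : (0 : ℝ) < n := by
    exact_mod_cast Fintype.card_pos_iff.2 ⟨h₀.choose⟩
  have hpow : (n : ℝ) ≤ 2 ^ (2 * Nat.clog 2 n) / n := by
    have : (n : ℝ) ≤ 2 ^ Nat.clog 2 n := by exact_mod_cast Nat.le_pow_clog (by omega) n
    rw [le_div_iff₀ hnR, mul_comm 2, pow_mul, sq]
    gcongr
  have hlt : (n : ℝ) * Real.exp (-(2 ^ (2 * Nat.clog 2 n) / n)) < 1 := by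
    rw [Real.exp_neg, ← div_eq_mul_inv, div_lt_one (Real.exp_pos _)]
    linarith [Real.add_one_le_exp ((2 : ℝ) ^ (2 * Nat.clog 2 n) / n)]
  have hcard : (S (2 * Nat.clog 2 n))ᶜ.card < 1 := by exact_mod_cast hbound.trans_lt hlt
  rwa [Nat.lt_one_iff, Finset.card_eq_zero, Finset.compl_eq_empty_iff] at hcard

end SquaredComplement

namespace IsQuasigroup

variable {G : Type*} {op : G → G → G}

theorem left_cancel (hq : IsQuasigroup op) {a x y : G} (h : op a x = op a y) : x = y :=
  (hq a (op a y)).1.unique h rfl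

theorem right_cancel (hq : IsQuasigroup op) {a x y : G} (h : op x a = op y a) : x = y :=
  (hq a (op y a)).2.unique h rfl

/-- Left multiplication as a permutation; its inverse is left division. -/
noncomputable def mulLeft (hq : IsQuasigroup op) (a : G) : G ≃ G :=
  Equiv.ofBijective (op a) ⟨fun _ _ h => hq.left_cancel h, fun b => (hq a b).1.exists⟩

/-- Right multiplication as a permutation; its inverse is right division. -/
noncomputable def mulRight (hq : IsQuasigroup op) (a : G) : G ≃ G :=
  Equiv.ofBijective (op · a) ⟨fun _ _ h => hq.right_cancel h, fun b => (hq a b).2.exists⟩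

theorem op_mulRight_symm (hq : IsQuasigroup op) (a u : G) : op ((hq.mulRight a).symm u) a = u :=
  (hq.mulRight a).apply_symm_apply u

/-- The map `u ↦ (u / b) h`, which is multiplication by `h` in a principal isotope of `op`. -/
noncomputable def shift (hq : IsQuasigroup op) (b h u : G) : G := op ((hq.mulRight b).symm u) h

theorem shift_eq_iff (hq : IsQuasigroup op) {b h u v : G} :
    hq.shift b h u = v ↔ ∃ z, op z b = u ∧ op z h = v := by
  constructor
  · exact fun h => ⟨_, hq.op_mulRight_symm b u, h⟩
  · rintro ⟨z, rfl, rfl⟩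
    exact congrArg (op · h) ((hq.mulRight b).symm_apply_apply z)

/-- The `i`-th of the shifts by `h 0, h 1, …` if the `i`-th bit of `e` selects it, and the identity
otherwise. Walking along these maps computes the cube element with exponent vector `e`. -/
noncomputable def pick (hq : IsQuasigroup op) (b : G) (h : ℕ → G) (e i : ℕ) (u : G) : G :=
  if e.testBit i then hq.shift b (h i) u else u

section Finite

variable [Fintype G] [DecidableEq G]

theorem card_filter_notMem_image_shift_le (hq : IsQuasigroup op) (b : G) (S : Finset G) (z : G) :
    (Finset.univ.filter fun g => z ∉ S.image (hq.shift b g)).card ≤ Sᶜ.card := by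
  choose q hq_shift using fun x => (hq ((hq.mulRight b).symm x) z).1.exists
  have hinj : Function.Injective q := fun x y hxy =>
    (hq.mulRight b).symm.injective <| hq.right_cancel (a := q x) <|
      (hq_shift x).trans ((hq_shift y).symm.trans (by rw [hxy]))
  rw [Finset.card_compl, ← Finset.card_image_of_injective S hinj, ← Finset.card_compl]
  refine Finset.card_le_card fun g hg => Finset.mem_compl.2 fun hgq => ?_
  obtain ⟨x, hx, rfl⟩ := Finset.mem_image.1 hgq
  exact (Finset.mem_filter.1 hg).2 (Finset.mem_image.2 ⟨x, hx, hq_shift x⟩)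

-- A uniformly random shift has this property on average.
theorem exists_card_compl_union_image_shift_le [Nonempty G] (hq : IsQuasigroup op) (b : G)
    (S : Finset G) : ∃ g, Fintype.card G * (S ∪ S.image (hq.shift b g))ᶜ.card ≤ Sᶜ.card ^ 2 := by
  have hsum : ∑ g : G, (S ∪ S.image (hq.shift b g))ᶜ.card ≤ Sᶜ.card ^ 2 := by
    have hcompl (g : G) : (S ∪ S.image (hq.shift b g))ᶜ =
        Finset.bipartiteAbove (fun g z => z ∉ S.image (hq.shift b g)) Sᶜ g := by
      ext z
      simp only [Finset.mem_compl, Finset.mem_union, not_or, Finset.mem_bipartiteAbove]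
    simp only [hcompl, Finset.sum_card_bipartiteAbove_eq_sum_card_bipartiteBelow]
    rw [sq, ← smul_eq_mul]
    exact Finset.sum_le_card_nsmul _ _ _ fun z _ => hq.card_filter_notMem_image_shift_le b S z
  obtain ⟨g, -, hg⟩ := Finset.exists_le_of_sum_le
    (f := fun g => Fintype.card G * (S ∪ S.image (hq.shift b g))ᶜ.card) (g := fun _ => Sᶜ.card ^ 2)
    (Finset.univ_nonempty (α := G)) (by
      rw [← Finset.mul_sum, Finset.sum_const, Finset.card_univ, smul_eq_mul]
      exact Nat.mul_le_mul_left _ hsum)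
  exact ⟨g, hg⟩

end Finite

theorem exists_walk_pick_eq_of_mem [DecidableEq G] (hq : IsQuasigroup op) {b u₀ : G} {h : ℕ → G}
    {S : ℕ → Finset G} (h₀ : S 0 = {u₀})
    (hS : ∀ k, S (k + 1) = S k ∪ (S k).image (hq.shift b (h k))) (k : ℕ) {v : G} (hv : v ∈ S k) :
    ∃ e < 2 ^ k, walk (hq.pick b h e) 0 k u₀ = v := by
  induction k generalizing v with
  | zero => exact ⟨0, by simp, (Finset.mem_singleton.1 (h₀ ▸ hv)).symm⟩
  | succ k ih =>
    rw [hS, Finset.mem_union] at hv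
    rcases hv with hv | hv
    · obtain ⟨e, he, rfl⟩ := ih hv
      refine ⟨e, by rw [pow_succ]; omega, ?_⟩
      rw [walk, pick, Nat.zero_add, Nat.testBit_lt_two_pow he]
      rfl
    · obtain ⟨u, hu, rfl⟩ := Finset.mem_image.1 hv
      obtain ⟨e, he, rfl⟩ := ih hu
      refine ⟨2 ^ k + e, by rw [pow_succ]; omega, ?_⟩
      have htop : (2 ^ k + e).testBit k = true := by
        rw [Nat.testBit_two_pow_add_eq, Nat.testBit_lt_two_pow he]
        rfl
      rw [walk, pick, Nat.zero_add, htop, if_pos rfl, walk_congr (g := hq.pick b _ e)]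
      intro j hj
      funext u
      rw [pick, pick, Nat.zero_add, Nat.testBit_two_pow_add_gt hj]

theorem exists_cube [Fintype G] [Nonempty G] (hq : IsQuasigroup op) (b u₀ : G) :
    ∃ h : ℕ → G, ∀ v, ∃ e < 2 ^ (2 * Nat.clog 2 (Fintype.card G)),
      walk (hq.pick b h e) 0 (2 * Nat.clog 2 (Fintype.card G)) u₀ = v := by
  classical
  choose g hg using hq.exists_card_compl_union_image_shift_le b
  let S : ℕ → Finset G := Nat.rec {u₀} fun _ S => S ∪ S.image (hq.shift b (g S))
  have huniv : S (2 * Nat.clog 2 (Fintype.card G)) = Finset.univ :=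
    eq_univ_of_card_compl_le (Finset.singleton_nonempty u₀) fun k => hg (S k)
  exact ⟨fun k => g (S k), fun v =>
    hq.exists_walk_pick_eq_of_mem (S := S) rfl (fun _ => rfl) _ (huniv ▸ Finset.mem_univ v)⟩

theorem walk_pick_isotopy {H : Type*} {op' : H → H → H} (hq : IsQuasigroup op)
    (hq' : IsQuasigroup op') {α β γ : G ≃ H} (h : ∀ x y, op' (α x) (β y) = γ (op x y)) (b : G)
    (g : ℕ → G) (e i s : ℕ) (u : G) :
    walk (hq'.pick (β b) (fun i => β (g i)) e) i s (γ u) = γ (walk (hq.pick b g e) i s u) := by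
  induction s with
  | zero => rfl
  | succ s ih =>
    rw [walk, walk, ih, pick, pick]
    split
    · rw [shift_eq_iff]
      refine ⟨α ((hq.mulRight b).symm _), ?_, h _ _⟩
      rw [h, hq.op_mulRight_symm]
    · rfl

end IsQuasigroup

/-! ### Isotopies from parametrizations -/

/-- For a parametrization `T` of a quasigroup: the equation `T e₃ = (T e₁ / b) (a \ T e₂)`, which
says that `T e₃` is the product of `T e₁` and `T e₂` in the principal isotope of `op` that is a loop
with neutral element `a b`. -/
def LoopTriple {X G : Type*} (op : G → G → G) (a b : G) (T : X → G) (e₁ e₂ e₃ : X) : Prop :=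
  ∃ x y, op x b = T e₁ ∧ op a y = T e₂ ∧ op x y = T e₃

section Isotopy

variable {X G H : Type*} {op₁ : G → G → G} {op₂ : H → H → H} {a b : G} {a' b' : H} {T : X → G}
  {T' : X → H}

-- Every element is a product with left factor `b`, so equal values of `T` are the same product, and
-- `T'` sees the same product.
theorem eq_of_loopTriple_imp (h₁ : IsQuasigroup op₁) (h₂ : IsQuasigroup op₂)
    (hT : Function.Surjective T)
    (h : ∀ e₁ e₂ e₃, LoopTriple op₁ a b T e₁ e₂ e₃ → LoopTriple op₂ a' b' T' e₁ e₂ e₃)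
    {e e' : X} (hee : T e = T e') : T' e = T' e' := by
  obtain ⟨y, hy⟩ := (h₁ b (T e)).1.exists
  obtain ⟨c, hc⟩ := hT (op₁ b b)
  obtain ⟨d, hd⟩ := hT (op₁ a y)
  obtain ⟨x₁, y₁, hx₁, hy₁, hxy₁⟩ := h c d e ⟨b, y, hc.symm, hd.symm, hy⟩
  obtain ⟨x₂, y₂, hx₂, hy₂, hxy₂⟩ := h c d e' ⟨b, y, hc.symm, hd.symm, hy.trans hee⟩
  rw [← hxy₁, ← hxy₂, h₂.right_cancel (hx₁.trans hx₂.symm), h₂.left_cancel (hy₁.trans hy₂.symm)]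

theorem isotopic_of_loopTriple_imp [Fintype G] [Fintype H] (h₁ : IsQuasigroup op₁)
    (h₂ : IsQuasigroup op₂) (hcard : Fintype.card G = Fintype.card H)
    (hT : Function.Surjective T) (hT' : Function.Surjective T')
    (h : ∀ e₁ e₂ e₃, LoopTriple op₁ a b T e₁ e₂ e₃ → LoopTriple op₂ a' b' T' e₁ e₂ e₃) :
    Isotopic op₁ op₂ := by
  choose r hr using hT
  have hsurj : Function.Surjective fun g => T' (r g) := fun v =>
    let ⟨e, he⟩ := hT' v
    ⟨T e, (eq_of_loopTriple_imp h₁ h₂ (fun g => ⟨r g, hr g⟩) h (hr _)).trans he⟩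
  let γ : G ≃ H := Equiv.ofBijective _
    ((Fintype.bijective_iff_surjective_and_card _).2 ⟨hsurj, hcard⟩)
  refine ⟨(h₁.mulRight b).trans (γ.trans (h₂.mulRight b').symm),
    (h₁.mulLeft a).trans (γ.trans (h₂.mulLeft a').symm), γ, fun x y => ?_⟩
  obtain ⟨x', y', hx', hy', hxy'⟩ := h (r (op₁ x b)) (r (op₁ a y)) (r (op₁ x y))
    ⟨x, y, (hr _).symm, (hr _).symm, (hr _).symm⟩
  have hx : (h₂.mulRight b').symm (γ (op₁ x b)) = x' := (Equiv.symm_apply_eq _).2 hx'.symm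
  have hy : (h₂.mulLeft a').symm (γ (op₁ a y)) = y' := (Equiv.symm_apply_eq _).2 hy'.symm
  change op₂ ((h₂.mulRight b').symm (γ (op₁ x b))) ((h₂.mulLeft a').symm (γ (op₁ a y))) = _
  rw [hx, hy]
  exact hxy'

end Isotopy

/-! ### Strings for tables and certificates -/

section Pair

variable {x : List Bool} (y : List Bool) {i : ℕ}

theorem pair_cons (b : Bool) (x y : List Bool) : pair (b :: x) y = true :: b :: pair x y := rfl

theorem length_pair (x y : List Bool) : (pair x y).length = 2 * x.length + 1 + y.length := by
  induction x with
  | nil =>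
    rw [pair, List.flatMap_nil, List.nil_append, List.length_cons, List.length_nil]
    omega
  | cons b x ih => simp only [pair_cons, List.length_cons, ih]; omega

theorem getD_pair_two_mul (hi : i < x.length) : (pair x y).getD (2 * i) false = true := by
  induction x generalizing i with
  | nil => exact absurd hi (Nat.not_lt_zero i)
  | cons b x ih =>
    cases i with
    | zero => rfl
    | succ i =>
      rw [pair_cons, Nat.mul_succ, List.getD_cons_succ, List.getD_cons_succ]
      exact ih (Nat.lt_of_succ_lt_succ hi)

theorem getD_pair_two_mul_add_one (hi : i < x.length) :
    (pair x y).getD (2 * i + 1) false = x.getD i false := by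
  induction x generalizing i with
  | nil => exact absurd hi (Nat.not_lt_zero i)
  | cons b x ih =>
    cases i with
    | zero => rfl
    | succ i =>
      rw [pair_cons, Nat.mul_succ, List.getD_cons_succ, List.getD_cons_succ, List.getD_cons_succ]
      exact ih (Nat.lt_of_succ_lt_succ hi)

theorem getD_pair_separator (x y : List Bool) : (pair x y).getD (2 * x.length) false = false := by
  induction x with
  | nil => rfl
  | cons b x ih =>
    rw [pair_cons, List.length_cons, Nat.mul_succ, List.getD_cons_succ, List.getD_cons_succ, ih]

theorem getD_pair_right (x y : List Bool) (i : ℕ) :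
    (pair x y).getD (2 * x.length + 1 + i) false = y.getD i false := by
  induction x with
  | nil =>
    rw [List.length_nil, Nat.mul_zero, Nat.zero_add, Nat.add_comm]
    rfl
  | cons b x ih =>
    rw [pair_cons, List.length_cons,
      show 2 * (x.length + 1) + 1 + i = 2 * x.length + 1 + i + 2 by omega,
      List.getD_cons_succ, List.getD_cons_succ, ih]

end Pair

theorem mul_add_lt_mul {k m a t : ℕ} (ha : a < k) (ht : t < m) : a * m + t < k * m :=
  calc a * m + t < a * m + m := Nat.add_lt_add_left ht _
    _ = (a + 1) * m := (Nat.succ_mul a m).symm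
    _ ≤ k * m := Nat.mul_le_mul_right _ ha

section FlatMap

variable {β γ δ : Type*} {m : ℕ}

theorem length_flatMap_const {F : β → List γ} (hF : ∀ b, (F b).length = m) (l : List β) :
    (l.flatMap F).length = l.length * m := by
  simp only [List.length_flatMap, hF, List.map_const', List.sum_replicate, smul_eq_mul]

theorem getD_flatMap_const {F : β → List γ} (hF : ∀ b, (F b).length = m) {l : List β} {i j : ℕ}
    (hi : i < l.length) (hj : j < m) (d : γ) :
    (l.flatMap F).getD (i * m + j) d = (F l[i]).getD j d := by
  induction l generalizing i with
  | nil => exact absurd hi (Nat.not_lt_zero i)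
  | cons b l ih =>
    rw [List.flatMap_cons]
    cases i with
    | zero =>
      rw [Nat.zero_mul, Nat.zero_add, List.getD_append _ _ _ _ (by rwa [hF]),
        List.getElem_cons_zero]
    | succ i =>
      have hindex : (i + 1) * m + j = m + (i * m + j) := by ring
      rw [hindex, List.getD_append_right _ _ _ _ (by rw [hF]; omega), hF, Nat.add_sub_cancel_left,
        ih (Nat.lt_of_succ_lt_succ hi), List.getElem_cons_succ]

theorem getD_flatMap_flatMap_const {F : β → γ → List δ} (hF : ∀ b c, (F b c).length = m)
    {l : List β} {l' : List γ} {i j t : ℕ} (hi : i < l.length) (hj : j < l'.length) (ht : t < m)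
    (d : δ) :
    (l.flatMap fun b => l'.flatMap (F b)).getD ((i * l'.length + j) * m + t) d =
      (F l[i] l'[j]).getD t d := by
  have hindex : (i * l'.length + j) * m + t = i * (l'.length * m) + (j * m + t) := by ring
  rw [hindex, getD_flatMap_const (fun b => length_flatMap_const (hF b) l') hi
    (mul_add_lt_mul hj ht), getD_flatMap_const (hF _) hj ht]

end FlatMap

/-- The `⌈log₂ n⌉` lowest bits of `c`. -/
def bits (n c : ℕ) : List Bool := (List.range (Nat.clog 2 n)).map c.testBit

theorem length_bits (n c : ℕ) : (bits n c).length = Nat.clog 2 n := by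
  rw [bits, List.length_map, List.length_range]

theorem getD_bits {n t : ℕ} (c : ℕ) (ht : t < Nat.clog 2 n) :
    (bits n c).getD t false = c.testBit t := by
  rw [List.getD_eq_getElem _ _ (by rwa [length_bits])]
  simp only [bits, List.getElem_map, List.getElem_range]

theorem eq_of_testBit_clog {n a b : ℕ} (ha : a < n) (hb : b < n)
    (h : ∀ t < Nat.clog 2 n, a.testBit t = b.testBit t) : a = b := by
  have hn := Nat.le_pow_clog (b := 2) (by omega) n
  exact (eq_iff_forall_testBit_eq (ha.trans_le hn) (hb.trans_le hn)).2 h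

/-- The number of bits of a table. -/
def tableBits (n : ℕ) : ℕ := n * n * Nat.clog 2 n

/-- The length of the encoding of two tables. -/
def inputBits (n : ℕ) : ℕ := 3 * tableBits n + 1

/-- The number of elements in a row of a certificate: `a`, `b`, `u` and a cube of dimension
`2 ⌈log₂ n⌉`. -/
def rowLength (n : ℕ) : ℕ := 2 * Nat.clog 2 n + 3

theorem two_mul_le_inputBits (n : ℕ) : 2 * n ≤ inputBits n + 1 := by
  unfold inputBits tableBits
  rcases Nat.lt_or_ge n 2 with h | h
  · omega
  · have : n * n ≤ n * n * Nat.clog 2 n :=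
      Nat.le_mul_of_pos_right _ (Nat.clog_pos (by omega) h)
    nlinarith

theorem length_encodeTable {n : ℕ} (op : Fin n → Fin n → Fin n) :
    (encodeTable op).length = tableBits n := by
  have hrow (i : Fin n) :
      ((List.finRange n).flatMap fun j => bits n (op i j)).length = n * Nat.clog 2 n := by
    rw [length_flatMap_const fun j => length_bits n (op i j), List.length_finRange]
  calc (encodeTable op).length = (List.finRange n).length * (n * Nat.clog 2 n) :=
        length_flatMap_const hrow _
    _ = tableBits n := by rw [List.length_finRange, tableBits, mul_assoc]

theorem getD_encodeTable {n : ℕ} (op : Fin n → Fin n → Fin n) (a b : Fin n) {t : ℕ}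
    (ht : t < Nat.clog 2 n) :
    (encodeTable op).getD ((a * n + b) * Nat.clog 2 n + t) false = (op a b : ℕ).testBit t := by
  have := getD_flatMap_flatMap_const (F := fun i j => bits n (op i j)) (l := List.finRange n)
    (l' := List.finRange n) (i := a) (j := b) (fun i j => length_bits n (op i j))
    (by simp only [List.length_finRange, Fin.is_lt])
    (by simp only [List.length_finRange, Fin.is_lt]) ht false
  simp only [List.length_finRange, List.getElem_finRange, Fin.cast_mk, Fin.eta,
    getD_bits _ ht] at this
  exact this

theorem length_pair_encodeTable {n : ℕ} (op₀ op₁ : Fin n → Fin n → Fin n) :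
    (pair (encodeTable op₀) (encodeTable op₁)).length = inputBits n := by
  rw [length_pair, length_encodeTable, length_encodeTable, inputBits]
  ring

/-- A certificate as a string: two rows of elements. -/
def encodeCert {n : ℕ} (cert : ℕ → ℕ → Fin n) : List Bool :=
  (List.range 2).flatMap fun j => (List.range (rowLength n)).flatMap fun i => bits n (cert j i)

theorem length_encodeCert {n : ℕ} (cert : ℕ → ℕ → Fin n) :
    (encodeCert cert).length = 2 * (rowLength n * Nat.clog 2 n) := by
  have hrow (j : ℕ) : ((List.range (rowLength n)).flatMap fun i => bits n (cert j i)).length =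
      rowLength n * Nat.clog 2 n := by
    rw [length_flatMap_const fun i => length_bits n (cert j i), List.length_range]
  exact length_flatMap_const hrow _

theorem getD_encodeCert {n : ℕ} (cert : ℕ → ℕ → Fin n) {j i t : ℕ} (hj : j < 2)
    (hi : i < rowLength n) (ht : t < Nat.clog 2 n) :
    (encodeCert cert).getD ((j * rowLength n + i) * Nat.clog 2 n + t) false =
      (cert j i : ℕ).testBit t := by
  have := getD_flatMap_flatMap_const (F := fun j i => bits n (cert j i)) (l := List.range 2)
    (l' := List.range (rowLength n)) (fun j i => length_bits n (cert j i))
    (by rwa [List.length_range]) (by rwa [List.length_range]) ht false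
  simp only [List.length_range, List.getElem_range, getD_bits _ ht] at this
  exact this

/-- The position of bit `t` of entry `(a, b)` of table `j` in `pair (pair table₀ table₁) y`. -/
def tablePos (n j a b t : ℕ) : ℕ :=
  if j = 0 then 2 * (2 * ((a * n + b) * Nat.clog 2 n + t) + 1) + 1
  else 2 * (2 * tableBits n + 1 + ((a * n + b) * Nat.clog 2 n + t)) + 1

/-- The position of bit `t` of element `i` of row `j` of the certificate `y` in `pair x y`, where
`x` consists of two tables. -/
def certPos (n j i t : ℕ) : ℕ :=
  2 * inputBits n + 1 + ((j * rowLength n + i) * Nat.clog 2 n + t)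

/-- The `⌈log₂ n⌉` bits of `w` at the positions `pos 0, pos 1, …` are those of `c`. -/
def Reads (w : List Bool) (n : ℕ) (pos : ℕ → ℕ) (c : ℕ) : Prop :=
  ∀ t < Nat.clog 2 n, w.getD (pos t) false = c.testBit t

theorem Reads.iff_eq {w : List Bool} {n : ℕ} {pos : ℕ → ℕ} {c : Fin n} (h : Reads w n pos c)
    (c' : Fin n) : Reads w n pos c' ↔ c = c' :=
  ⟨fun h' => Fin.ext (eq_of_testBit_clog c.2 c'.2 fun t ht => (h t ht).symm.trans (h' t ht)),
    fun hc => hc ▸ h⟩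

/-- The input consists of two tables of order `n` and a certificate. -/
structure Format (w : List Bool) (n : ℕ) : Prop where
  length_le : inputBits n ≤ w.length
  input_mark : ∀ i < inputBits n, w.getD (2 * i) false = true
  input_end : w.getD (2 * inputBits n) false = false
  table_mark : ∀ i < tableBits n, w.getD (2 * (2 * i) + 1) false = true
  table_end : w.getD (2 * (2 * tableBits n) + 1) false = false

section Encoded

variable {n : ℕ} (op₀ op₁ : Fin n → Fin n → Fin n) (y : List Bool)

theorem entry_lt {t : ℕ} (a b : Fin n) (ht : t < Nat.clog 2 n) :
    (a * n + b) * Nat.clog 2 n + t < tableBits n :=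
  mul_add_lt_mul (mul_add_lt_mul a.2 b.2) ht

theorem exists_entry {p : ℕ} (h : p < tableBits n) :
    ∃ a b : Fin n, ∃ t < Nat.clog 2 n, (a * n + b) * Nat.clog 2 n + t = p := by
  have hL : 0 < Nat.clog 2 n := Nat.pos_of_mul_pos_left (Nat.zero_lt_of_lt h)
  have hdiv : p / Nat.clog 2 n < n * n :=
    Nat.div_lt_of_lt_mul (by rwa [tableBits, mul_comm] at h)
  have hn : 0 < n := Nat.pos_of_mul_pos_left (Nat.zero_lt_of_lt hdiv)
  refine ⟨⟨p / Nat.clog 2 n / n, Nat.div_lt_of_lt_mul hdiv⟩,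
    ⟨p / Nat.clog 2 n % n, Nat.mod_lt _ hn⟩, p % Nat.clog 2 n, Nat.mod_lt _ hL, ?_⟩
  simp only [Nat.div_add_mod']

theorem reads_tablePos_zero (a b : Fin n) :
    Reads (pair (pair (encodeTable op₀) (encodeTable op₁)) y) n (tablePos n 0 a b) (op₀ a b) := by
  intro t ht
  have hlt := entry_lt a b ht
  have hx := length_pair_encodeTable op₀ op₁
  rw [inputBits] at hx
  rw [← getD_encodeTable op₀ a b ht, tablePos, if_pos rfl, getD_pair_two_mul_add_one y (by omega),
    getD_pair_two_mul_add_one _ (by rwa [length_encodeTable])]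

theorem reads_tablePos_one (a b : Fin n) :
    Reads (pair (pair (encodeTable op₀) (encodeTable op₁)) y) n (tablePos n 1 a b) (op₁ a b) := by
  intro t ht
  have hlt := entry_lt a b ht
  have hx := length_pair_encodeTable op₀ op₁
  rw [inputBits] at hx
  rw [← getD_encodeTable op₁ a b ht, tablePos, if_neg one_ne_zero,
    getD_pair_two_mul_add_one y (by omega), ← getD_pair_right (encodeTable op₀) (encodeTable op₁),
    length_encodeTable]

theorem reads_certPos {x : List Bool} (hx : x.length = inputBits n) (cert : ℕ → ℕ → Fin n)
    {j i : ℕ} (hj : j < 2) (hi : i < rowLength n) :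
    Reads (pair x (encodeCert cert)) n (certPos n j i) (cert j i) := by
  intro t ht
  rw [certPos, ← hx, getD_pair_right, getD_encodeCert cert hj hi ht]

theorem format_pair : Format (pair (pair (encodeTable op₀) (encodeTable op₁)) y) n := by
  have hx := length_pair_encodeTable op₀ op₁
  have ht : (encodeTable op₀).length = tableBits n := length_encodeTable op₀
  have hinput : inputBits n = 3 * tableBits n + 1 := rfl
  refine ⟨by rw [length_pair]; omega, fun i hi => getD_pair_two_mul y (by omega),
    hx ▸ getD_pair_separator _ y, fun i hi => ?_, ?_⟩
  · rw [getD_pair_two_mul_add_one y (by omega), getD_pair_two_mul _ (by omega)]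
  · rw [getD_pair_two_mul_add_one y (by omega), ← ht, getD_pair_separator]

end Encoded

namespace Format

variable {x y : List Bool} {n : ℕ}

theorem length_eq (h : Format (pair x y) n) : x.length = inputBits n := by
  rcases lt_trichotomy x.length (inputBits n) with hlt | heq | hgt
  · exact absurd ((h.input_mark _ hlt).symm.trans (getD_pair_separator x y)) (by decide)
  · exact heq
  · exact absurd ((getD_pair_two_mul y hgt).symm.trans h.input_end) (by decide)

theorem getD_eq (h : Format (pair x y) n) {op₀ op₁ : Fin n → Fin n → Fin n}
    (h₀ : ∀ a b : Fin n, Reads (pair x y) n (tablePos n 0 a b) (op₀ a b))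
    (h₁ : ∀ a b : Fin n, Reads (pair x y) n (tablePos n 1 a b) (op₁ a b)) {k : ℕ}
    (hk : k < inputBits n) :
    x.getD k false = (pair (encodeTable op₀) (encodeTable op₁)).getD k false := by
  have hx := h.length_eq
  have ht : (encodeTable op₀).length = tableBits n := length_encodeTable op₀
  have hinput : inputBits n = 3 * tableBits n + 1 := rfl
  rw [← getD_pair_two_mul_add_one (x := x) y (by omega)]
  rcases lt_trichotomy k (2 * tableBits n) with hlt | rfl | hgt
  · rcases Nat.even_or_odd' k with ⟨i, rfl | rfl⟩
    · rw [getD_pair_two_mul (x := encodeTable op₀) _ (by omega), h.table_mark i (by omega)]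
    · obtain ⟨a, b, t, ht, rfl⟩ := exists_entry (show i < tableBits n by omega)
      rw [getD_pair_two_mul_add_one (x := encodeTable op₀) _ (by omega),
        getD_encodeTable op₀ a b ht, ← h₀ a b t ht, tablePos, if_pos rfl]
  · rw [h.table_end, ← ht, getD_pair_separator]
  · obtain ⟨i, rfl⟩ := Nat.exists_eq_add_of_le (show 2 * tableBits n + 1 ≤ k from hgt)
    obtain ⟨a, b, t, ht', rfl⟩ := exists_entry (show i < tableBits n by omega)
    have hright := getD_pair_right (encodeTable op₀) (encodeTable op₁)
    rw [ht] at hright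
    rw [hright, getD_encodeTable op₁ a b ht', ← h₁ a b t ht', tablePos, if_neg one_ne_zero]

theorem eq_pair (h : Format (pair x y) n) {op₀ op₁ : Fin n → Fin n → Fin n}
    (h₀ : ∀ a b : Fin n, Reads (pair x y) n (tablePos n 0 a b) (op₀ a b))
    (h₁ : ∀ a b : Fin n, Reads (pair x y) n (tablePos n 1 a b) (op₁ a b)) :
    x = pair (encodeTable op₀) (encodeTable op₁) := by
  have hlength := h.length_eq.trans (length_pair_encodeTable op₀ op₁).symm
  refine List.ext_getElem hlength fun k hk hk' => ?_
  rw [← List.getD_eq_getElem _ false hk, ← List.getD_eq_getElem _ false hk']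
  exact h.getD_eq h₀ h₁ (h.length_eq ▸ hk)

end Format

/-! ### A formula for isotopy -/

/-- The assignment for a call about the walk of `s` steps from `u` to `v` that starts with step `i`
and whose steps are selected by the bits of `e`, in table `j` of order `n`. Variable `0` tells such
calls from the main formula. The formulas below use variable `5` also for positions, `9` for the
index of a bit, `6`, `7`, `8`, `10`, …, `14` for elements, and `15`, `16`, `17` for the exponent
vectors of three walks. -/
def pathEnv (n j e s i u v : ℕ) : Env
  | 0 => 1
  | 1 => n
  | 2 => j
  | 3 => e
  | 4 => s
  | 5 => i
  | 6 => u
  | 7 => v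
  | _ => 0

namespace Formula

/-- The equivalence of two formulas. -/
def iff (φ ψ : Formula) : Formula := or (and φ ψ) (and (not φ) (not ψ))

/-- Existential quantification over the numbers below a bound. -/
def exLt (bound : Env → ℕ) (i : ℕ) (φ : Formula) : Formula :=
  ex i (and (num fun _ v => v i < bound v) φ)

/-- Universal quantification over the numbers below a bound. -/
def allLt (bound : Env → ℕ) (i : ℕ) (φ : Formula) : Formula :=
  all i (or (num fun _ v => bound v ≤ v i) φ)

/-- Existential quantification over the elements. -/
def exElem : ℕ → Formula → Formula := exLt fun v => v 1

/-- Universal quantification over the elements. -/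
def allElem : ℕ → Formula → Formula := allLt fun v => v 1

/-- The formula `φ` for table and row `j`. -/
def withRow (j : ℕ) (φ : Formula) : Formula := ex 2 (and (num fun _ v => v 2 = j) φ)

/-- The bits at the positions `pos v 0, pos v 1, …` are those of variable `c`. -/
def reads (pos : Env → ℕ → ℕ) (c : ℕ) : Formula :=
  allLt (fun v => Nat.clog 2 (v 1)) 9
    (iff (lit fun _ v => pos v (v 9)) (num fun _ v => (v c).testBit (v 9) = true))

/-- Entry `(a, b)` of the table is `c`, for variables `a`, `b` and `c`. -/
def entry (a b c : ℕ) : Formula := reads (fun v => tablePos (v 1) (v 2) (v a) (v b)) c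

/-- Element `d` of the certificate is variable `c`. -/
def certElem (d : Env → ℕ) (c : ℕ) : Formula := reads (fun v => certPos (v 1) (v 2) (d v)) c

/-- One step of a walk: the shift by a cube generator if it is selected. -/
def step : Formula :=
  or (num fun _ v => ¬(v 3).testBit (v 5) = true ∧ v 6 = v 7)
    (and (num fun _ v => (v 3).testBit (v 5) = true)
      (exElem 10 (exElem 11 (exElem 12 (and (certElem (fun _ => 1) 10)
        (and (certElem (fun v => v 5 + 3) 12) (and (entry 11 10 6) (entry 11 12 7))))))))

/-- A walk of any number of steps, by calls about its two halves. -/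
def path : Formula :=
  or (num fun _ v => v 4 = 0 ∧ v 6 = v 7)
    (or (and (num fun _ v => v 4 = 1) step)
      (and (num fun _ v => 2 ≤ v 4) (exElem 8
        (and (call fun _ v => pathEnv (v 1) (v 2) (v 3) (v 4 / 2) (v 5) (v 6) (v 8))
          (call fun _ v => pathEnv (v 1) (v 2) (v 3) (v 4 - v 4 / 2) (v 5 + v 4 / 2) (v 8)
            (v 7))))))

/-- The walk given by variable `e` ends in variable `c`. -/
def walkEnds (e c : ℕ) : Formula :=
  exElem 6 (and (certElem (fun _ => 2) 6)
    (call fun _ v => pathEnv (v 1) (v 2) (v e) (2 * Nat.clog 2 (v 1)) 0 (v 6) (v c)))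

/-- The loop equation between the ends of the walks given by variables `15`, `16` and `17`. -/
def loopTriple : Formula :=
  exElem 13 (exElem 14 (exElem 8
    (and (exElem 10 (exElem 7 (and (certElem (fun _ => 1) 10)
        (and (walkEnds 15 7) (entry 13 10 7)))))
      (and (exElem 10 (exElem 7 (and (certElem (fun _ => 0) 10)
          (and (walkEnds 16 7) (entry 10 14 7)))))
        (and (entry 13 14 8) (walkEnds 17 8))))))

/-- The separators and marks of the input are those of two tables and a certificate. -/
def format : Formula :=
  and (allLt (fun v => inputBits (v 1)) 5 (lit fun _ v => 2 * v 5))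
    (and (not (lit fun _ v => 2 * inputBits (v 1)))
      (and (allLt (fun v => tableBits (v 1)) 5 (lit fun _ v => 2 * (2 * v 5) + 1))
        (not (lit fun _ v => 2 * (2 * tableBits (v 1)) + 1))))

/-- The table is that of a quasigroup, the row of the certificate consists of elements, and the
walks reach everything. -/
def valid : Formula :=
  and (allElem 13 (allElem 14 (exElem 8 (entry 13 14 8))))
    (and (allElem 13 (allElem 8 (exElem 14 (entry 13 14 8))))
      (and (allElem 14 (allElem 8 (exElem 13 (entry 13 14 8))))
        (and (allLt (fun v => rowLength (v 1)) 5 (exElem 8 (certElem (fun v => v 5) 8)))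
          (allElem 8 (ex 15 (walkEnds 15 8))))))

/-- The input is a pair of tables with a certificate for isotopy, of an order that is given. -/
def certified : Formula :=
  and format (and (withRow 0 valid) (and (withRow 1 valid)
    (all 15 (all 16 (all 17 (or (not (withRow 0 loopTriple)) (withRow 1 loopTriple)))))))

/-- The input is a pair of tables with a certificate for isotopy. -/
def accept : Formula :=
  ex 1 (and (num fun N v => 0 < v 1 ∧ inputBits (v 1) ≤ N) certified)

/-- The formula to be iterated. -/
def isotopy : Formula :=
  or (and (num fun _ v => v 0 = 1) path) (and (num fun _ v => ¬v 0 = 1) accept)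

end Formula

namespace LogNat

variable {α : Type} [Ctx α] {n j a b i t e s u v : α → ℕ}

theorem tableBits (hn : LogNat n) : LogNat fun x => tableBits (n x) := (hn.mul hn).mul hn.clog

theorem inputBits (hn : LogNat n) : LogNat fun x => inputBits (n x) :=
  ((const 3).mul hn.tableBits).succ

theorem rowLength (hn : LogNat n) : LogNat fun x => rowLength (n x) :=
  ((const 2).mul hn.clog).add (const 3)

theorem tablePos (hn : LogNat n) (hj : LogNat j) (ha : LogNat a) (hb : LogNat b) (ht : LogNat t) :
    LogNat fun x => tablePos (n x) (j x) (a x) (b x) (t x) :=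
  have h := (((ha.mul hn).add hb).mul hn.clog).add ht
  ite (LogPred.eq hj zero) ((const 2).mul ((const 2).mul h).succ).succ
    ((const 2).mul (((const 2).mul hn.tableBits).succ.add h)).succ

theorem certPos (hn : LogNat n) (hj : LogNat j) (hi : LogNat i) (ht : LogNat t) :
    LogNat fun x => certPos (n x) (j x) (i x) (t x) :=
  ((const 2).mul hn.inputBits).succ.add ((((hj.mul hn.rowLength).add hi).mul hn.clog).add ht)

theorem pathEnv (hn : LogNat n) (hj : LogNat j) (he : LogNat e) (hs : LogNat s) (hi : LogNat i)
    (hu : LogNat u) (hv : LogNat v) (k : ℕ) :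
    LogNat fun x => pathEnv (n x) (j x) (e x) (s x) (i x) (u x) (v x) k :=
  match k with
  | 0 => const 1
  | 1 => hn
  | 2 => hj
  | 3 => he
  | 4 => hs
  | 5 => hi
  | 6 => hu
  | 7 => hv
  | _ + 8 => zero

end LogNat

namespace Formula

theorem uniform_iff {φ ψ : Formula} {D : ℕ} (hφ : φ.Uniform D) (hψ : ψ.Uniform D) :
    (iff φ ψ).Uniform D :=
  ⟨⟨hφ, hψ⟩, hφ, hψ⟩

section Quantifiers

variable {i D : ℕ} {φ : Formula} {bound : Env → ℕ}

theorem uniform_exLt (hb : LogTerm fun _ v => bound v) (hi : i < D) (h : φ.Uniform D) :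
    (exLt bound i φ).Uniform D :=
  ⟨hi, fun hv => .lt (hv i) (hb hv), h⟩

theorem uniform_allLt (hb : LogTerm fun _ v => bound v) (hi : i < D) (h : φ.Uniform D) :
    (allLt bound i φ).Uniform D :=
  ⟨hi, fun hv => .le (hb hv) (hv i), h⟩

theorem uniform_exElem (hi : i < D) (h : φ.Uniform D) : (exElem i φ).Uniform D :=
  uniform_exLt (fun hv => hv 1) hi h

theorem uniform_allElem (hi : i < D) (h : φ.Uniform D) : (allElem i φ).Uniform D :=
  uniform_allLt (fun hv => hv 1) hi h

theorem uniform_withRow (j : ℕ) (hD : 2 < D) (h : φ.Uniform D) : (withRow j φ).Uniform D :=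
  ⟨hD, fun hv => .eq (hv 2) (.const j), h⟩

end Quantifiers

theorem uniform_reads {pos : Env → ℕ → ℕ} (hpos : LogTerm fun _ v => pos v (v 9)) (c : ℕ) :
    (reads pos c).Uniform 18 :=
  uniform_allLt (fun hv => (hv 1).clog) (by omega)
    (uniform_iff hpos fun hv => .testBit (hv c) (hv 9))

theorem uniform_entry (a b c : ℕ) : (entry a b c).Uniform 18 :=
  uniform_reads (fun hv => .tablePos (hv 1) (hv 2) (hv a) (hv b) (hv 9)) c

theorem uniform_certElem {d : Env → ℕ} (hd : LogTerm fun _ v => d v) (c : ℕ) :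
    (certElem d c).Uniform 18 :=
  uniform_reads (fun hv => .certPos (hv 1) (hv 2) (hd hv) (hv 9)) c

theorem uniform_step : step.Uniform 18 :=
  ⟨fun hv => (LogPred.testBit (hv 3) (hv 5)).not.and (.eq (hv 6) (hv 7)),
    fun hv => .testBit (hv 3) (hv 5),
    uniform_exElem (by omega) <| uniform_exElem (by omega) <| uniform_exElem (by omega)
      ⟨uniform_certElem (fun _ => .const 1) _, uniform_certElem (fun hv => (hv 5).add (.const 3)) _,
        uniform_entry _ _ _, uniform_entry _ _ _⟩⟩

theorem uniform_path : path.Uniform 18 :=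
  ⟨fun hv => (LogPred.eq (hv 4) .zero).and (.eq (hv 6) (hv 7)),
    ⟨fun hv => .eq (hv 4) (.const 1), uniform_step⟩,
    fun hv => .le (.const 2) (hv 4), uniform_exElem (by omega)
      ⟨fun k _ _ _ hv => .pathEnv (hv 1) (hv 2) (hv 3) ((hv 4).div (.const 2)) (hv 5) (hv 6)
        (hv 8) k,
      fun k _ _ _ hv => .pathEnv (hv 1) (hv 2) (hv 3) ((hv 4).sub ((hv 4).div (.const 2)))
        ((hv 5).add ((hv 4).div (.const 2))) (hv 8) (hv 7) k⟩⟩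

theorem uniform_walkEnds (e c : ℕ) : (walkEnds e c).Uniform 18 :=
  uniform_exElem (by omega) ⟨uniform_certElem (fun _ => .const 2) _, fun k _ _ _ hv =>
    .pathEnv (hv 1) (hv 2) (hv e) (.mul (.const 2) (hv 1).clog) .zero (hv 6) (hv c) k⟩

theorem uniform_loopTriple : loopTriple.Uniform 18 :=
  uniform_exElem (by omega) <| uniform_exElem (by omega) <| uniform_exElem (by omega)
    ⟨uniform_exElem (by omega) <| uniform_exElem (by omega)
      ⟨uniform_certElem (fun _ => .const 1) _, uniform_walkEnds _ _, uniform_entry _ _ _⟩,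
    uniform_exElem (by omega) <| uniform_exElem (by omega)
      ⟨uniform_certElem (fun _ => .const 0) _, uniform_walkEnds _ _, uniform_entry _ _ _⟩,
    uniform_entry _ _ _, uniform_walkEnds _ _⟩

theorem uniform_format : format.Uniform 18 :=
  ⟨uniform_allLt (fun hv => (hv 1).inputBits) (by omega) fun hv => .mul (.const 2) (hv 5),
    fun hv => .mul (.const 2) (hv 1).inputBits,
    uniform_allLt (fun hv => (hv 1).tableBits) (by omega) fun hv =>
      .succ (.mul (.const 2) (.mul (.const 2) (hv 5))),
    fun hv => .succ (.mul (.const 2) (.mul (.const 2) (hv 1).tableBits))⟩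

theorem uniform_valid : valid.Uniform 18 :=
  have hentry := uniform_entry 13 14 8
  ⟨uniform_allElem (by omega) <| uniform_allElem (by omega) <| uniform_exElem (by omega) hentry,
    uniform_allElem (by omega) <| uniform_allElem (by omega) <| uniform_exElem (by omega) hentry,
    uniform_allElem (by omega) <| uniform_allElem (by omega) <| uniform_exElem (by omega) hentry,
    uniform_allLt (fun hv => (hv 1).rowLength) (by omega) <| uniform_exElem (by omega) <|
      uniform_certElem (fun hv => hv 5) _,
    uniform_allElem (by omega) ⟨by omega, uniform_walkEnds _ _⟩⟩

theorem uniform_certified : certified.Uniform 18 :=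
  ⟨uniform_format, uniform_withRow 0 (by omega) uniform_valid,
    uniform_withRow 1 (by omega) uniform_valid, by omega, by omega, by omega,
    uniform_withRow 0 (by omega) uniform_loopTriple,
    uniform_withRow 1 (by omega) uniform_loopTriple⟩

theorem uniform_accept : accept.Uniform 18 :=
  ⟨by omega, fun hv => (LogPred.lt .zero (hv 1)).and (.le (hv 1).inputBits .length),
    uniform_certified⟩

theorem uniform_isotopy : isotopy.Uniform 18 :=
  ⟨⟨fun hv => .eq (hv 0) (.const 1), uniform_path⟩,
    fun hv => (LogPred.eq (hv 0) (.const 1)).not, uniform_accept⟩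

end Formula

section

variable (w : List Bool) (R : Env → Prop) (n j : ℕ)

/-- The walk given by `e` in row `j` ends in `c`, if `R` tells walks. -/
def WalkEnds (e c : ℕ) : Prop :=
  ∃ u < n, Reads w n (certPos n j 2) u ∧
    R (normEnv (base w.length) 18 (pathEnv n j e (2 * Nat.clog 2 n) 0 u c))

/-- The loop equation between the ends of three walks in row `j`, if `R` tells walks. -/
def WalksLoopTriple (e₁ e₂ e₃ : ℕ) : Prop :=
  ∃ x < n, ∃ y < n, ∃ z < n,
    (∃ b < n, ∃ c < n, Reads w n (certPos n j 1) b ∧ WalkEnds w R n j e₁ c ∧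
      Reads w n (tablePos n j x b) c) ∧
    (∃ a < n, ∃ c < n, Reads w n (certPos n j 0) a ∧ WalkEnds w R n j e₂ c ∧
      Reads w n (tablePos n j a y) c) ∧
    Reads w n (tablePos n j x y) z ∧ WalkEnds w R n j e₃ z

/-- Table `j` is that of a quasigroup, row `j` of the certificate consists of elements, and the
walks in row `j` reach everything. -/
structure Valid : Prop where
  op : ∀ a < n, ∀ b < n, ∃ c < n, Reads w n (tablePos n j a b) c
  leftDiv : ∀ a < n, ∀ c < n, ∃ b < n, Reads w n (tablePos n j a b) c
  rightDiv : ∀ b < n, ∀ c < n, ∃ a < n, Reads w n (tablePos n j a b) c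
  cert : ∀ i < rowLength n, ∃ c < n, Reads w n (certPos n j i) c
  reach : ∀ c < n, ∃ e < base w.length, WalkEnds w R n j e c

/-- The input is a pair of tables of order `n` with a certificate for isotopy, if `R` tells
walks. -/
structure Accepts : Prop where
  pos : 0 < n
  format : Format w n
  valid_zero : Valid w R n 0
  valid_one : Valid w R n 1
  loopTriple : ∀ e₁ < base w.length, ∀ e₂ < base w.length, ∀ e₃ < base w.length,
    WalksLoopTriple w R n 0 e₁ e₂ e₃ → WalksLoopTriple w R n 1 e₁ e₂ e₃

end

theorem two_mul_add_three_lt_base (N : ℕ) : 2 * N + 3 < base N := by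
  unfold base
  nlinarith

theorem clog_le_self (n : ℕ) : Nat.clog 2 n ≤ n := Nat.clog_le_of_le_pow Nat.lt_two_pow_self.le

namespace Formula

variable {w : List Bool} {R : Env → Prop} {v : Env} {D i : ℕ} {φ ψ : Formula}

theorem eval_iff : (iff φ ψ).Eval D w R v ↔ (φ.Eval D w R v ↔ ψ.Eval D w R v) :=
  iff_iff_and_or_not_and_not.symm

section Quantifiers

variable {bound : Env → ℕ} (hbound : ∀ t, bound (Function.update v i t) = bound v)
  (hle : bound v ≤ base w.length)

include hbound hle

theorem eval_exLt : (exLt bound i φ).Eval D w R v ↔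
    ∃ t < bound v, φ.Eval D w R (Function.update v i t) := by
  simp only [exLt, Eval, Function.update_self, hbound]
  exact ⟨fun ⟨t, _, h⟩ => ⟨t, h⟩, fun ⟨t, h⟩ => ⟨t, h.1.trans_le hle, h⟩⟩

theorem eval_allLt : (allLt bound i φ).Eval D w R v ↔
    ∀ t < bound v, φ.Eval D w R (Function.update v i t) := by
  simp only [allLt, Eval, Function.update_self, hbound]
  exact ⟨fun h t ht => (h t (ht.trans_le hle)).resolve_left ht.not_ge,
    fun h t _ => (le_or_gt (bound v) t).imp_right (h t)⟩

end Quantifiers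

theorem eval_exElem (hi : 1 ≠ i) (hn : v 1 ≤ base w.length) :
    (exElem i φ).Eval D w R v ↔ ∃ t < v 1, φ.Eval D w R (Function.update v i t) :=
  eval_exLt (fun _ => Function.update_of_ne hi _ _) hn

theorem eval_allElem (hi : 1 ≠ i) (hn : v 1 ≤ base w.length) :
    (allElem i φ).Eval D w R v ↔ ∀ t < v 1, φ.Eval D w R (Function.update v i t) :=
  eval_allLt (fun _ => Function.update_of_ne hi _ _) hn

theorem eval_withRow {j : ℕ} (hj : j < base w.length) :
    (withRow j φ).Eval D w R v ↔ φ.Eval D w R (Function.update v 2 j) := by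
  simp only [withRow, Eval, Function.update_self]
  exact ⟨fun ⟨_, _, ht, h⟩ => ht ▸ h, fun h => ⟨j, hj, rfl, h⟩⟩

theorem eval_reads {pos : Env → ℕ → ℕ} {c : ℕ} (hpos : ∀ t, pos (Function.update v 9 t) = pos v)
    (hc : c ≠ 9) (hn : v 1 ≤ base w.length) :
    (reads pos c).Eval D w R v ↔ Reads w (v 1) (pos v) (v c) := by
  have hupdate (t : ℕ) : Function.update v 9 t 1 = v 1 := Function.update_of_ne (by omega) t v
  rw [reads, eval_allLt (fun t => by rw [hupdate]) ((clog_le_self _).trans hn)]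
  simp only [eval_iff, Eval, Function.update_self, Function.update_of_ne hc, hpos,
    ← Bool.eq_iff_iff]
  rfl

theorem eval_entry {a b c : ℕ} (ha : a ≠ 9) (hb : b ≠ 9) (hc : c ≠ 9) (hn : v 1 ≤ base w.length) :
    (entry a b c).Eval D w R v ↔ Reads w (v 1) (tablePos (v 1) (v 2) (v a) (v b)) (v c) :=
  eval_reads (fun t => by simp [Function.update_of_ne, ha, hb]) hc hn

theorem eval_certElem {d : Env → ℕ} {c : ℕ} (hd : ∀ t, d (Function.update v 9 t) = d v)
    (hc : c ≠ 9) (hn : v 1 ≤ base w.length) :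
    (certElem d c).Eval D w R v ↔ Reads w (v 1) (certPos (v 1) (v 2) (d v)) (v c) :=
  eval_reads (fun t => by simp [Function.update_of_ne, hd]) hc hn

theorem eval_walkEnds {e c : ℕ} (he : e ≠ 6) (hc : c ≠ 6) (hn : v 1 ≤ base w.length) :
    (walkEnds e c).Eval 18 w R v ↔ WalkEnds w R (v 1) (v 2) (v e) (v c) := by
  simp [walkEnds, Eval, eval_exElem, eval_certElem, hn, WalkEnds, Function.update_of_ne, he, hc]

theorem eval_step (hn : v 1 ≤ base w.length) : step.Eval D w R v ↔
    (¬(v 3).testBit (v 5) = true ∧ v 6 = v 7) ∨ ((v 3).testBit (v 5) = true ∧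
      ∃ b < v 1, ∃ z < v 1, ∃ h < v 1, Reads w (v 1) (certPos (v 1) (v 2) 1) b ∧
        Reads w (v 1) (certPos (v 1) (v 2) (v 5 + 3)) h ∧
        Reads w (v 1) (tablePos (v 1) (v 2) z b) (v 6) ∧
        Reads w (v 1) (tablePos (v 1) (v 2) z h) (v 7)) := by
  simp [step, Eval, eval_exElem, eval_certElem, eval_entry, hn]

theorem eval_loopTriple (hn : v 1 ≤ base w.length) : loopTriple.Eval 18 w R v ↔
    WalksLoopTriple w R (v 1) (v 2) (v 15) (v 16) (v 17) := by
  simp [loopTriple, Eval, eval_exElem, eval_certElem, eval_entry, eval_walkEnds, hn,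
    WalksLoopTriple]

theorem eval_valid (hn : v 1 ≤ w.length) : valid.Eval 18 w R v ↔ Valid w R (v 1) (v 2) := by
  have hbase := two_mul_add_three_lt_base w.length
  have hn' : v 1 ≤ base w.length := by omega
  have hrow : rowLength (v 1) ≤ base w.length := by
    have := clog_le_self (v 1)
    unfold rowLength
    omega
  simp only [valid, Eval, eval_exElem, eval_allElem, eval_allLt, eval_entry, eval_certElem,
    eval_walkEnds, Function.update_self, Function.update_of_ne, ne_eq, OfNat.one_ne_ofNat,
    Nat.reduceEqDiff, Nat.succ_ne_self, not_false_eq_true, implies_true, hn', hrow]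
  exact ⟨fun ⟨h₁, h₂, h₃, h₄, h₅⟩ => ⟨h₁, h₂, h₃, h₄, h₅⟩,
    fun ⟨h₁, h₂, h₃, h₄, h₅⟩ => ⟨h₁, h₂, h₃, h₄, h₅⟩⟩

theorem eval_format (hw : inputBits (v 1) ≤ w.length) :
    format.Eval D w R v ↔ Format w (v 1) := by
  have hbase := two_mul_add_three_lt_base w.length
  have hw' : inputBits (v 1) ≤ base w.length := by omega
  have htable : tableBits (v 1) ≤ inputBits (v 1) := by
    unfold inputBits
    omega
  simp only [format, Eval, eval_allLt, Function.update_self, Function.update_of_ne, ne_eq,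
    OfNat.one_ne_ofNat, not_false_eq_true, implies_true, hw', htable.trans hw', Bool.not_eq_true]
  exact ⟨fun ⟨h₁, h₂, h₃, h₄⟩ => ⟨hw, h₁, h₂, h₃, h₄⟩, fun ⟨_, h₁, h₂, h₃, h₄⟩ => ⟨h₁, h₂, h₃, h₄⟩⟩

theorem eval_certified (hpos : 0 < v 1) (hn : inputBits (v 1) ≤ w.length) :
    certified.Eval 18 w R v ↔ Accepts w R (v 1) := by
  have hbase := two_mul_add_three_lt_base w.length
  have htwo := two_mul_le_inputBits (v 1)
  have hle : v 1 ≤ w.length := by omega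
  have hle' : v 1 ≤ base w.length := by omega
  have hzero : 0 < base w.length := by omega
  have hone : 1 < base w.length := by omega
  simp only [certified, Eval, eval_format, eval_withRow, eval_valid, eval_loopTriple,
    Function.update_self, Function.update_of_ne, ne_eq, OfNat.one_ne_ofNat, Nat.reduceEqDiff,
    not_false_eq_true, ← imp_iff_not_or, hn, hle, hle', hzero, hone]
  exact ⟨fun ⟨h₁, h₂, h₃, h₄⟩ => ⟨hpos, h₁, h₂, h₃, h₄⟩,
    fun ⟨_, h₁, h₂, h₃, h₄⟩ => ⟨h₁, h₂, h₃, h₄⟩⟩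

theorem eval_accept : accept.Eval 18 w R v ↔ ∃ n, Accepts w R n := by
  simp only [accept, Eval, Function.update_self]
  constructor
  · rintro ⟨n, _, ⟨hpos, hn⟩, h⟩
    rw [eval_certified (by simpa using hpos) (by simpa using hn), Function.update_self] at h
    exact ⟨n, h⟩
  · rintro ⟨n, h⟩
    have hn : inputBits n ≤ w.length := h.format.length_le
    have hlt : n < base w.length := by
      have hbase := two_mul_add_three_lt_base w.length
      have htwo := two_mul_le_inputBits n
      omega
    refine ⟨n, hlt, ⟨h.pos, hn⟩, ?_⟩
    rwa [eval_certified (by simpa using h.pos) (by simpa using hn), Function.update_self]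

end Formula

theorem exists_lt_iff_exists_fin {n : ℕ} {p : ℕ → Prop} : (∃ i < n, p i) ↔ ∃ i : Fin n, p i := by
  simp only [Fin.exists_iff, exists_prop]

/-- Table `j` is that of `op`, and row `j` of the certificate is `cert`. -/
structure Decodes (w : List Bool) {n : ℕ} (j : ℕ) (op : Fin n → Fin n → Fin n) (cert : ℕ → Fin n) :
    Prop where
  row_lt : j < 2
  length_le : inputBits n ≤ w.length
  op_iff : ∀ a b c : Fin n, Reads w n (tablePos n j a b) c ↔ op a b = c
  cert_iff : ∀ i < rowLength n, ∀ c : Fin n, Reads w n (certPos n j i) c ↔ cert i = c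

section Walks

variable {n : ℕ} {op : Fin n → Fin n → Fin n}

/-- The steps of the walk that is given by `e`, for a row of a certificate: the elements of index
`0` and `1` are those which define the loop isotope, that of index `2` is the start of the walks,
and the others generate the cube. -/
noncomputable def certStep (hq : IsQuasigroup op) (cert : ℕ → Fin n) (e : ℕ) : ℕ → Fin n → Fin n :=
  hq.pick (cert 1) (fun i => cert (i + 3)) e

/-- The end of the walk that is given by `e`. -/
noncomputable def walkEnd (hq : IsQuasigroup op) (cert : ℕ → Fin n) (e : ℕ) : Fin n :=
  walk (certStep hq cert e) 0 (2 * Nat.clog 2 n) (cert 2)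

end Walks

/-- The relation `R` tells the ends of walks. -/
def WalkSpec (R : List Bool → Env → Prop) : Prop :=
  ∀ (w : List Bool) (n j : ℕ) (op : Fin n → Fin n → Fin n) (cert : ℕ → Fin n)
    (hq : IsQuasigroup op), Decodes w j op cert → ∀ e < base w.length, ∀ u v : Fin n,
    R w (normEnv (base w.length) 18 (pathEnv n j e (2 * Nat.clog 2 n) 0 u v)) ↔
      walk (certStep hq cert e) 0 (2 * Nat.clog 2 n) u = v

theorem normEnv_pathEnv {b n j e s i u v : ℕ} (hb : 1 < b) (hn : n < b) (hj : j < b) (he : e < b)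
    (hs : s < b) (hi : i < b) (hu : u < b) (hv : v < b) :
    normEnv b 18 (pathEnv n j e s i u v) = pathEnv n j e s i u v := by
  funext k
  unfold normEnv
  split
  · apply Nat.mod_eq_of_lt
    unfold pathEnv
    split <;> omega
  · unfold pathEnv
    split <;> omega

namespace Decodes

variable {w : List Bool} {n j : ℕ} {op : Fin n → Fin n → Fin n} {cert : ℕ → Fin n}

theorem two_mul_le (hD : Decodes w j op cert) : 2 * n ≤ w.length + 1 := by
  have := hD.length_le
  have := two_mul_le_inputBits n
  omega

theorem le_base (hD : Decodes w j op cert) : n ≤ base w.length := by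
  have := hD.two_mul_le
  have := two_mul_add_three_lt_base w.length
  omega

theorem normEnv_pathEnv (hD : Decodes w j op cert) {e s i : ℕ} (he : e < base w.length)
    (hs : s ≤ 2 * Nat.clog 2 n) (hi : i ≤ 2 * Nat.clog 2 n) (u v : Fin n) :
    normEnv (base w.length) 18 (pathEnv n j e s i u v) = pathEnv n j e s i u v := by
  have hn := hD.two_mul_le
  have hj := hD.row_lt
  have hbase := two_mul_add_three_lt_base w.length
  have hclog := clog_le_self n
  have hu := u.2
  have hv := v.2
  exact LatinIsotopy.normEnv_pathEnv (by omega) (by omega) (by omega) he (by omega) (by omega)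
    (by omega) (by omega)

theorem eval_step (hD : Decodes w j op cert) (hq : IsQuasigroup op) {R : Env → Prop} (e s : ℕ)
    {i : ℕ} (hi : i < 2 * Nat.clog 2 n) (u v : Fin n) :
    Formula.step.Eval 18 w R (pathEnv n j e s i u v) ↔ certStep hq cert e i u = v := by
  have hone : 1 < rowLength n := by
    unfold rowLength
    omega
  have hrow : i + 3 < rowLength n := Nat.add_lt_add_right hi 3
  rw [Formula.eval_step (by exact hD.le_base)]
  simp only [pathEnv, exists_lt_iff_exists_fin, hD.op_iff, hD.cert_iff _ hone,
    hD.cert_iff _ hrow, certStep, IsQuasigroup.pick]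
  split
  case isTrue ht => simp [ht, hq.shift_eq_iff]
  case isFalse hf => simp [hf, Fin.ext_iff]

variable {R : List Bool → Env → Prop}

theorem walkEnds_iff (hD : Decodes w j op cert) (hq : IsQuasigroup op) (hR : WalkSpec R) {e : ℕ}
    (he : e < base w.length) (c : Fin n) :
    WalkEnds w (R w) n j e c ↔ walkEnd hq cert e = c := by
  have htwo : 2 < rowLength n := by
    unfold rowLength
    omega
  simp only [WalkEnds, exists_lt_iff_exists_fin, hD.cert_iff _ htwo,
    hR w n j op cert hq hD e he, exists_eq_left', walkEnd]

theorem walksLoopTriple_iff (hD : Decodes w j op cert) (hq : IsQuasigroup op) (hR : WalkSpec R)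
    {e₁ e₂ e₃ : ℕ} (h₁ : e₁ < base w.length) (h₂ : e₂ < base w.length) (h₃ : e₃ < base w.length) :
    WalksLoopTriple w (R w) n j e₁ e₂ e₃ ↔
      LoopTriple op (cert 0) (cert 1) (walkEnd hq cert) e₁ e₂ e₃ := by
  have hone : 1 < rowLength n := by
    unfold rowLength
    omega
  simp only [WalksLoopTriple, exists_lt_iff_exists_fin, hD.cert_iff _ hone,
    hD.cert_iff _ hone.pos, hD.op_iff, hD.walkEnds_iff hq hR h₁, hD.walkEnds_iff hq hR h₂,
    hD.walkEnds_iff hq hR h₃, LoopTriple]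
  simp [eq_comm]

end Decodes

/-! ### Walks in logarithmic space -/

open Classical in
/-- The element reached after `t` steps from `u`: each step is to the last element which the
formula for steps allows, and there is only one. -/
noncomputable def follow (w : List Bool) (n j e u : ℕ) : ℕ → ℕ
  | 0 => u
  | t + 1 => Nat.findGreatest (fun z =>
      Formula.step.Eval 18 w (fun _ => False) (pathEnv n j e 0 t (follow w n j e u t) z)) (n - 1)

/-- The relation on assignments which tells walks by following them step by step. -/
def FollowRel (w : List Bool) (v : Env) : Prop :=
  follow w (v 1) (v 2) (v 3) (v 6) (2 * Nat.clog 2 (v 1)) = v 7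

theorem follow_le (w : List Bool) (n j e u t : ℕ) : follow w n j e u t ≤ u + n := by
  classical
  cases t with
  | zero => exact Nat.le_add_right _ _
  | succ t => exact (Nat.findGreatest_le _).trans (by omega)

theorem logPred_followRel {α : Type} [Ctx α] {v : α → Env} (hv : ∀ i, LogNat fun a => v a i) :
    LogPred fun a => FollowRel (inp a) (v a) := by
  classical
  have hstep : LogPred fun b : ((α × ℕ) × ℕ) × ℕ => Formula.step.Eval 18 (inp b) (fun _ => False)
      (pathEnv (v b.1.1.1 1) (v b.1.1.1 2) (v b.1.1.1 3) 0 b.1.1.2 b.1.2 b.2) :=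
    Formula.uniform_step.logPred (R := fun _ _ => False) (fun _ => .const False)
      (.pathEnv (hv 1).weaken.weaken.weaken (hv 2).weaken.weaken.weaken (hv 3).weaken.weaken.weaken
        .zero LogNat.snd.weaken.weaken LogNat.snd.weaken .snd)
  exact .eq (LogNat.recursion
    (f := fun a t => follow (inp a) (v a 1) (v a 2) (v a 3) (v a 6) t)
    (((hv 6).add (hv 1)).weaken.bounded.of_le fun _ => follow_le _ _ _ _ _ _) (hv 6)
    (.findGreatest hstep (hv 1).weaken.weaken.pred) (fun _ _ => by rw [follow]; congr)
    ((LogNat.const 2).mul (hv 1).clog)) (hv 7)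

theorem Decodes.follow_eq_walk {w : List Bool} {n j : ℕ} {op : Fin n → Fin n → Fin n}
    {cert : ℕ → Fin n} (hD : Decodes w j op cert) (hq : IsQuasigroup op) (e : ℕ) (u : Fin n)
    {t : ℕ} (ht : t ≤ 2 * Nat.clog 2 n) :
    follow w n j e u t = walk (certStep hq cert e) 0 t u := by
  classical
  induction t with
  | zero => rfl
  | succ t ih =>
    rw [follow, ih (by omega), walk, Nat.zero_add, Nat.findGreatest_eq_iff]
    refine ⟨by omega, fun _ => (hD.eval_step hq e 0 (by omega) _ _).2 rfl, fun z hz hzn h => ?_⟩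
    rw [(hD.eval_step hq e 0 (by omega) _ ⟨z, by omega⟩).1 h] at hz
    exact lt_irrefl _ hz

theorem walkSpec_followRel : WalkSpec FollowRel := by
  intro w n j op cert hq hD e he u v
  rw [hD.normEnv_pathEnv he le_rfl (Nat.zero_le _), Fin.ext_iff, ← hD.follow_eq_walk hq e u le_rfl]
  rfl

/-! ### Walks by repeated halving -/

theorem eval_isotopy_pathEnv {w : List Bool} {R : Env → Prop} {n j e s i u v : ℕ}
    (hn : n ≤ base w.length) : Formula.isotopy.Eval 18 w R (pathEnv n j e s i u v) ↔
      (s = 0 ∧ u = v) ∨ (s = 1 ∧ Formula.step.Eval 18 w R (pathEnv n j e s i u v)) ∨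
      (2 ≤ s ∧ ∃ z < n, R (normEnv (base w.length) 18 (pathEnv n j e (s / 2) i u z)) ∧
        R (normEnv (base w.length) 18 (pathEnv n j e (s - s / 2) (i + s / 2) z v))) := by
  have h0 : pathEnv n j e s i u v 0 = 1 := rfl
  simp only [Formula.isotopy, Formula.Eval, h0, true_and, not_true, false_and, or_false,
    Formula.path]
  exact or_congr Iff.rfl (or_congr Iff.rfl (and_congr_right fun _ =>
    Formula.eval_exElem (by omega) hn))

namespace Decodes

variable {w : List Bool} {n j : ℕ} {op : Fin n → Fin n → Fin n} {cert : ℕ → Fin n} {e s i : ℕ}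

theorem eval_isotopy_of_le_one (hD : Decodes w j op cert) (hq : IsQuasigroup op) {R : Env → Prop}
    (hs : s ≤ 1) (hi : i + s ≤ 2 * Nat.clog 2 n) (u v : Fin n) :
    Formula.isotopy.Eval 18 w R (pathEnv n j e s i u v) ↔
      walk (certStep hq cert e) i s u = v := by
  rw [eval_isotopy_pathEnv hD.le_base]
  obtain rfl | rfl := Nat.le_one_iff_eq_zero_or_eq_one.1 hs
  · simp [walk, Fin.ext_iff]
  · rw [hD.eval_step hq e 1 (by omega) u v]
    simp [walk]

theorem eval_isotopy_of_two_le (hD : Decodes w j op cert) (he : e < base w.length)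
    {R : Env → Prop} (hs : 2 ≤ s) (hi : i + s ≤ 2 * Nat.clog 2 n) (u v : Fin n) :
    Formula.isotopy.Eval 18 w R (pathEnv n j e s i u v) ↔ ∃ z : Fin n,
      R (pathEnv n j e (s / 2) i u z) ∧ R (pathEnv n j e (s - s / 2) (i + s / 2) z v) := by
  have h0 : s ≠ 0 := by omega
  have h1 : s ≠ 1 := by omega
  rw [eval_isotopy_pathEnv hD.le_base]
  simp only [h0, h1, hs, false_and, false_or, true_and, exists_lt_iff_exists_fin]
  refine exists_congr fun z => ?_
  rw [hD.normEnv_pathEnv he (by omega) (by omega), hD.normEnv_pathEnv he (by omega) (by omega)]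

theorem stage_pathEnv (hD : Decodes w j op cert) (hq : IsQuasigroup op) (he : e < base w.length)
    {ℓ : ℕ} (hs : s ≤ 2 ^ ℓ) (hi : i + s ≤ 2 * Nat.clog 2 n) (u v : Fin n) :
    Formula.isotopy.stage 18 w (ℓ + 1) (pathEnv n j e s i u v) ↔
      walk (certStep hq cert e) i s u = v := by
  induction ℓ generalizing s i u v with
  | zero => exact hD.eval_isotopy_of_le_one hq (by simpa using hs) hi u v
  | succ ℓ ih =>
    obtain h | h := lt_or_ge s 2
    · exact hD.eval_isotopy_of_le_one hq (by omega) hi u v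
    have hwalk := walk_add (certStep hq cert e) i (s / 2) (s - s / 2) u
    rw [Nat.add_sub_of_le (Nat.div_le_self s 2)] at hwalk
    rw [pow_succ] at hs
    rw [Formula.stage, hD.eval_isotopy_of_two_le he h hi, hwalk]
    have hfirst (z : Fin n) := ih (s := s / 2) (i := i) (by omega) (by omega) u z
    have hsecond (z : Fin n) := ih (s := s - s / 2) (i := i + s / 2) (by omega) (by omega) z v
    simp only [hfirst, hsecond, exists_eq_left']

end Decodes

theorem clog_le_log_add_one {n m : ℕ} (h : 2 * n ≤ m + 1) : Nat.clog 2 n ≤ Nat.log 2 m + 1 := by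
  rw [Nat.clog_le_iff_le_pow Nat.one_lt_two]
  have hm := Nat.lt_pow_succ_log_self Nat.one_lt_two m
  omega

theorem walkSpec_stage : WalkSpec fun w =>
    Formula.isotopy.stage 18 w (Nat.log 2 (Nat.log 2 w.length) + 3) := by
  intro w n j op cert hq hD e he u v
  rw [hD.normEnv_pathEnv he le_rfl (Nat.zero_le _)]
  refine hD.stage_pathEnv hq he ?_ (Nat.zero_add _).le u v
  have hclog := clog_le_log_add_one hD.two_mul_le
  have hlog := Nat.lt_pow_succ_log_self Nat.one_lt_two (Nat.log 2 w.length)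
  rw [pow_succ]
  omega

/-! ### Certificates for isotopy -/

theorem two_pow_le_base {n N : ℕ} (h : 2 * n ≤ N + 1) : 2 ^ (2 * Nat.clog 2 n) ≤ base N := by
  have hclog : 2 ^ Nat.clog 2 n ≤ N + 2 := by
    rcases le_or_gt n 1 with hn | hn
    · rw [Nat.clog_of_right_le_one hn, pow_zero]
      omega
    · obtain ⟨k, hk⟩ := Nat.exists_eq_succ_of_ne_zero (Nat.clog_pos one_lt_two hn).ne'
      have hlt := Nat.pow_pred_clog_lt_self one_lt_two hn
      rw [hk, Nat.pred_succ] at hlt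
      rw [hk, pow_succ]
      omega
  rw [mul_comm, pow_mul]
  exact Nat.pow_le_pow_left hclog 2

section Valid

variable {w : List Bool} {n j : ℕ}

theorem Decodes.valid {op : Fin n → Fin n → Fin n} {cert : ℕ → Fin n}
    {R : List Bool → Env → Prop} (hD : Decodes w j op cert) (hq : IsQuasigroup op)
    (hR : WalkSpec R) (h : ∀ c, ∃ e < base w.length, walkEnd hq cert e = c) :
    Valid w (R w) n j where
  op a ha b hb := ⟨_, (op ⟨a, ha⟩ ⟨b, hb⟩).2, (hD.op_iff ⟨a, ha⟩ ⟨b, hb⟩ _).2 rfl⟩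
  leftDiv a ha c hc :=
    let ⟨b, hb⟩ := (hq ⟨a, ha⟩ ⟨c, hc⟩).1.exists
    ⟨b, b.2, (hD.op_iff ⟨a, ha⟩ b ⟨c, hc⟩).2 hb⟩
  rightDiv b hb c hc :=
    let ⟨a, ha⟩ := (hq ⟨b, hb⟩ ⟨c, hc⟩).2.exists
    ⟨a, a.2, (hD.op_iff a ⟨b, hb⟩ ⟨c, hc⟩).2 ha⟩
  cert i hi := ⟨_, (cert i).2, (hD.cert_iff i hi _).2 rfl⟩
  reach c hc :=
    let ⟨e, he, hec⟩ := h ⟨c, hc⟩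
    ⟨e, he, (hD.walkEnds_iff hq hR he ⟨c, hc⟩).2 hec⟩

variable {R : Env → Prop}

theorem Valid.exists_isQuasigroup (h : Valid w R n j) : ∃ op : Fin n → Fin n → Fin n,
    IsQuasigroup op ∧ ∀ a b : Fin n, Reads w n (tablePos n j a b) (op a b) := by
  choose op hop using fun a b : Fin n => exists_lt_iff_exists_fin.1 (h.op a a.2 b b.2)
  have hleft (a : Fin n) : Function.Bijective (op a) :=
    Function.Surjective.bijective_of_finite fun c =>
      let ⟨b, hb⟩ := exists_lt_iff_exists_fin.1 (h.leftDiv a a.2 c c.2)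
      ⟨b, ((hop a b).iff_eq c).1 hb⟩
  have hright (b : Fin n) : Function.Bijective (op · b) :=
    Function.Surjective.bijective_of_finite fun c =>
      let ⟨a, ha⟩ := exists_lt_iff_exists_fin.1 (h.rightDiv b b.2 c c.2)
      ⟨a, ((hop a b).iff_eq c).1 ha⟩
  exact ⟨op, fun a c => ⟨(hleft a).existsUnique c, (hright a).existsUnique c⟩, hop⟩

theorem Valid.exists_decodes (h : Valid w R n j) (hn : 0 < n) (hj : j < 2)
    (hw : inputBits n ≤ w.length) :
    ∃ (op : Fin n → Fin n → Fin n) (cert : ℕ → Fin n), IsQuasigroup op ∧ Decodes w j op cert := by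
  obtain ⟨op, hq, hop⟩ := h.exists_isQuasigroup
  have hcert (i : ℕ) : ∃ c : Fin n, i < rowLength n → Reads w n (certPos n j i) c := by
    by_cases hi : i < rowLength n
    · obtain ⟨c, hc⟩ := exists_lt_iff_exists_fin.1 (h.cert i hi)
      exact ⟨c, fun _ => hc⟩
    · exact ⟨⟨0, hn⟩, fun h => absurd h hi⟩
  choose cert hcert using hcert
  exact ⟨op, cert, hq, hj, hw, fun a b => (hop a b).iff_eq, fun i hi => (hcert i hi).iff_eq⟩

end Valid

/-- The row of a certificate with the elements `a, b, u, h 0, h 1, …`. -/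
def certRow {G : Type*} (a b u : G) (h : ℕ → G) : ℕ → G
  | 0 => a
  | 1 => b
  | 2 => u
  | i + 3 => h i

/-- The certificate with the rows `r₀` and `r₁`. -/
def certRows {G : Type*} (r₀ r₁ : ℕ → G) : ℕ → ℕ → G
  | 0 => r₀
  | _ + 1 => r₁

section Isotopy

variable {n : ℕ} {op₀ op₁ : Fin n → Fin n → Fin n}

theorem decodes_zero (op₀ op₁ : Fin n → Fin n → Fin n) (cert : ℕ → ℕ → Fin n) :
    Decodes (pair (pair (encodeTable op₀) (encodeTable op₁)) (encodeCert cert)) 0 op₀ (cert 0) where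
  row_lt := two_pos
  length_le := (format_pair op₀ op₁ _).length_le
  op_iff a b := (reads_tablePos_zero op₀ op₁ _ a b).iff_eq
  cert_iff _ hi := (reads_certPos (length_pair_encodeTable op₀ op₁) cert two_pos hi).iff_eq

theorem decodes_one (op₀ op₁ : Fin n → Fin n → Fin n) (cert : ℕ → ℕ → Fin n) :
    Decodes (pair (pair (encodeTable op₀) (encodeTable op₁)) (encodeCert cert)) 1 op₁ (cert 1) where
  row_lt := one_lt_two
  length_le := (format_pair op₀ op₁ _).length_le
  op_iff a b := (reads_tablePos_one op₀ op₁ _ a b).iff_eq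
  cert_iff _ hi := (reads_certPos (length_pair_encodeTable op₀ op₁) cert one_lt_two hi).iff_eq

theorem loopTriple_of_isotopy {X : Type*} {α β γ : Fin n ≃ Fin n}
    (h : ∀ x y, op₁ (α x) (β y) = γ (op₀ x y)) {a b : Fin n} {T : X → Fin n} {e₁ e₂ e₃ : X}
    (ht : LoopTriple op₀ a b T e₁ e₂ e₃) :
    LoopTriple op₁ (α a) (β b) (fun e => γ (T e)) e₁ e₂ e₃ := by
  obtain ⟨x, y, h₁, h₂, h₃⟩ := ht
  exact ⟨α x, β y, by rw [h, h₁], by rw [h, h₂], by rw [h, h₃]⟩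

variable {R : List Bool → Env → Prop}

theorem accepts_of_isotopic (hR : WalkSpec R) (hn : 0 < n) (h₀ : IsQuasigroup op₀)
    (h₁ : IsQuasigroup op₁) (h : Isotopic op₀ op₁) : ∃ cert : ℕ → ℕ → Fin n,
      Accepts (pair (pair (encodeTable op₀) (encodeTable op₁)) (encodeCert cert))
        (R (pair (pair (encodeTable op₀) (encodeTable op₁)) (encodeCert cert))) n := by
  obtain ⟨α, β, γ, hiso⟩ := h
  let z : Fin n := ⟨0, hn⟩
  have : Nonempty (Fin n) := ⟨z⟩
  obtain ⟨g, hg⟩ := h₀.exists_cube z z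
  rw [Fintype.card_fin] at hg
  let cert := certRows (certRow z z z g) (certRow (α z) (β z) (γ z) fun i => β (g i))
  refine ⟨cert, ?_⟩
  have hD₀ := decodes_zero op₀ op₁ cert
  have hD₁ := decodes_one op₀ op₁ cert
  have hends (e : ℕ) : walkEnd h₁ (cert 1) e = γ (walkEnd h₀ (cert 0) e) :=
    h₀.walk_pick_isotopy h₁ hiso z g e 0 _ z
  have hreach (c : Fin n) := (hg c).imp fun e he =>
    And.imp_left (lt_of_lt_of_le · (two_pow_le_base hD₀.two_mul_le)) he
  refine ⟨hn, format_pair op₀ op₁ _, hD₀.valid h₀ hR hreach, hD₁.valid h₁ hR fun c => ?_,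
    fun e₁ he₁ e₂ he₂ e₃ he₃ => ?_⟩
  · obtain ⟨e, he, hec⟩ := hreach (γ.symm c)
    exact ⟨e, he, (hends e).trans ((congrArg γ hec).trans (γ.apply_symm_apply c))⟩
  · rw [hD₀.walksLoopTriple_iff h₀ hR he₁ he₂ he₃, hD₁.walksLoopTriple_iff h₁ hR he₁ he₂ he₃,
      funext hends]
    exact loopTriple_of_isotopy hiso

theorem mem_of_accepts (hR : WalkSpec R) {x y : List Bool}
    (h : Accepts (pair x y) (R (pair x y)) n) : x ∈ LatinSquareIsotopy := by
  obtain ⟨op₀, cert₀, h₀, hD₀⟩ := h.valid_zero.exists_decodes h.pos two_pos h.format.length_le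
  obtain ⟨op₁, cert₁, h₁, hD₁⟩ := h.valid_one.exists_decodes h.pos one_lt_two h.format.length_le
  refine ⟨n, n, op₀, op₁, h.pos, h.pos, h₀, h₁, ?_, h.format.eq_pair
    (fun a b => (hD₀.op_iff a b _).2 rfl) fun a b => (hD₁.op_iff a b _).2 rfl⟩
  refine isotopic_of_loopTriple_imp (X := {e // e < base (pair x y).length}) h₀ h₁ rfl
    (a := cert₀ 0) (b := cert₀ 1) (a' := cert₁ 0) (b' := cert₁ 1)
    (T := fun e => walkEnd h₀ cert₀ e) (T' := fun e => walkEnd h₁ cert₁ e) (fun c => ?_)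
    (fun c => ?_) ?_
  · obtain ⟨e, he, hec⟩ := h.valid_zero.reach c c.2
    exact ⟨⟨e, he⟩, (hD₀.walkEnds_iff h₀ hR he c).1 hec⟩
  · obtain ⟨e, he, hec⟩ := h.valid_one.reach c c.2
    exact ⟨⟨e, he⟩, (hD₁.walkEnds_iff h₁ hR he c).1 hec⟩
  · rintro ⟨e₁, he₁⟩ ⟨e₂, he₂⟩ ⟨e₃, he₃⟩ ht
    exact (hD₁.walksLoopTriple_iff h₁ hR he₁ he₂ he₃).1 (h.loopTriple e₁ he₁ e₂ he₂ e₃ he₃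
      ((hD₀.walksLoopTriple_iff h₀ hR he₁ he₂ he₃).2 ht))

theorem length_encodeCert_le (cert : ℕ → ℕ → Fin n) :
    (encodeCert cert).length ≤ 18 * Nat.log 2 (inputBits n) ^ 2 + 18 := by
  have hclog := clog_le_log_add_one (two_mul_le_inputBits n)
  rw [length_encodeCert, rowLength]
  calc 2 * ((2 * Nat.clog 2 n + 3) * Nat.clog 2 n)
      ≤ 2 * ((2 * (Nat.log 2 (inputBits n) + 1) + 3) * (Nat.log 2 (inputBits n) + 1)) := by gcongr
    _ ≤ 18 * Nat.log 2 (inputBits n) ^ 2 + 18 := by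
      nlinarith [Nat.le_self_pow two_ne_zero (Nat.log 2 (inputBits n))]

theorem mem_latinSquareIsotopy_iff (hR : WalkSpec R) (x : List Bool) :
    x ∈ LatinSquareIsotopy ↔ ∃ y : List Bool, y.length ≤ 18 * Nat.log 2 x.length ^ 2 + 18 ∧
      ∃ n, Accepts (pair x y) (R (pair x y)) n := by
  constructor
  · rintro ⟨n, m, op₀, op₁, hn, -, h₀, h₁, ⟨α, hα⟩, rfl⟩
    obtain rfl : n = m := by simpa using Fintype.card_congr α
    obtain ⟨cert, hcert⟩ := accepts_of_isotopic hR hn h₀ h₁ ⟨α, hα⟩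
    exact ⟨encodeCert cert, length_pair_encodeTable op₀ op₁ ▸ length_encodeCert_le cert, n, hcert⟩
  · exact fun ⟨_, _, _, h⟩ => mem_of_accepts hR h

end Isotopy

theorem latinSquareIsotopy_mem_beta_logSpace : LatinSquareIsotopy ∈ Beta 2 LogSpace := by
  refine ⟨{w | ∃ n, Accepts w (FollowRel w) n}, mem_logSpace ?_, 18,
    mem_latinSquareIsotopy_iff walkSpec_followRel⟩
  exact (Formula.uniform_accept.logPred (α := List Bool) (R := FollowRel) logPred_followRel
    (v := fun _ _ => 0) fun _ => .zero).congr fun _ => Formula.eval_accept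

theorem Formula.eval_isotopy_of_ne_one {w : List Bool} {R : Env → Prop} {v : Env} (h : v 0 ≠ 1) :
    isotopy.Eval 18 w R v ↔ ∃ n, Accepts w R n := by
  simp only [isotopy, Eval, h, false_and, not_false_eq_true, true_and, false_or, eval_accept]

theorem latinSquareIsotopy_mem_beta_FOLL : LatinSquareIsotopy ∈ Beta 2 FOLL := by
  refine ⟨{w | ∃ n, Accepts w
      (Formula.isotopy.stage 18 w (Nat.log 2 (Nat.log 2 w.length) + 3)) n},
    Formula.uniform_isotopy.mem_FOLL 3 fun w => ?_, 18, mem_latinSquareIsotopy_iff walkSpec_stage⟩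
  exact (Formula.eval_isotopy_of_ne_one zero_ne_one).symm

end LatinIsotopy

theorem theorem1 :
    LatinIsotopy.LatinSquareIsotopy ∈
      LatinIsotopy.Beta 2 LatinIsotopy.LogSpace ∩ LatinIsotopy.Beta 2 LatinIsotopy.FOLL :=
  ⟨LatinIsotopy.latinSquareIsotopy_mem_beta_logSpace,
    LatinIsotopy.latinSquareIsotopy_mem_beta_FOLL⟩
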